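/- **Setting.** Let $J\subset\mathbb R$ be an open set of times (for instance $J=(0,\infty)$). For $t\in J$ let $\Gamma(t)=\{(x,z)\in\mathbb R^2: z=h(x,t)\}$, $\Omega_\pm(t)=\{\pm(z-h(x,t))>0\}$, $\Omega_0=\{z>0\}$, and let $$n=\frac{(h_x,-1)}{\sqrt{1+h_x^2}},\qquad \kappa=\partial_x\frac{h_x}{\sqrt{1+h_x^2}},\qquad V=-\frac{h_t}{\sqrt{1+h_x^2}},\qquad ds=\sqrt{1+h_x^2}\,dx .$$ Let $(f,\Gamma)$ be a sufficiently regular solution on $J$ of the Mullins–Sekerka problem $$\Delta f=0\ \text{ in }\mathbb R^2\setminus\Gamma(t),\qquad f=\kappa\ \text{ on }\Gamma(t),\qquad V=-[\nabla f\cdot n]\ \text{ on }\Gamma(t),$$ where $[g]=g_+-g_-$ is the difference of the traces on $\Gamma(t)$ from $\Omega_+(t)$ and from $\Omega_-(t)$. Sufficiently regular means: $h$ is smooth on $\mathbb R\times J$; $f$ is smooth in $(x,z,t)$ up to $\Gamma$ from each side; and the functions $\partial_t^i\partial_x^jh$ ($i\le1$, $j\le2$) on $\mathbb R$, as well as $\nabla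 f$, $\nabla^2f$, $\nabla f_t$ on $\Omega_\pm(t)$ (evaluated at $(x,h(x,t)+y)$ and regarded as functions of $(x,y)$, $y\ne0$), are square integrable locally uniformly in time, i.e. near each $t_0\in J$ they are bounded in absolute value by a square integrable function independent of $t$. Define $$E=\int_{\mathbb R}\Big(\sqrt{1+h_x^2}-1\Big)dx,\qquad D=\int_{\mathbb R^2}|\nabla f|^2\,dx\,dz,\qquad H=\int_{\mathbb R^2}|\nabla\varphi|^2\,dx\,dz,$$ where $\varphi(\cdot,t)$ is a weak solution with $\nabla\varphi\in L^2(\mathbb R^2)$ of $-\Delta\varphi=\mathbf 1_{\Omega_+(t)}-\mathbf 1_{\Omega_0}$. **Lemma 4.1.** There are universal constants $\delta>0$ and $C<\infty$ such that, for every such solution and every $t\in J$ with $$\sup_{\mathbb R}|h_x(\cdot,t)|\le1\qquad\text{and}\qquad E(t)^2D(t)\le\delta ,$$ the following holds at time $t$: $E$ and $D$ are differentiable, $\int_\Gamma V_s^2\,ds<\infty$ (where $V_s$ is the derivative of $V$ with respect to arclength), and $$\frac{dE}{dt}=-D,\qquad \frac{dD}{dt}+\int_\Gamma V_s^2\,ds\le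 C\big(D^{5/2}+E\,D^3\big);$$ and, provided that $\varphi(\cdot,s)$ exists for all $s\in J$ (that is, the squared distance is finite), $H$ is differentiable at $t$ and $$\frac{dH}{dt}\le C\,H^{1/2}E^{1/6}D^{7/12}.$$ -/

import Mathlib

noncomputable section

namespace MullinsSekerka

open MeasureTheory Filter
open scoped Topology ContDiff

/-! Points of the plane are pairs `p = (x, z)`; the interface is the graph `z = η x`.  At a fixed
time `η : ℝ → ℝ` is the height and `g : ℝ × ℝ → ℝ` a function on the plane; time dependent objects
are `h : ℝ → ℝ → ℝ` (`h t x`) and `f : ℝ → ℝ × ℝ → ℝ` (`f t p`). -/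

/-- `∂ₓ g`. -/
def dx (g : ℝ × ℝ → ℝ) (p : ℝ × ℝ) : ℝ := fderiv ℝ g p (1, 0)

/-- `∂_z g`. -/
def dz (g : ℝ × ℝ → ℝ) (p : ℝ × ℝ) : ℝ := fderiv ℝ g p (0, 1)

/-- The Laplacian `∂ₓ∂ₓ g + ∂_z∂_z g`. -/
def lap (g : ℝ × ℝ → ℝ) (p : ℝ × ℝ) : ℝ := dx (dx g) p + dz (dz g) p

/-- The Dirichlet integral `∫_{ℝ²} |∇g|²` (the graph `Γ`, where the derivative of `g` may fail to
exist, is a null set). -/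
def dirichlet (g : ℝ × ℝ → ℝ) : ℝ := ∫ p : ℝ × ℝ, ((dx g p) ^ 2 + (dz g p) ^ 2)

/-- `Ω₊`, the region above the graph of `η`. -/
def upperPhase (η : ℝ → ℝ) : Set (ℝ × ℝ) := {p | η p.1 < p.2}

/-- `Ω₋`, the region below the graph of `η`. -/
def lowerPhase (η : ℝ → ℝ) : Set (ℝ × ℝ) := {p | p.2 < η p.1}

/-- The line element `ds/dx = √(1 + ηₓ²)` of the graph. -/
def lineElement (η : ℝ → ℝ) (x : ℝ) : ℝ := √(1 + (deriv η x) ^ 2)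

/-- The curvature `κ = ∂ₓ (ηₓ / √(1 + ηₓ²))` of the graph at `(x, η x)`. -/
def curvature (η : ℝ → ℝ) (x : ℝ) : ℝ := deriv (fun y => deriv η y / lineElement η y) x

/-- `∇g(p) · n(x)`, where `n(x) = (ηₓ, -1) / √(1 + ηₓ²)` is the unit normal of the graph at
`(x, η x)` that is outward with respect to `Ω₊`. -/
def normalComponent (η : ℝ → ℝ) (x : ℝ) (g : ℝ × ℝ → ℝ) (p : ℝ × ℝ) : ℝ :=
  (dx g p * deriv η x - dz g p) / lineElement η x

/-- `[∇g · n](x) = (∇g · n)₊ - (∇g · n)₋ = j`, with the one-sided traces on the graph taken as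
limits from `Ω₊` and from `Ω₋`. -/
def HasNormalJump (η : ℝ → ℝ) (g : ℝ × ℝ → ℝ) (x j : ℝ) : Prop :=
  ∃ a b : ℝ,
    Tendsto (normalComponent η x g) (𝓝[upperPhase η] (x, η x)) (𝓝 a) ∧
    Tendsto (normalComponent η x g) (𝓝[lowerPhase η] (x, η x)) (𝓝 b) ∧
    j = a - b

/-- The normal velocity `V = - h_t / √(1 + h_x²)` of the moving graph, in the direction `n`. -/
def normalVelocity (h : ℝ → ℝ → ℝ) (t x : ℝ) : ℝ :=
  -(deriv (fun s => h s x) t) / lineElement (h t) x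

/-- The arclength derivative `v_s` of a function `v` on the graph, as a function of `x`. -/
def arcDeriv (η : ℝ → ℝ) (v : ℝ → ℝ) (x : ℝ) : ℝ := deriv v x / lineElement η x

/-- The energy gap `E = ∫ (√(1 + ηₓ²) - 1) dx`. -/
def energy (η : ℝ → ℝ) : ℝ := ∫ x : ℝ, (lineElement η x - 1)

/-- `-Δφ = 1_{Ω₊} - 1_{Ω₀}` weakly on `ℝ²`, where `Ω₀ = {z > 0}`, with `∇φ` square integrable.
Weak solutions with a bounded right-hand side are `C¹`, so classical gradients may be used. -/
structure IsPotential (η : ℝ → ℝ) (φ : ℝ × ℝ → ℝ) : Prop where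
  contDiff : ContDiff ℝ 1 φ
  integrable : Integrable (fun p => (dx φ p) ^ 2 + (dz φ p) ^ 2)
  weak : ∀ ψ : ℝ × ℝ → ℝ, ContDiff ℝ ∞ ψ → HasCompactSupport ψ →
    ∫ p : ℝ × ℝ, (dx φ p * dx ψ p + dz φ p * dz ψ p) =
      ∫ p : ℝ × ℝ, ((upperPhase η).indicator (fun _ => (1 : ℝ)) p -
        (upperPhase (fun _ => 0)).indicator (fun _ => (1 : ℝ)) p) * ψ p

/-- Near each time of `J`, the functions `u t` are dominated on `S` by one `L²` function. -/
def LocallyDominated {X : Type} [MeasureSpace X] (J : Set ℝ) (S : Set X) (u : ℝ → X → ℝ) :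
    Prop :=
  ∀ t₀ ∈ J, ∃ g : X → ℝ, MemLp g 2 volume ∧ ∀ᶠ t in 𝓝 t₀, ∀ x ∈ S, |u t x| ≤ g x

/-- The point at signed vertical distance `q.2` from the graph, over `q.1`. -/
def shift (η : ℝ → ℝ) (q : ℝ × ℝ) : ℝ × ℝ := (q.1, η q.1 + q.2)

/-- Regularity of the height: `h` is smooth on `J × ℝ`, and `h` and `h_t` are in `H²(ℝ)`, locally
uniformly in time. -/
structure RegularHeight (J : Set ℝ) (h : ℝ → ℝ → ℝ) : Prop where
  smooth : ContDiffOn ℝ ∞ (fun y : ℝ × ℝ => h y.1 y.2) (J ×ˢ Set.univ)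
  sobolev : ∀ i ≤ 1, ∀ j ≤ 2, LocallyDominated J Set.univ
    (fun t x => iteratedDeriv j (fun y => iteratedDeriv i (fun s => h s y) t) x)

/-- Regularity of `f`: it is smooth in space and time up to the interface from each side, and in
both phases `∇f`, `∇²f` and `∇f_t` are square integrable, locally uniformly in time
(in coordinates in which the interface is at rest). -/
structure RegularField (J : Set ℝ) (h : ℝ → ℝ → ℝ) (f : ℝ → ℝ × ℝ → ℝ) : Prop where
  smooth_upper : ∃ F : ℝ × (ℝ × ℝ) → ℝ, ContDiffOn ℝ ∞ F (J ×ˢ Set.univ) ∧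
    ∀ t ∈ J, ∀ p : ℝ × ℝ, h t p.1 ≤ p.2 → f t p = F (t, p)
  smooth_lower : ∃ F : ℝ × (ℝ × ℝ) → ℝ, ContDiffOn ℝ ∞ F (J ×ˢ Set.univ) ∧
    ∀ t ∈ J, ∀ p : ℝ × ℝ, p.2 ≤ h t p.1 → f t p = F (t, p)
  grad : ∀ v : ℝ × ℝ, LocallyDominated J {q : ℝ × ℝ | q.2 ≠ 0}
    (fun t q => fderiv ℝ (f t) (shift (h t) q) v)
  hess : ∀ v w : ℝ × ℝ, LocallyDominated J {q : ℝ × ℝ | q.2 ≠ 0}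
    (fun t q => fderiv ℝ (fun p => fderiv ℝ (f t) p v) (shift (h t) q) w)
  grad_t : ∀ v : ℝ × ℝ, LocallyDominated J {q : ℝ × ℝ | q.2 ≠ 0}
    (fun t q => deriv (fun s => fderiv ℝ (f s) (shift (h t) q) v) t)

/-- A sufficiently regular solution `(f, Γ)` of the Mullins-Sekerka problem for times in `J`, with
`Γ(t)` the graph of `h t`. -/
structure IsSolution (J : Set ℝ) (h : ℝ → ℝ → ℝ) (f : ℝ → ℝ × ℝ → ℝ) : Prop where
  regular_height : RegularHeight J h
  regular_field : RegularField J h f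
  harmonic : ∀ t ∈ J, ∀ p ∈ upperPhase (h t) ∪ lowerPhase (h t), lap (f t) p = 0
  gibbs_thomson : ∀ t ∈ J, ∀ x : ℝ, f t (x, h t x) = curvature (h t) x
  velocity : ∀ t ∈ J, ∀ x : ℝ, HasNormalJump (h t) (f t) x (-normalVelocity h t x)

end MullinsSekerka

end

/-! The vertical shear `shift` straightens the interface and preserves area. At a fixed time it
turns the solution into a `FlatSolution` (`IsSolution.flatSolution`): with `p = f_x`, `q = f_z`, `u
= h_t`, the field `(p, q - η' p)` is square integrable, divergence free off the line `y = 0`, and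
has normal jump `u` there. All identities at one time come from Green's formula `green` for such
fields. A test function with square integrable gradient and trace grows at most like `√|y|`, so the
errors made by cutoffs stay bounded in L² and vanish pointwise, which makes them tend to zero
weakly.

Energy. Differentiating `E` gives `-∫ κ h_t`, and Green's formula tested with `f` itself, whose
trace is `κ`, identifies `∫ κ h_t` with `D`.

Dissipation. Testing with the time derivative of `f` in the moving coordinates gives `dD/dt = -2 ∫
h_tx² / ℓ³ - 2 ∫ h_tx f_x f_z`, where `ℓ` is the line element. Part of the first term pays for `∫
V_s²`. The cubic term is at most a multiple of `‖h_tx‖ D^{3/4} N^{1/4}`, where `N` is the squared L²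
norm of the tangential derivative of `∇f`. To bound `N`, the equation is differentiated in `x` and
tested with the tangential derivative of `f` (`second_order_identity`, `second_order_bound`). The
norms of the curvature and of `h_t` are interpolated with `pow_four_integral_mul_jump_le`, an
explicit form of the duality between H^{1/2} and H^{-1/2}. All powers then close by Young's
inequality in `exists_absorption`.

Squared distance. The source of `φ` moves according to the weak form of the problem, and `∇f` is
continuous in time in L². Together with the approximation of `φ` by compactly supported functions
this gives `dH/dt = -2 ∫ ∇f · ∇φ` (`IsExtension.hasDerivAt_potential`). Testing the equation of `φ`
with `f` localises the right-hand side to the region between the graph and the axis, where `f` is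
the curvature up to `√|y|`. Hence `∫ ∇f · ∇φ = -∫ h κ` up to an error `(∫ |h|³)^{1/2} D^{1/2}`
(`FlatSolution.pairing`). The term `-∫ h κ` is comparable to `∫ h_x²`: its sign makes it harmless
for `dH/dt`, and it also shows that `E² ≲ H D`. Finally `∫ |h|³` is interpolated between `H` and `∫
h_x²` by testing the equation of `φ` with `h` in a strip containing the graph
(`exists_height_bound`). The condition on `E² D` guarantees that the strip of optimal height does
contain the graph (`pow_le_of_interpolation`). -/

noncomputable section

namespace MullinsSekerka

open MeasureTheory Filter Set
open scoped Topology ContDiff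

/-! ### One-dimensional Sobolev inequalities and functions glued along a line -/

/-- The `L²` norm of a real function. -/
def l2norm {X : Type*} [MeasureSpace X] (f : X → ℝ) : ℝ := √(∫ x, f x ^ 2)

lemma l2norm_nonneg {X : Type*} [MeasureSpace X] (f : X → ℝ) : 0 ≤ l2norm f := Real.sqrt_nonneg _

lemma l2norm_sq {X : Type*} [MeasureSpace X] (f : X → ℝ) : l2norm f ^ 2 = ∫ x, f x ^ 2 :=
  Real.sq_sqrt (integral_nonneg fun _ => sq_nonneg _)

/-- The quadratic polynomial `c ↦ ∫ (f + c g)²` is nonnegative, so its discriminant is nonpositive.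
-/
lemma sq_integral_mul_le {X : Type*} [MeasurableSpace X] {μ : Measure X} {f g : X → ℝ}
    (hf : MemLp f 2 μ) (hg : MemLp g 2 μ) :
    (∫ x, f x * g x ∂μ) ^ 2 ≤ (∫ x, f x ^ 2 ∂μ) * ∫ x, g x ^ 2 ∂μ := by
  have hfg : Integrable (fun x => f x * g x) μ := hf.integrable_mul hg
  have key : ∀ c : ℝ, 0 ≤ (∫ x, g x ^ 2 ∂μ) * (c * c) + (2 * ∫ x, f x * g x ∂μ) * c
      + ∫ x, f x ^ 2 ∂μ := by
    intro c
    have h0 : 0 ≤ ∫ x, (f x + c * g x) ^ 2 ∂μ := integral_nonneg fun _ => sq_nonneg _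
    have h1 : ∫ x, (f x + c * g x) ^ 2 ∂μ
        = ∫ x, (f x ^ 2 + (2 * c) * (f x * g x)) + (c * c) * g x ^ 2 ∂μ := by
      congr 1; ext x; ring
    have h2 : Integrable (fun x => f x ^ 2 + (2 * c) * (f x * g x)) μ :=
      hf.integrable_sq.add (hfg.const_mul _)
    rw [h1, integral_add h2 (hg.integrable_sq.const_mul _),
      integral_add hf.integrable_sq (hfg.const_mul _), integral_const_mul, integral_const_mul] at h0
    linarith
  have := discrim_le_zero key
  simp only [discrim] at this
  nlinarith

lemma abs_integral_mul_le {X : Type*} [MeasureSpace X] {f g : X → ℝ}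
    (hf : MemLp f 2) (hg : MemLp g 2) :
    |∫ x, f x * g x| ≤ l2norm f * l2norm g := by
  apply abs_le_of_sq_le_sq _ (mul_nonneg (l2norm_nonneg _) (l2norm_nonneg _))
  rw [mul_pow, l2norm_sq, l2norm_sq]
  exact sq_integral_mul_le hf hg

lemma integral_abs_mul_le {X : Type*} [MeasureSpace X] {f g : X → ℝ}
    (hf : MemLp f 2) (hg : MemLp g 2) :
    ∫ x, |f x * g x| ≤ l2norm f * l2norm g := by
  have := abs_integral_mul_le hf.abs hg.abs
  simp only [l2norm, sq_abs, Pi.abs_apply] at this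
  refine le_trans (le_of_eq ?_) ((le_abs_self _).trans this)
  congr 1; ext x; rw [abs_mul]

lemma l2norm_le_of_le {X : Type*} [MeasureSpace X] {f g : X → ℝ} {c : ℝ} (hc : 0 ≤ c)
    (hg : MemLp g 2) (h : ∀ᵐ x, |f x| ≤ c * |g x|) : l2norm f ≤ c * l2norm g := by
  unfold l2norm
  rw [show c * √(∫ x, g x ^ 2) = √(∫ x, c ^ 2 * g x ^ 2) by
    rw [integral_const_mul, Real.sqrt_mul (sq_nonneg c), Real.sqrt_sq hc]]
  apply Real.sqrt_le_sqrt
  apply integral_mono_of_nonneg (Eventually.of_forall fun _ => sq_nonneg _)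
    (hg.integrable_sq.const_mul _)
  filter_upwards [h] with x hx
  rw [← mul_pow]
  apply sq_le_sq.2
  rwa [abs_mul, abs_of_nonneg hc]

lemma memLp_two_of_sq {X : Type*} [MeasurableSpace X] {μ : Measure X} {f : X → ℝ}
    (hm : AEStronglyMeasurable f μ) (h : Integrable (fun x => f x ^ 2) μ) : MemLp f 2 μ :=
  (memLp_two_iff_integrable_sq hm).2 h

/-- Functions bounded in `L²` that vanish eventually at every point tend to zero weakly. -/
lemma tendsto_integral_mul_of_eventually_zero {X : Type*} [MeasureSpace X] {b : X → ℝ}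
    {f : ℕ → X → ℝ} {C : ℝ} (hb : MemLp b 2) (hf : ∀ n, MemLp (f n) 2)
    (hC : ∀ n, ∫ x, f n x ^ 2 ≤ C) (h0 : ∀ᵐ x, ∀ᶠ n in atTop, f n x = 0) :
    Tendsto (fun n => ∫ x, f n x * b x) atTop (𝓝 0) := by
  classical
  -- `c n` is `b` cut down to the set where `f n` does not vanish. The pairing does not see the
  -- difference, and `c n → 0` in L² by dominated convergence. A strongly measurable representative
  -- of `f n` makes this set measurable.
  set c : ℕ → X → ℝ := fun n x => if (hf n).1.mk (f n) x = 0 then 0 else b x with hc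
  have hms : ∀ n, MeasurableSet {x | (hf n).1.mk (f n) x = 0} := fun n =>
    (hf n).1.stronglyMeasurable_mk.measurable (measurableSet_singleton 0)
  have hcm : ∀ n, AEStronglyMeasurable (c n) := fun n => by
    have : c n = indicator {x | (hf n).1.mk (f n) x = 0}ᶜ b := by
      ext x; simp only [hc, indicator, mem_compl_iff, mem_ofPred_eq]; split_ifs <;> simp_all
    rw [this]; exact hb.1.indicator (hms n).compl
  have hcb : ∀ n x, |c n x| ≤ |b x| := fun n x => by
    simp only [hc]; split_ifs <;> simp
  have hcL : ∀ n, MemLp (c n) 2 := fun n => hb.mono (hcm n) (Eventually.of_forall (hcb n))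
  have heq : ∀ n, ∫ x, f n x * b x = ∫ x, f n x * c n x := fun n => by
    apply integral_congr_ae
    filter_upwards [(hf n).1.ae_eq_mk] with x hx
    simp only [hc]; split_ifs with h
    · rw [hx, h]; simp
    · rfl
  have hlim : Tendsto (fun n => ∫ x, c n x ^ 2) atTop (𝓝 0) := by
    have := tendsto_integral_of_dominated_convergence (F := fun n x => c n x ^ 2)
      (f := fun _ => (0 : ℝ)) (μ := volume) (fun x => b x ^ 2) (fun n => (hcL n).integrable_sq.1)
      hb.integrable_sq (fun n => Eventually.of_forall fun x => by
        rw [Real.norm_eq_abs, abs_of_nonneg (sq_nonneg _)]; exact sq_le_sq.2 (hcb n x)) ?_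
    · simpa using this
    · have hall : ∀ᵐ x, ∀ n, f n x = (hf n).1.mk (f n) x :=
        ae_all_iff.2 fun n => (hf n).1.ae_eq_mk
      filter_upwards [h0, hall] with x hx hx'
      apply tendsto_const_nhds.congr'
      filter_upwards [hx] with n hn
      simp [hc, ← hx' n, hn]
  have hlim2 : Tendsto (fun n => √(C * ∫ x, c n x ^ 2)) atTop (𝓝 0) := by
    have := (hlim.const_mul C).sqrt
    simpa using this
  apply squeeze_zero_norm _ hlim2
  intro n
  rw [heq, Real.norm_eq_abs]
  apply Real.abs_le_sqrt
  refine (sq_integral_mul_le (hf n) (hcL n)).trans ?_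
  exact mul_le_mul_of_nonneg_right (hC n) (integral_nonneg fun _ => sq_nonneg _)

/-- Both `v²` and its derivative `2 v v'` are integrable on the half-line, so `v²` tends to zero at
infinity and `v(x)² = -2 ∫ v v'` over the half-line. -/
lemma sq_le_integral_Ioi {v v' : ℝ → ℝ} {x : ℝ} (hd : ∀ y ∈ Ici x, HasDerivAt v (v' y) y)
    (hv : MemLp v 2 (volume.restrict (Ioi x))) (hv' : MemLp v' 2 (volume.restrict (Ioi x))) :
    v x ^ 2 ≤ 2 * ∫ y in Ioi x, |v y * v' y| := by
  have hi : IntegrableOn (fun y => v y * v' y) (Ioi x) := hv.integrable_mul hv'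
  have hd2 : ∀ y ∈ Ici x, HasDerivAt (fun y => v y ^ 2) (2 * (v y * v' y)) y := fun y hy => by
    have := (hd y hy).fun_pow 2
    refine this.congr_deriv ?_
    push_cast; ring
  have h0 := tendsto_zero_of_hasDerivAt_of_integrableOn_Ioi (fun y hy => hd2 y (Ioi_subset_Ici_self hy))
    (hi.const_mul 2) hv.integrable_sq
  have h1 := integral_Ioi_of_hasDerivAt_of_tendsto' hd2 (hi.const_mul 2) h0
  rw [integral_const_mul] at h1
  have h2 : |∫ y in Ioi x, v y * v' y| ≤ ∫ y in Ioi x, |v y * v' y| := abs_integral_le_integral_abs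
  have := neg_abs_le (∫ y in Ioi x, v y * v' y)
  linarith

lemma sq_le_integral_line {v v' : ℝ → ℝ} (hd : ∀ y, HasDerivAt v (v' y) y)
    (hv : MemLp v 2) (hv' : MemLp v' 2) (x : ℝ) :
    v x ^ 2 ≤ 2 * ∫ y, |v y * v' y| := by
  refine (sq_le_integral_Ioi (fun y _ => hd y) (hv.restrict _) (hv'.restrict _)).trans ?_
  apply mul_le_mul_of_nonneg_left _ zero_le_two
  exact setIntegral_le_integral (hv.integrable_mul hv').abs (Eventually.of_forall fun _ => abs_nonneg _)

/-- Agmon's inequality, the source of every uniform bound on the height, its slope, and their rates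
of change. -/
lemma sq_le_l2norm_mul {v v' : ℝ → ℝ} (hd : ∀ y, HasDerivAt v (v' y) y)
    (hv : MemLp v 2) (hv' : MemLp v' 2) (x : ℝ) :
    v x ^ 2 ≤ 2 * (l2norm v * l2norm v') :=
  (sq_le_integral_line hd hv hv' x).trans
    (mul_le_mul_of_nonneg_left (integral_abs_mul_le hv hv') zero_le_two)

lemma ae_snd_ne (c : ℝ) : ∀ᵐ q : ℝ × ℝ, q.2 ≠ c := by
  have : ∀ᵐ y : ℝ, y ≠ c := by simp [ae_iff]
  exact Measure.quasiMeasurePreserving_snd.ae this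

lemma ae_fst {P : ℝ → Prop} (h : ∀ᵐ x : ℝ, P x) : ∀ᵐ q : ℝ × ℝ, P q.1 :=
  Measure.quasiMeasurePreserving_fst.ae h

lemma ae_snd {P : ℝ → Prop} (h : ∀ᵐ x : ℝ, P x) : ∀ᵐ q : ℝ × ℝ, P q.2 :=
  Measure.quasiMeasurePreserving_snd.ae h

lemma ae_memLp_slice_fst {v : ℝ × ℝ → ℝ} (hv : MemLp v 2) :
    ∀ᵐ x : ℝ, MemLp (fun y => v (x, y)) 2 := by
  have h1 : ∀ᵐ x : ℝ, Integrable (fun y => v (x, y) ^ 2) := hv.integrable_sq.prod_right_ae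
  have h2 : ∀ᵐ x : ℝ, AEStronglyMeasurable (fun y => v (x, y)) := hv.1.prodMk_left
  filter_upwards [h1, h2] with x h1 h2 using memLp_two_of_sq h2 h1

lemma ae_memLp_slice_snd {v : ℝ × ℝ → ℝ} (hv : MemLp v 2) :
    ∀ᵐ y : ℝ, MemLp (fun x => v (x, y)) 2 := by
  have : MemLp (fun q : ℝ × ℝ => v q.swap) 2 :=
    hv.comp_measurePreserving Measure.measurePreserving_swap
  exact ae_memLp_slice_fst this

/-- A weight depending on `x` only, against the square of a function with one derivative in `x`. -/
lemma integral_weight_mul_sq_le {w : ℝ → ℝ} {v vx : ℝ × ℝ → ℝ} (hw : Integrable w)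
    (hw0 : ∀ x, 0 ≤ w x) (hv : MemLp v 2) (hvx : MemLp vx 2)
    (hd : ∀ q : ℝ × ℝ, q.2 ≠ 0 → HasDerivAt (fun x => v (x, q.2)) (vx q) q.1) :
    Integrable (fun q : ℝ × ℝ => w q.1 * v q ^ 2) ∧
      ∫ q : ℝ × ℝ, w q.1 * v q ^ 2 ≤ (∫ x, w x) * (2 * (l2norm v * l2norm vx)) := by
  have hi : Integrable (fun q : ℝ × ℝ => |v q * vx q|) := (hv.integrable_mul hvx).abs
  -- On almost every horizontal line `v²` is bounded by `m(y)` uniformly in `x`, so the weight and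
  -- `m` separate under Fubini. With a squared weight this puts the product of `v` and an L²
  -- function of `x` into L².
  set m : ℝ → ℝ := fun y => 2 * ∫ x, |v (x, y) * vx (x, y)| with hm
  have hmi : Integrable m := (hi.integral_prod_right).const_mul 2
  have hmw : Integrable (fun q : ℝ × ℝ => w q.1 * m q.2) := hw.mul_prod hmi
  have hle : ∀ᵐ q : ℝ × ℝ, w q.1 * v q ^ 2 ≤ w q.1 * m q.2 := by
    filter_upwards [ae_snd (ae_memLp_slice_snd hv), ae_snd (ae_memLp_slice_snd hvx), ae_snd_ne 0]
      with q h1 h2 h3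
    apply mul_le_mul_of_nonneg_left _ (hw0 _)
    exact sq_le_integral_line (fun y => hd (y, q.2) h3) h1 h2 q.1
  have hint : Integrable (fun q : ℝ × ℝ => w q.1 * v q ^ 2) := by
    refine hmw.mono' ?_ ?_
    · exact (hw.1.comp_quasiMeasurePreserving Measure.quasiMeasurePreserving_fst).mul
        (hv.integrable_sq.1)
    · filter_upwards [hle] with q hq
      rwa [Real.norm_eq_abs, abs_of_nonneg (mul_nonneg (hw0 _) (sq_nonneg _))]
  refine ⟨hint, (integral_mono_ae hint hmw hle).trans ?_⟩
  have hp : ∫ q : ℝ × ℝ, w q.1 * m q.2 = (∫ x, w x) * ∫ y, m y := integral_prod_mul w m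
  rw [hp]
  apply mul_le_mul_of_nonneg_left _ (integral_nonneg hw0)
  rw [hm, integral_const_mul]
  apply mul_le_mul_of_nonneg_left _ zero_le_two
  have : ∫ y, ∫ x, |v (x, y) * vx (x, y)| = ∫ q : ℝ × ℝ, |v q * vx q| :=
    (integral_prod_symm _ hi).symm
  rw [this]
  exact integral_abs_mul_le hv hvx

/-- The function that is `G true` on `{0 < y}` and `G false` on `{y ≤ 0}`. -/
def glue (G : Bool → ℝ × ℝ → ℝ) (q : ℝ × ℝ) : ℝ := G (decide (0 < q.2)) q

lemma glue_of_pos (G : Bool → ℝ × ℝ → ℝ) {q : ℝ × ℝ} (h : 0 < q.2) : glue G q = G true q := by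
  simp [glue, h]

lemma glue_of_nonpos (G : Bool → ℝ × ℝ → ℝ) {q : ℝ × ℝ} (h : q.2 ≤ 0) :
    glue G q = G false q := by
  simp [glue, not_lt.2 h]

lemma measurable_glue {G : Bool → ℝ × ℝ → ℝ} (h : ∀ i, Measurable (G i)) :
    Measurable (glue G) := by
  have : glue G = fun q => if 0 < q.2 then G true q else G false q := by
    ext q; by_cases h : 0 < q.2 <;> simp [glue, h]
  rw [this]
  exact Measurable.ite (measurableSet_lt measurable_const measurable_snd) (h _) (h _)

/-- The trace on `{y = 0}` of a function that, with its `y`-derivative, is in `L²` above. -/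
lemma integral_trace_sq_le {v : ℝ × ℝ → ℝ} {V Vy : ℝ × ℝ → ℝ} (hc : ContDiff ℝ 1 v)
    (hV : MemLp V 2) (hVy : MemLp Vy 2) (h1 : ∀ q, 0 < q.2 → V q = v q)
    (h2 : ∀ q, 0 < q.2 → Vy q = dz v q) :
    MemLp (fun x => v (x, 0)) 2 ∧ ∫ x, v (x, 0) ^ 2 ≤ 2 * (l2norm V * l2norm Vy) := by
  have hi : Integrable (fun q : ℝ × ℝ => |V q * Vy q|) := (hV.integrable_mul hVy).abs
  have hmi : Integrable (fun x => 2 * ∫ y, |V (x, y) * Vy (x, y)|) :=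
    (hi.integral_prod_left).const_mul 2
  have hd : ∀ x y : ℝ, HasDerivAt (fun y => v (x, y)) (dz v (x, y)) y := fun x y => by
    have h1 : HasFDerivAt v (fderiv ℝ v (x, y)) (x, y) :=
      (hc.differentiable one_ne_zero _).hasFDerivAt
    have h2 : HasDerivAt (fun y : ℝ => (x, y)) ((0 : ℝ), (1 : ℝ)) y :=
      (hasDerivAt_const y x).prodMk (hasDerivAt_id y)
    exact h1.comp_hasDerivAt y h2
  -- Almost every vertical half-line admits the one-dimensional estimate; only values at `y > 0`
  -- enter, where `V` and `Vy` agree with `v` and its derivative.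
  have hle : ∀ᵐ x, v (x, 0) ^ 2 ≤ 2 * ∫ y, |V (x, y) * Vy (x, y)| := by
    filter_upwards [ae_memLp_slice_fst hV, ae_memLp_slice_fst hVy, hi.prod_right_ae] with x a1 a2 a3
    have e1 : MemLp (fun y => v (x, y)) 2 (volume.restrict (Ioi 0)) :=
      (a1.restrict (Ioi 0)).ae_eq (by
        filter_upwards [ae_restrict_mem measurableSet_Ioi] with y hy using h1 _ hy)
    have e2 : MemLp (fun y => dz v (x, y)) 2 (volume.restrict (Ioi 0)) :=
      (a2.restrict (Ioi 0)).ae_eq (by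
        filter_upwards [ae_restrict_mem measurableSet_Ioi] with y hy using h2 _ hy)
    refine (sq_le_integral_Ioi (fun y _ => hd x y) e1 e2).trans ?_
    apply mul_le_mul_of_nonneg_left _ zero_le_two
    refine le_trans (le_of_eq ?_) (setIntegral_le_integral (s := Ioi 0) a3 (Eventually.of_forall fun _ => abs_nonneg _))
    apply setIntegral_congr_fun measurableSet_Ioi
    intro y hy
    simp only [h1 (x, y) hy, h2 (x, y) hy]
  have hcont : Continuous (fun x : ℝ => v (x, 0)) := hc.continuous.comp (by fun_prop)
  have hint : Integrable (fun x => v (x, 0) ^ 2) := by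
    refine hmi.mono' (hcont.pow 2).aestronglyMeasurable ?_
    filter_upwards [hle] with x hx
    rwa [Real.norm_eq_abs, abs_of_nonneg (sq_nonneg _)]
  refine ⟨memLp_two_of_sq hcont.aestronglyMeasurable hint, (integral_mono_ae hint hmi hle).trans ?_⟩
  rw [integral_const_mul]
  apply mul_le_mul_of_nonneg_left _ zero_le_two
  have : ∫ x, ∫ y, |V (x, y) * Vy (x, y)| = ∫ q : ℝ × ℝ, |V q * Vy q| :=
    (integral_prod _ hi).symm
  rw [this]
  exact integral_abs_mul_le hV hVy

end MullinsSekerka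

end

/-! ### Green's formula for divergence free fields in L² -/

noncomputable section

namespace MullinsSekerka

open MeasureTheory Filter Set
open scoped Topology ContDiff

/-- The sign of `y` in the upper (`true`) and in the lower (`false`) half plane. -/
def sgn (i : Bool) : ℝ := if i then 1 else -1

lemma sgn_decide_mul_pos {y : ℝ} (h : y ≠ 0) : 0 < sgn (decide (0 < y)) * y := by
  rcases lt_or_gt_of_ne h with h | h
  · simp [sgn, not_lt.2 h.le, h]
  · simp [sgn, h]

lemma hasDerivAt_dx {v : ℝ × ℝ → ℝ} {q : ℝ × ℝ} (h : DifferentiableAt ℝ v q) :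
    HasDerivAt (fun x => v (x, q.2)) (dx v q) q.1 := by
  have h2 : HasDerivAt (fun x : ℝ => (x, q.2)) ((1 : ℝ), (0 : ℝ)) q.1 :=
    (hasDerivAt_id q.1).prodMk (hasDerivAt_const q.1 q.2)
  exact HasFDerivAt.comp_hasDerivAt q.1 (f := fun x : ℝ => (x, q.2)) (l := v) h.hasFDerivAt h2

lemma hasDerivAt_dz {v : ℝ × ℝ → ℝ} {q : ℝ × ℝ} (h : DifferentiableAt ℝ v q) :
    HasDerivAt (fun y => v (q.1, y)) (dz v q) q.2 := by
  have h2 : HasDerivAt (fun y : ℝ => (q.1, y)) ((0 : ℝ), (1 : ℝ)) q.2 :=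
    (hasDerivAt_const q.2 q.1).prodMk (hasDerivAt_id q.2)
  exact HasFDerivAt.comp_hasDerivAt q.2 (f := fun y : ℝ => (q.1, y)) (l := v) h.hasFDerivAt h2

lemma dx_mul {v w : ℝ × ℝ → ℝ} {q : ℝ × ℝ} (hv : DifferentiableAt ℝ v q)
    (hw : DifferentiableAt ℝ w q) : dx (fun q => v q * w q) q = v q * dx w q + w q * dx v q := by
  unfold dx; rw [fderiv_fun_mul hv hw]; simp

lemma dz_mul {v w : ℝ × ℝ → ℝ} {q : ℝ × ℝ} (hv : DifferentiableAt ℝ v q)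
    (hw : DifferentiableAt ℝ w q) : dz (fun q => v q * w q) q = v q * dz w q + w q * dz v q := by
  unfold dz; rw [fderiv_fun_mul hv hw]; simp

lemma continuous_dx {v : ℝ × ℝ → ℝ} (h : ContDiff ℝ 1 v) : Continuous (dx v) :=
  (h.continuous_fderiv one_ne_zero).clm_apply continuous_const

lemma continuous_dz {v : ℝ × ℝ → ℝ} (h : ContDiff ℝ 1 v) : Continuous (dz v) :=
  (h.continuous_fderiv one_ne_zero).clm_apply continuous_const

lemma hasCompactSupport_dx {v : ℝ × ℝ → ℝ} (h : HasCompactSupport v) : HasCompactSupport (dx v) :=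
  h.fderiv_apply (𝕜 := ℝ) _

lemma hasCompactSupport_dz {v : ℝ × ℝ → ℝ} (h : HasCompactSupport v) : HasCompactSupport (dz v) :=
  h.fderiv_apply (𝕜 := ℝ) _

lemma hasCompactSupport_slice_fst {v : ℝ × ℝ → ℝ} (h : HasCompactSupport v) (x : ℝ) :
    HasCompactSupport (fun y => v (x, y)) := by
  refine HasCompactSupport.of_support_subset_isCompact (h.isCompact.image continuous_snd) ?_
  intro y hy
  exact ⟨(x, y), subset_tsupport _ hy, rfl⟩

lemma hasCompactSupport_slice_snd {v : ℝ × ℝ → ℝ} (h : HasCompactSupport v) (y : ℝ) :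
    HasCompactSupport (fun x => v (x, y)) := by
  refine HasCompactSupport.of_support_subset_isCompact (h.isCompact.image continuous_fst) ?_
  intro x hx
  exact ⟨(x, y), subset_tsupport _ hx, rfl⟩

lemma integral_halfPlane_dx {X : ℝ × ℝ → ℝ} (hX : ContDiff ℝ 1 X) (hc : HasCompactSupport X)
    (S : Set ℝ) : ∫ q in univ ×ˢ S, dx X q = 0 := by
  have hi : Integrable (dx X) := (continuous_dx hX).integrable_of_hasCompactSupport
    (hasCompactSupport_dx hc)
  have hi' : Integrable (dx X) ((volume.restrict univ).prod (volume.restrict S)) := by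
    rw [Measure.prod_restrict]; exact hi.restrict
  rw [Measure.volume_eq_prod, ← Measure.prod_restrict, integral_prod_symm _ hi']
  apply integral_eq_zero_of_ae
  refine Eventually.of_forall fun y => ?_
  simp only [Measure.restrict_univ, Pi.zero_apply]
  have hsl : HasCompactSupport fun x => X (x, y) := hasCompactSupport_slice_snd hc y
  have hc1 : ContDiff ℝ 1 fun x : ℝ => X (x, y) := hX.comp (by fun_prop)
  apply integral_eq_zero_of_hasDerivAt_of_integrable (f := fun x => X (x, y))
  · exact fun x => hasDerivAt_dx (q := (x, y)) (hX.differentiable one_ne_zero _)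
  · exact ((continuous_dx hX).comp (by fun_prop : Continuous fun x : ℝ => (x, y))).integrable_of_hasCompactSupport
      (hasCompactSupport_slice_snd (hasCompactSupport_dx hc) y)
  · exact hc1.continuous.integrable_of_hasCompactSupport hsl

lemma integral_upper_dz {X : ℝ × ℝ → ℝ} (hX : ContDiff ℝ 1 X) (hc : HasCompactSupport X) :
    ∫ q in univ ×ˢ Ioi (0 : ℝ), dz X q = - ∫ x, X (x, 0) := by
  have hi : Integrable (dz X) := (continuous_dz hX).integrable_of_hasCompactSupport
    (hasCompactSupport_dz hc)
  have hi' : Integrable (dz X) ((volume.restrict univ).prod (volume.restrict (Ioi 0))) := by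
    rw [Measure.prod_restrict]; exact hi.restrict
  rw [Measure.volume_eq_prod, ← Measure.prod_restrict, integral_prod _ hi', ← integral_neg,
    Measure.restrict_univ]
  congr 1; ext x
  have hc1 : ContDiff ℝ 1 fun y : ℝ => X (x, y) := hX.comp (by fun_prop)
  have := (hasCompactSupport_slice_fst hc x).integral_Ioi_deriv_eq hc1 0
  rw [← this]
  congr 1; ext y
  exact (hasDerivAt_dz (q := (x, y)) (hX.differentiable one_ne_zero _)).deriv.symm

lemma integral_lower_dz {X : ℝ × ℝ → ℝ} (hX : ContDiff ℝ 1 X) (hc : HasCompactSupport X) :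
    ∫ q in univ ×ˢ Iic (0 : ℝ), dz X q = ∫ x, X (x, 0) := by
  have hi : Integrable (dz X) := (continuous_dz hX).integrable_of_hasCompactSupport
    (hasCompactSupport_dz hc)
  have hi' : Integrable (dz X) ((volume.restrict univ).prod (volume.restrict (Iic 0))) := by
    rw [Measure.prod_restrict]; exact hi.restrict
  rw [Measure.volume_eq_prod, ← Measure.prod_restrict, integral_prod _ hi',
    Measure.restrict_univ]
  congr 1; ext x
  have hc1 : ContDiff ℝ 1 fun y : ℝ => X (x, y) := hX.comp (by fun_prop)
  have := (hasCompactSupport_slice_fst hc x).integral_Iic_deriv_eq hc1 0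
  rw [← this]
  congr 1; ext y
  exact (hasDerivAt_dz (q := (x, y)) (hX.differentiable one_ne_zero _)).deriv.symm

/-- The divergence theorem for a compactly supported field that is smooth up to `{y = 0}` from
each side. -/
lemma integral_glue_div {X1 X2 : Bool → ℝ × ℝ → ℝ} (h1 : ∀ i, ContDiff ℝ 1 (X1 i))
    (h2 : ∀ i, ContDiff ℝ 1 (X2 i)) (c1 : ∀ i, HasCompactSupport (X1 i))
    (c2 : ∀ i, HasCompactSupport (X2 i)) :
    ∫ q, glue (fun i q => dx (X1 i) q + dz (X2 i) q) q =
      (∫ x, X2 false (x, 0)) - ∫ x, X2 true (x, 0) := by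
  have i1 : ∀ i, Integrable (dx (X1 i)) := fun i =>
    (continuous_dx (h1 i)).integrable_of_hasCompactSupport (hasCompactSupport_dx (c1 i))
  have i2 : ∀ i, Integrable (dz (X2 i)) := fun i =>
    (continuous_dz (h2 i)).integrable_of_hasCompactSupport (hasCompactSupport_dz (c2 i))
  have hU : MeasurableSet (univ ×ˢ Ioi (0 : ℝ) : Set (ℝ × ℝ)) := MeasurableSet.univ.prod measurableSet_Ioi
  have hcompl : (univ ×ˢ Ioi (0 : ℝ) : Set (ℝ × ℝ))ᶜ = univ ×ˢ Iic (0 : ℝ) := by ext q; simp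
  have e1 : EqOn (glue (fun i q => dx (X1 i) q + dz (X2 i) q))
      (fun q => dx (X1 true) q + dz (X2 true) q) (univ ×ˢ Ioi (0 : ℝ)) := fun q hq =>
    glue_of_pos _ hq.2
  have e2 : EqOn (glue (fun i q => dx (X1 i) q + dz (X2 i) q))
      (fun q => dx (X1 false) q + dz (X2 false) q) (univ ×ˢ Iic (0 : ℝ)) := fun q hq =>
    glue_of_nonpos _ hq.2
  have hi : Integrable (glue (fun i q => dx (X1 i) q + dz (X2 i) q)) := by
    refine (((i1 true).add (i2 true)).norm.add ((i1 false).add (i2 false)).norm).mono'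
      (measurable_glue fun i => ((continuous_dx (h1 i)).add
        (continuous_dz (h2 i))).measurable).aestronglyMeasurable (Eventually.of_forall fun q => ?_)
    simp only [glue, Pi.add_apply]
    rcases decide (0 < q.2) <;> simp
  rw [← integral_add_compl hU hi, hcompl, setIntegral_congr_fun hU e1,
    setIntegral_congr_fun (MeasurableSet.univ.prod measurableSet_Iic) e2,
    integral_add (i1 _).restrict (i2 _).restrict, integral_add (i1 _).restrict (i2 _).restrict,
    integral_halfPlane_dx (h1 _) (c1 _), integral_halfPlane_dx (h1 _) (c1 _),
    integral_upper_dz (h2 _) (c2 _), integral_lower_dz (h2 _) (c2 _)]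
  ring

/-! ### Cutoff functions -/

/-- A fixed smooth cutoff on the line. -/
def lineBump : ContDiffBump (0 : ℝ) := ⟨1, 2, one_pos, one_lt_two⟩

lemma exists_deriv_lineBump_bound : ∃ M : ℝ, 0 ≤ M ∧ ∀ x, |deriv lineBump x| ≤ M := by
  have hc : Continuous (deriv lineBump) :=
    (lineBump.contDiff (n := 1)).continuous_deriv le_rfl
  obtain ⟨M, hM⟩ := (lineBump.hasCompactSupport.deriv).exists_bound_of_continuous hc
  exact ⟨M, (norm_nonneg _).trans (hM 0), hM⟩

/-- Cutoff functions on the plane. -/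
def cutoff (n : ℕ) (q : ℝ × ℝ) : ℝ := lineBump (q.1 / (n + 1)) * lineBump (q.2 / (n + 1))

lemma lineBump_eq_zero {x : ℝ} (h : 2 ≤ |x|) : lineBump x = 0 :=
  lineBump.zero_of_le_dist (by simpa [lineBump] using h)

lemma lineBump_eq_one {x : ℝ} (h : |x| ≤ 1) : lineBump x = 1 :=
  lineBump.one_of_mem_closedBall (by simpa [lineBump] using h)

lemma contDiff_cutoff (n : ℕ) : ContDiff ℝ ∞ (cutoff n) := by
  have : ContDiff ℝ ∞ lineBump := lineBump.contDiff
  have h1 : ContDiff ℝ ∞ fun q : ℝ × ℝ => lineBump (q.1 / (n + 1)) := this.comp (by fun_prop)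
  have h2 : ContDiff ℝ ∞ fun q : ℝ × ℝ => lineBump (q.2 / (n + 1)) := this.comp (by fun_prop)
  exact h1.mul h2

lemma cutoff_mem_Icc (n : ℕ) (q : ℝ × ℝ) : cutoff n q ∈ Icc (0 : ℝ) 1 :=
  ⟨mul_nonneg lineBump.nonneg lineBump.nonneg,
    mul_le_one₀ lineBump.le_one lineBump.nonneg lineBump.le_one⟩

lemma cutoff_eq_zero_fst {n : ℕ} {q : ℝ × ℝ} (h : 2 * ((n : ℝ) + 1) ≤ |q.1|) :
    cutoff n q = 0 := by
  have hn : (0 : ℝ) < n + 1 := by positivity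
  have : lineBump (q.1 / (n + 1)) = 0 := lineBump_eq_zero (by
    rw [abs_div, abs_of_pos hn, le_div_iff₀ hn]; exact h)
  simp [cutoff, this]

lemma cutoff_eq_zero_snd {n : ℕ} {q : ℝ × ℝ} (h : 2 * ((n : ℝ) + 1) ≤ |q.2|) :
    cutoff n q = 0 := by
  have hn : (0 : ℝ) < n + 1 := by positivity
  have : lineBump (q.2 / (n + 1)) = 0 := lineBump_eq_zero (by
    rw [abs_div, abs_of_pos hn, le_div_iff₀ hn]; exact h)
  simp [cutoff, this]

lemma hasCompactSupport_cutoff (n : ℕ) : HasCompactSupport (cutoff n) := by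
  apply HasCompactSupport.of_support_subset_isCompact
    ((isCompact_Icc (a := -(2 * ((n : ℝ) + 1))) (b := 2 * ((n : ℝ) + 1))).prod
      (isCompact_Icc (a := -(2 * ((n : ℝ) + 1))) (b := 2 * ((n : ℝ) + 1))))
  intro q hq
  by_contra hcon
  simp only [mem_prod, mem_Icc, ← abs_le, not_and_or, not_le] at hcon
  rcases hcon with h | h
  · exact hq (cutoff_eq_zero_fst h.le)
  · exact hq (cutoff_eq_zero_snd h.le)

lemma dx_cutoff (n : ℕ) (q : ℝ × ℝ) : dx (cutoff n) q =
    deriv lineBump (q.1 / (n + 1)) / (n + 1) * lineBump (q.2 / (n + 1)) := by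
  have h := hasDerivAt_dx (((contDiff_cutoff n).differentiable (by simp)) q)
  have hb := ((lineBump.contDiff (n := 1)).differentiable one_ne_zero (q.1 / (n + 1))).hasDerivAt
  have h2 := (hb.comp q.1 ((hasDerivAt_id q.1).div_const ((n : ℝ) + 1))).mul_const
    (lineBump (q.2 / (n + 1)))
  rw [h.unique h2]; ring

lemma dz_cutoff (n : ℕ) (q : ℝ × ℝ) : dz (cutoff n) q =
    lineBump (q.1 / (n + 1)) * (deriv lineBump (q.2 / (n + 1)) / (n + 1)) := by
  have h := hasDerivAt_dz (((contDiff_cutoff n).differentiable (by simp)) q)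
  have hb := ((lineBump.contDiff (n := 1)).differentiable one_ne_zero (q.2 / (n + 1))).hasDerivAt
  have h2 := (hb.comp q.2 ((hasDerivAt_id q.2).div_const ((n : ℝ) + 1))).const_mul
    (lineBump (q.1 / (n + 1)))
  rw [h.unique h2]; ring

/-- At a zero the bump attains its minimum. This argument covers the endpoint `|x| = 2`, where the
bump need not vanish in a neighbourhood. -/
lemma deriv_lineBump_eq_zero {x : ℝ} (h : 2 ≤ |x|) : deriv lineBump x = 0 := by
  have hmin : IsLocalMin lineBump x := by
    refine Eventually.of_forall fun y => ?_
    rw [lineBump_eq_zero h]; exact lineBump.nonneg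
  exact hmin.deriv_eq_zero

lemma deriv_lineBump_eq_zero' {x : ℝ} (h : |x| ≤ 1) : deriv lineBump x = 0 := by
  have hmax : IsLocalMax lineBump x := by
    refine Eventually.of_forall fun y => ?_
    rw [lineBump_eq_one h]; exact lineBump.le_one
  exact hmax.deriv_eq_zero

/-- Error functions produced by differentiating cutoffs. -/
structure IsCutoffError (M : ℝ) (e : ℕ → ℝ × ℝ → ℝ) : Prop where
  bound : ∀ n q, |e n q| ≤ M / (n + 1)
  support : ∀ (n : ℕ) q, 2 * ((n : ℝ) + 1) ≤ |q.1| ∨ 2 * ((n : ℝ) + 1) ≤ |q.2| → e n q = 0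
  zero : ∀ (n : ℕ) q, |q.1| ≤ (n : ℝ) + 1 → |q.2| ≤ (n : ℝ) + 1 → e n q = 0

lemma IsCutoffError.eventually_zero {M : ℝ} {e : ℕ → ℝ × ℝ → ℝ} (h : IsCutoffError M e)
    (q : ℝ × ℝ) : ∀ᶠ n in atTop, e n q = 0 := by
  obtain ⟨N, hN⟩ := exists_nat_ge (max |q.1| |q.2|)
  filter_upwards [eventually_ge_atTop N] with n hn
  have : (N : ℝ) ≤ n := by exact_mod_cast hn
  exact h.zero n q (by linarith [le_max_left |q.1| |q.2|]) (by linarith [le_max_right |q.1| |q.2|])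

lemma exists_isCutoffError : ∃ M : ℝ, 0 ≤ M ∧ IsCutoffError M (fun n => dx (cutoff n)) ∧
    IsCutoffError M (fun n => dz (cutoff n)) := by
  obtain ⟨M, hM0, hM⟩ := exists_deriv_lineBump_bound
  have hsc : ∀ (n : ℕ) (x : ℝ), 2 * ((n : ℝ) + 1) ≤ |x| → 2 ≤ |x / (n + 1)| := fun n x h => by
    have hn : (0 : ℝ) < n + 1 := by positivity
    rw [abs_div, abs_of_pos hn, le_div_iff₀ hn]; exact h
  have hsc' : ∀ (n : ℕ) (x : ℝ), |x| ≤ (n : ℝ) + 1 → |x / (n + 1)| ≤ 1 := fun n x h => by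
    have hn : (0 : ℝ) < n + 1 := by positivity
    rw [abs_div, abs_of_pos hn, div_le_one hn]; exact h
  have habs : ∀ x, |lineBump x| ≤ 1 := fun x => by
    rw [abs_of_nonneg lineBump.nonneg]; exact lineBump.le_one
  refine ⟨M, hM0, ⟨fun n q => ?_, fun n q h => ?_, fun n q h1 h2 => ?_⟩,
    ⟨fun n q => ?_, fun n q h => ?_, fun n q h1 h2 => ?_⟩⟩
  · rw [dx_cutoff, abs_mul, abs_div, abs_of_pos (by positivity : (0 : ℝ) < n + 1)]
    have : |deriv lineBump (q.1 / (n + 1))| / (n + 1) ≤ M / (n + 1) := by gcongr; exact hM _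
    calc _ ≤ M / (n + 1) * 1 := mul_le_mul this (habs _) (abs_nonneg _) (by positivity)
      _ = _ := mul_one _
  · rw [dx_cutoff]
    rcases h with h | h
    · rw [deriv_lineBump_eq_zero (hsc n _ h)]; simp
    · rw [lineBump_eq_zero (hsc n _ h)]; simp
  · rw [dx_cutoff, deriv_lineBump_eq_zero' (hsc' n _ h1)]; simp
  · rw [dz_cutoff, abs_mul, abs_div, abs_of_pos (by positivity : (0 : ℝ) < n + 1)]
    have : |deriv lineBump (q.2 / (n + 1))| / (n + 1) ≤ M / (n + 1) := by gcongr; exact hM _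
    calc _ ≤ 1 * (M / (n + 1)) := mul_le_mul (habs _) this (by positivity) zero_le_one
      _ = _ := one_mul _
  · rw [dz_cutoff]
    rcases h with h | h
    · rw [lineBump_eq_zero (hsc n _ h)]; simp
    · rw [deriv_lineBump_eq_zero (hsc n _ h)]; simp
  · rw [dz_cutoff, deriv_lineBump_eq_zero' (hsc' n _ h2)]; simp

lemma tendsto_cutoff (q : ℝ × ℝ) : ∀ᶠ n in atTop, cutoff n q = 1 := by
  obtain ⟨N, hN⟩ := exists_nat_ge (max |q.1| |q.2|)
  filter_upwards [eventually_ge_atTop N] with n hn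
  have h1 : (N : ℝ) ≤ n := by exact_mod_cast hn
  have hn : (0 : ℝ) < n + 1 := by positivity
  have h2 : ∀ x : ℝ, |x| ≤ max |q.1| |q.2| → lineBump (x / (n + 1)) = 1 := fun x hx =>
    lineBump_eq_one (by rw [abs_div, abs_of_pos hn, div_le_one hn]; linarith)
  simp [cutoff, h2 _ (le_max_left _ _), h2 _ (le_max_right _ _)]

lemma tendsto_integral_cutoff_mul {Y : ℝ × ℝ → ℝ} (hY : Integrable Y) :
    Tendsto (fun n => ∫ q, cutoff n q * Y q) atTop (𝓝 (∫ q, Y q)) := by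
  apply tendsto_integral_of_dominated_convergence (fun q => |Y q|)
  · exact fun n => (contDiff_cutoff n).continuous.aestronglyMeasurable.mul hY.1
  · exact hY.abs
  · refine fun n => Eventually.of_forall fun q => ?_
    rw [norm_mul, Real.norm_eq_abs, Real.norm_eq_abs, abs_of_nonneg (cutoff_mem_Icc n q).1]
    exact mul_le_of_le_one_left (abs_nonneg _) (cutoff_mem_Icc n q).2
  · refine Eventually.of_forall fun q => ?_
    apply tendsto_const_nhds.congr'
    filter_upwards [tendsto_cutoff q] with n hn
    simp [hn]

/-- The error terms of cutoffs vanish in the limit for functions of moderate growth. -/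
lemma tendsto_integral_cutoff_error {M : ℝ} {e : ℕ → ℝ × ℝ → ℝ} (he : IsCutoffError M e)
    (hem : ∀ n, Measurable (e n)) {ψ b : ℝ × ℝ → ℝ} {α β : ℝ → ℝ}
    (hψ : AEStronglyMeasurable ψ) (hα : MemLp α 2) (hβ : MemLp β 2) (hb : MemLp b 2)
    (hle : ∀ᵐ q : ℝ × ℝ, |ψ q| ≤ α q.1 + √|q.2| * β q.1) :
    Tendsto (fun n => ∫ q, ψ q * e n q * b q) atTop (𝓝 0) := by
  -- `(ψ e_n)²` is bounded by `γ_n(x) I_n(y)`. With `R = n + 1`, the factor `R⁻²` meets a growth of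
  -- order `R` from `ψ²` and a strip of height `4 R`. This is the borderline case: the L² norms stay
  -- bounded but need not tend to zero, and only the weak limit against `b` vanishes.
  set γ : ℕ → ℝ → ℝ := fun n x =>
    (M / (n + 1)) ^ 2 * (2 * α x ^ 2 + 4 * ((n : ℝ) + 1) * β x ^ 2) with hγ
  set I : ℕ → ℝ → ℝ := fun n => indicator (Icc (-(2 * ((n : ℝ) + 1))) (2 * ((n : ℝ) + 1)))
    (fun _ => (1 : ℝ)) with hI
  have hγi : ∀ n, Integrable (γ n) := fun n =>
    ((hα.integrable_sq.const_mul 2).add (hβ.integrable_sq.const_mul _)).const_mul _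
  have hIi : ∀ n, Integrable (I n) := fun n =>
    (integrable_indicator_iff measurableSet_Icc).2 (by simp)
  have hprod : ∀ n, Integrable (fun q : ℝ × ℝ => γ n q.1 * I n q.2) := fun n =>
    (hγi n).mul_prod (hIi n)
  have hsq : ∀ n, ∀ᵐ q : ℝ × ℝ, (ψ q * e n q) ^ 2 ≤ γ n q.1 * I n q.2 := by
    intro n
    filter_upwards [hle] with q hq
    by_cases hs : |q.2| ≤ 2 * ((n : ℝ) + 1)
    · have h1 : I n q.2 = 1 := indicator_of_mem (s := Icc _ _) (abs_le.1 hs) _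
      rw [h1, mul_one, mul_pow, mul_comm]
      apply mul_le_mul _ _ (sq_nonneg _) (sq_nonneg _)
      · exact sq_le_sq.2 ((he.bound n q).trans (le_abs_self _))
      · have h2 : ψ q ^ 2 ≤ (α q.1 + √|q.2| * β q.1) ^ 2 :=
          sq_le_sq.2 (hq.trans (le_abs_self _))
        have h3 : √|q.2| ^ 2 = |q.2| := Real.sq_sqrt (abs_nonneg _)
        have h4 : (√|q.2| * β q.1) ^ 2 ≤ 2 * ((n : ℝ) + 1) * β q.1 ^ 2 := by
          rw [mul_pow, h3]; exact mul_le_mul_of_nonneg_right hs (sq_nonneg _)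
        nlinarith [sq_nonneg (α q.1 - √|q.2| * β q.1)]
    · rw [he.support n q (Or.inr (not_le.1 hs).le)]
      have : 0 ≤ γ n q.1 * I n q.2 := by
        apply mul_nonneg (by simp only [hγ]; positivity)
        exact indicator_nonneg (fun _ _ => zero_le_one) _
      simpa using this
  have hL : ∀ n, MemLp (fun q => ψ q * e n q) 2 := fun n => by
    have hm : AEStronglyMeasurable (fun q => ψ q * e n q) := hψ.mul (hem n).aestronglyMeasurable
    refine memLp_two_of_sq hm ((hprod n).mono' (hm.pow 2) ?_)
    filter_upwards [hsq n] with q hq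
    rwa [Real.norm_eq_abs, abs_of_nonneg (sq_nonneg _)]
  have hIint : ∀ n, ∫ y, I n y = 4 * ((n : ℝ) + 1) := fun n => by
    rw [hI, integral_indicator measurableSet_Icc]
    simp only [integral_const, MeasurableSet.univ, measureReal_restrict_apply, univ_inter,
      smul_eq_mul, mul_one, Real.volume_real_Icc]
    rw [max_eq_left (by have : (0 : ℝ) ≤ n := n.cast_nonneg
                        linarith)]
    ring
  apply tendsto_integral_mul_of_eventually_zero (C := M ^ 2 * (8 * (∫ x, α x ^ 2) + 16 * ∫ x, β x ^ 2)) hb hL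
  · intro n
    have hA : 0 ≤ ∫ x, α x ^ 2 := integral_nonneg fun _ => sq_nonneg _
    have hp : ∫ q : ℝ × ℝ, γ n q.1 * I n q.2 = (∫ x, γ n x) * ∫ y, I n y :=
      integral_prod_mul (γ n) (I n)
    refine (integral_mono_ae (hL n).integrable_sq (hprod n) (hsq n)).trans ?_
    rw [hp, hIint, hγ, integral_const_mul, integral_add (hα.integrable_sq.const_mul _)
      (hβ.integrable_sq.const_mul _), integral_const_mul, integral_const_mul]
    have hn : (0 : ℝ) < n + 1 := by positivity
    have hn1 : (1 : ℝ) ≤ n + 1 := by have : (0 : ℝ) ≤ n := n.cast_nonneg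
                                     linarith
    have e1 : (M / ((n : ℝ) + 1)) ^ 2 * (2 * (∫ x, α x ^ 2) + 4 * ((n : ℝ) + 1) * ∫ x, β x ^ 2) *
        (4 * ((n : ℝ) + 1)) = M ^ 2 * (8 * (∫ x, α x ^ 2) / ((n : ℝ) + 1) + 16 * ∫ x, β x ^ 2) := by
      field_simp; ring
    rw [e1]
    apply mul_le_mul_of_nonneg_left _ (sq_nonneg _)
    gcongr
    exact div_le_self (by positivity) hn1
  · refine Eventually.of_forall fun q => ?_
    filter_upwards [he.eventually_zero q] with n hn
    simp [hn]

/-- Growth in `y` of a function with square integrable `y`-derivative. -/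
lemma exists_growth_bound {Ψ : Bool → ℝ × ℝ → ℝ} {ψ₀ : ℝ → ℝ} (hΨ : ∀ i, ContDiff ℝ 1 (Ψ i))
    (htr : ∀ i x, Ψ i (x, 0) = ψ₀ x) (hy : MemLp (glue fun i => dz (Ψ i)) 2) :
    ∃ β : ℝ → ℝ, (∀ x, 0 ≤ β x) ∧ MemLp β 2 ∧ l2norm β = l2norm (glue fun i => dz (Ψ i)) ∧
      ∀ᵐ x : ℝ, ∀ y : ℝ, |glue Ψ (x, y) - ψ₀ x| ≤ √|y| * β x := by
  set V := glue fun i => dz (Ψ i) with hV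
  -- `β(x)` is the L² norm of the `y`-derivative on the vertical line over `x`. Integrating from the
  -- trace and using Cauchy-Schwarz on an interval of length `|y|` gives the square root growth.
  refine ⟨fun x => √(∫ y, V (x, y) ^ 2), fun x => Real.sqrt_nonneg _, ?_, ?_, ?_⟩
  · have hi : Integrable fun x => ∫ y, V (x, y) ^ 2 := hy.integrable_sq.integral_prod_left
    refine memLp_two_of_sq ?_ ?_
    · exact Real.continuous_sqrt.comp_aestronglyMeasurable hi.1
    · refine hi.congr (Eventually.of_forall fun x => ?_)
      exact (Real.sq_sqrt (integral_nonneg fun _ => sq_nonneg _)).symm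
  · unfold l2norm
    congr 1
    rw [Measure.volume_eq_prod, integral_prod _ hy.integrable_sq]
    congr 1; ext x
    exact Real.sq_sqrt (integral_nonneg fun _ => sq_nonneg _)
  · filter_upwards [ae_memLp_slice_fst hy] with x hx y
    have hd : ∀ i y, HasDerivAt (fun y => Ψ i (x, y)) (dz (Ψ i) (x, y)) y := fun i y =>
      hasDerivAt_dz (q := (x, y)) ((hΨ i).differentiable one_ne_zero _)
    have hc : ∀ i, Continuous fun y => dz (Ψ i) (x, y) := fun i =>
      (continuous_dz (hΨ i)).comp (by fun_prop)
    have key : ∃ c d : ℝ, c ≤ d ∧ d - c = |y| ∧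
        |glue Ψ (x, y) - ψ₀ x| ≤ |∫ s in Ioc c d, V (x, s)| := by
      rcases le_or_gt y 0 with h | h
      · refine ⟨y, 0, h, by rw [abs_of_nonpos h]; ring, ?_⟩
        have h1 := intervalIntegral.integral_eq_sub_of_hasDerivAt (a := y) (b := 0)
          (fun s _ => hd false s) ((hc false).intervalIntegrable _ _)
        rw [intervalIntegral.integral_of_le h] at h1
        rw [glue_of_nonpos Ψ (q := (x, y)) h, ← htr false x, abs_sub_comm, ← h1]
        apply le_of_eq; congr 1
        exact setIntegral_congr_fun measurableSet_Ioc fun s hs =>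
          (glue_of_nonpos (fun i => dz (Ψ i)) (q := (x, s)) hs.2).symm
      · refine ⟨0, y, h.le, by rw [abs_of_pos h]; ring, ?_⟩
        have h1 := intervalIntegral.integral_eq_sub_of_hasDerivAt (a := 0) (b := y)
          (fun s _ => hd true s) ((hc true).intervalIntegrable _ _)
        rw [intervalIntegral.integral_of_le h.le] at h1
        rw [glue_of_pos Ψ (q := (x, y)) h, ← htr true x, ← h1]
        apply le_of_eq; congr 1
        exact setIntegral_congr_fun measurableSet_Ioc fun s hs =>
          (glue_of_pos (fun i => dz (Ψ i)) (q := (x, s)) hs.1).symm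
    obtain ⟨c, d, hcd, hlen, hle⟩ := key
    refine hle.trans ?_
    rw [← Real.sqrt_mul (abs_nonneg _)]
    apply Real.abs_le_sqrt
    have hone : MemLp (fun _ : ℝ => (1 : ℝ)) 2 (volume.restrict (Ioc c d)) := memLp_const 1
    have h2 := sq_integral_mul_le hone (hx.restrict (Ioc c d))
    simp only [one_mul, one_pow, integral_const, MeasurableSet.univ, measureReal_restrict_apply,
      univ_inter, smul_eq_mul, mul_one, Real.volume_real_Ioc_of_le hcd, hlen] at h2
    refine h2.trans (mul_le_mul_of_nonneg_left ?_ (abs_nonneg _))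
    exact setIntegral_le_integral hx.integrable_sq (Eventually.of_forall fun _ => sq_nonneg _)

/-- Green's formula for fields in `L²` that are divergence free off `{y = 0}`. -/
theorem green {B1 B2 Ψ : Bool → ℝ × ℝ → ℝ} {ψ₀ w : ℝ → ℝ} (hB1 : ∀ i, ContDiff ℝ 1 (B1 i))
    (hB2 : ∀ i, ContDiff ℝ 1 (B2 i)) (hΨ : ∀ i, ContDiff ℝ 1 (Ψ i))
    (hdiv : ∀ i q, 0 < sgn i * q.2 → dx (B1 i) q + dz (B2 i) q = 0)
    (htr : ∀ i x, Ψ i (x, 0) = ψ₀ x) (hψ₀ : MemLp ψ₀ 2)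
    (hw : ∀ x, B2 false (x, 0) - B2 true (x, 0) = w x) (hwL : MemLp w 2)
    (L1 : MemLp (glue B1) 2) (L2 : MemLp (glue B2) 2)
    (Lx : MemLp (glue fun i => dx (Ψ i)) 2) (Ly : MemLp (glue fun i => dz (Ψ i)) 2) :
    ∫ q, (glue B1 q * glue (fun i => dx (Ψ i)) q + glue B2 q * glue (fun i => dz (Ψ i)) q) =
      ∫ x, ψ₀ x * w x := by
  obtain ⟨M, hM0, ex, ez⟩ := exists_isCutoffError
  obtain ⟨β, hβ0, hβ, -, hgrow⟩ := exists_growth_bound hΨ htr Ly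
  have hgrow' : ∀ᵐ q : ℝ × ℝ, |glue Ψ q| ≤ |ψ₀ q.1| + √|q.2| * β q.1 := by
    filter_upwards [ae_fst hgrow] with q hq
    have h1 := hq q.2
    have h2 := abs_add_le (glue Ψ q - ψ₀ q.1) (ψ₀ q.1)
    rw [sub_add_cancel] at h2
    have h3 : glue Ψ (q.1, q.2) = glue Ψ q := rfl
    rw [h3] at h1
    linarith
  have hΨm : AEStronglyMeasurable (glue Ψ) :=
    (measurable_glue fun i => (hΨ i).continuous.measurable).aestronglyMeasurable
  have hmain : Integrable fun q => glue B1 q * glue (fun i => dx (Ψ i)) q +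
      glue B2 q * glue (fun i => dz (Ψ i)) q := (L1.integrable_mul Lx).add (L2.integrable_mul Ly)
  have T1 := tendsto_integral_cutoff_mul hmain
  have hmx : ∀ n, Measurable (dx (cutoff n)) := fun n =>
    (continuous_dx ((contDiff_cutoff n).of_le (by simp))).measurable
  have hmz : ∀ n, Measurable (dz (cutoff n)) := fun n =>
    (continuous_dz ((contDiff_cutoff n).of_le (by simp))).measurable
  have T2 := tendsto_integral_cutoff_error ex hmx hΨm hψ₀.abs hβ L1 hgrow'
  have T3 := tendsto_integral_cutoff_error ez hmz hΨm hψ₀.abs hβ L2 hgrow'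
  have hψw : Integrable fun x => ψ₀ x * w x := hψ₀.integrable_mul hwL
  have hc1 : ∀ n, ContDiff ℝ 1 (cutoff n) := fun n => (contDiff_cutoff n).of_le (by simp)
  have T4 : Tendsto (fun n => ∫ x, cutoff n (x, 0) * (ψ₀ x * w x)) atTop
      (𝓝 (∫ x, ψ₀ x * w x)) := by
    apply tendsto_integral_of_dominated_convergence (fun x => |ψ₀ x * w x|)
    · exact fun n => ((contDiff_cutoff n).continuous.comp
        (by fun_prop : Continuous fun x : ℝ => (x, (0 : ℝ)))).aestronglyMeasurable.mul hψw.1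
    · exact hψw.abs
    · refine fun n => Eventually.of_forall fun x => ?_
      rw [norm_mul, Real.norm_eq_abs, Real.norm_eq_abs, abs_of_nonneg (cutoff_mem_Icc n _).1]
      exact mul_le_of_le_one_left (abs_nonneg _) (cutoff_mem_Icc n _).2
    · refine Eventually.of_forall fun x => ?_
      apply tendsto_const_nhds.congr'
      filter_upwards [tendsto_cutoff (x, 0)] with n hn
      simp [hn]
  -- The divergence theorem for the compactly supported field `χ_n Ψ B`, with `χ_n` the cutoff. As
  -- `B` is divergence free off the line, only `∇(χ_n Ψ) · B` survives, and the two boundary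
  -- integrals combine to the jump `w`.
  have hid : ∀ n, (∫ q, cutoff n q * (glue B1 q * glue (fun i => dx (Ψ i)) q +
      glue B2 q * glue (fun i => dz (Ψ i)) q)) + (∫ q, glue Ψ q * dx (cutoff n) q * glue B1 q) +
      (∫ q, glue Ψ q * dz (cutoff n) q * glue B2 q) = ∫ x, cutoff n (x, 0) * (ψ₀ x * w x) := by
    intro n
    have hX : ∀ {B : Bool → ℝ × ℝ → ℝ} (_ : ∀ i, ContDiff ℝ 1 (B i)) (i : Bool),
        ContDiff ℝ 1 (fun q => cutoff n q * (Ψ i q * B i q)) ∧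
        HasCompactSupport (fun q => cutoff n q * (Ψ i q * B i q)) := fun hB i =>
      ⟨(hc1 n).mul ((hΨ i).mul (hB i)), (hasCompactSupport_cutoff n).mul_right⟩
    have hg := integral_glue_div (X1 := fun i q => cutoff n q * (Ψ i q * B1 i q))
      (X2 := fun i q => cutoff n q * (Ψ i q * B2 i q)) (fun i => (hX hB1 i).1)
      (fun i => (hX hB2 i).1) (fun i => (hX hB1 i).2) (fun i => (hX hB2 i).2)
    have hint : ∀ i, Integrable fun x => cutoff n (x, 0) * (Ψ i (x, 0) * B2 i (x, 0)) := fun i =>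
      ((hX hB2 i).1.continuous.comp
        (by fun_prop : Continuous fun x : ℝ => (x, (0 : ℝ)))).integrable_of_hasCompactSupport
        (hasCompactSupport_slice_snd (hX hB2 i).2 0)
    rw [← integral_sub (hint _) (hint _)] at hg
    have hr : ∀ x, cutoff n (x, 0) * (Ψ false (x, 0) * B2 false (x, 0)) -
        cutoff n (x, 0) * (Ψ true (x, 0) * B2 true (x, 0)) = cutoff n (x, 0) * (ψ₀ x * w x) := by
      intro x; rw [htr, htr, ← hw]; ring
    simp only [hr] at hg
    rw [← hg]
    have hcs : ∀ {e Y : ℝ × ℝ → ℝ}, Continuous e → HasCompactSupport e →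
        AEStronglyMeasurable Y → (∃ Z : Bool → ℝ × ℝ → ℝ, (∀ i, Continuous (Z i)) ∧ Y = glue Z) →
        Integrable (fun q => e q * Y q) := by
      rintro e Y he hec hY ⟨Z, hZ, rfl⟩
      refine (((he.mul (hZ true)).integrable_of_hasCompactSupport hec.mul_right).norm.add
        ((he.mul (hZ false)).integrable_of_hasCompactSupport hec.mul_right).norm).mono'
        (he.aestronglyMeasurable.mul hY) (Eventually.of_forall fun q => ?_)
      simp only [glue, Pi.add_apply]
      rcases decide (0 < q.2) <;> simp <;> positivity
    have hib : ∀ {B : Bool → ℝ × ℝ → ℝ} (_ : ∀ i, ContDiff ℝ 1 (B i)) {e : ℝ × ℝ → ℝ},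
        Continuous e → HasCompactSupport e → Integrable (fun q => glue Ψ q * e q * glue B q) := by
      intro B hB e he hec
      have hZ : ∀ i, Continuous fun q => Ψ i q * B i q := fun i =>
        (hΨ i).continuous.mul (hB i).continuous
      refine (hcs he hec (Y := glue fun i q => Ψ i q * B i q) ?_ ⟨_, hZ, rfl⟩).congr
        (Eventually.of_forall fun q => ?_)
      · exact (measurable_glue fun i => (hZ i).measurable).aestronglyMeasurable
      · simp only [glue]; ring
    have i1 : Integrable fun q => cutoff n q * (glue B1 q * glue (fun i => dx (Ψ i)) q +
        glue B2 q * glue (fun i => dz (Ψ i)) q) := by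
      refine hmain.abs.mono' ((hc1 n).continuous.aestronglyMeasurable.mul hmain.1)
        (Eventually.of_forall fun q => ?_)
      rw [norm_mul, Real.norm_eq_abs, Real.norm_eq_abs, abs_of_nonneg (cutoff_mem_Icc n q).1]
      exact mul_le_of_le_one_left (abs_nonneg _) (cutoff_mem_Icc n q).2
    have i2 := hib hB1 (continuous_dx (hc1 n)) (hasCompactSupport_dx (hasCompactSupport_cutoff n))
    have i3 := hib hB2 (continuous_dz (hc1 n)) (hasCompactSupport_dz (hasCompactSupport_cutoff n))
    have i12 : Integrable fun q => cutoff n q * (glue B1 q * glue (fun i => dx (Ψ i)) q +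
        glue B2 q * glue (fun i => dz (Ψ i)) q) + glue Ψ q * dx (cutoff n) q * glue B1 q :=
      i1.add i2
    rw [← integral_add i1 i2, ← integral_add i12 i3]
    apply integral_congr_ae
    filter_upwards [ae_snd_ne 0] with q hq
    have hs := hdiv _ q (sgn_decide_mul_pos hq)
    simp only [glue]
    generalize decide (0 < q.2) = i at hs ⊢
    have d0 : DifferentiableAt ℝ (cutoff n) q := (hc1 n).differentiable one_ne_zero _
    have d1 : DifferentiableAt ℝ (Ψ i) q := (hΨ i).differentiable one_ne_zero _
    have d2 : DifferentiableAt ℝ (B1 i) q := (hB1 i).differentiable one_ne_zero _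
    have d3 : DifferentiableAt ℝ (B2 i) q := (hB2 i).differentiable one_ne_zero _
    rw [dx_mul d0 (d1.fun_mul d2), dz_mul d0 (d1.fun_mul d3), dx_mul d1 d2, dz_mul d1 d3]
    have : dz (B2 i) q = - dx (B1 i) q := by linarith
    rw [this]
    ring
  have T5 := (T1.add T2).add T3
  simp only [add_zero] at T5
  exact tendsto_nhds_unique (T5.congr hid) T4

end MullinsSekerka

end

/-! ### The problem at a frozen time in straightened coordinates -/

noncomputable section

namespace MullinsSekerka

open MeasureTheory Filter Set
open scoped Topology ContDiff

/-- A solution of the Mullins-Sekerka problem at one time in the coordinates `shift η`, with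
`u = h_t`, `p = ∂ₓ f`, `q = ∂_z f` in the upper (`true`) and the lower (`false`) phase;
`gt`, `pt`, `qt` are the time derivatives in these coordinates. -/
structure FlatSolution (η u : ℝ → ℝ) (g p q gt pt qt : Bool → ℝ × ℝ → ℝ) : Prop where
  smooth_η : ContDiff ℝ ∞ η
  smooth_u : ContDiff ℝ ∞ u
  smooth_g : ∀ i, ContDiff ℝ ∞ (g i)
  smooth_p : ∀ i, ContDiff ℝ ∞ (p i)
  smooth_q : ∀ i, ContDiff ℝ ∞ (q i)
  smooth_gt : ∀ i, ContDiff ℝ ∞ (gt i)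
  memLp_η : MemLp η 2
  memLp_η1 : MemLp (deriv η) 2
  memLp_η2 : MemLp (deriv (deriv η)) 2
  memLp_u : MemLp u 2
  memLp_u1 : MemLp (deriv u) 2
  memLp_u2 : MemLp (deriv (deriv u)) 2
  memLp_p : MemLp (glue p) 2
  memLp_q : MemLp (glue q) 2
  memLp_px : MemLp (glue fun i => dx (p i)) 2
  memLp_qx : MemLp (glue fun i => dx (q i)) 2
  memLp_pt : MemLp (glue pt) 2
  memLp_qt : MemLp (glue qt) 2
  dx_g : ∀ i z, dx (g i) z = p i z + deriv η z.1 * q i z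
  dz_g : ∀ i z, dz (g i) z = q i z
  dx_gt : ∀ i z, dx (gt i) z = pt i z + deriv η z.1 * qt i z + deriv u z.1 * q i z
  dz_gt : ∀ i z, dz (gt i) z = qt i z
  divergence : ∀ i z, 0 < sgn i * z.2 → dx (p i) z + dz (q i) z - deriv η z.1 * dz (p i) z = 0
  trace_g : ∀ i x, g i (x, 0) = curvature η x
  trace_gt : ∀ i x, gt i (x, 0) = deriv (fun y => deriv u y / lineElement η y ^ 3) x
  jump : ∀ x, (q false (x, 0) - deriv η x * p false (x, 0)) -
    (q true (x, 0) - deriv η x * p true (x, 0)) = u x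

lemma lineElement_pos (η : ℝ → ℝ) (x : ℝ) : 0 < lineElement η x :=
  Real.sqrt_pos.2 (by positivity)

lemma lineElement_sq (η : ℝ → ℝ) (x : ℝ) : lineElement η x ^ 2 = 1 + deriv η x ^ 2 :=
  Real.sq_sqrt (by positivity)

lemma one_le_lineElement (η : ℝ → ℝ) (x : ℝ) : 1 ≤ lineElement η x :=
  Real.one_le_sqrt.2 (by nlinarith [sq_nonneg (deriv η x)])

lemma contDiff_deriv {v : ℝ → ℝ} (h : ContDiff ℝ ∞ v) : ContDiff ℝ ∞ (deriv v) :=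
  ((contDiff_infty_iff_deriv).1 h).2

lemma hasDerivAt_of_contDiff {v : ℝ → ℝ} (h : ContDiff ℝ ∞ v) (x : ℝ) :
    HasDerivAt v (deriv v x) x := (h.differentiable (by simp) x).hasDerivAt

lemma contDiff_lineElement {η : ℝ → ℝ} (h : ContDiff ℝ ∞ η) : ContDiff ℝ ∞ (lineElement η) := by
  refine ContDiff.sqrt (contDiff_const.add ((contDiff_deriv h).pow 2)) fun x => ?_
  positivity

lemma hasDerivAt_lineElement {η : ℝ → ℝ} (h : ContDiff ℝ ∞ η) (x : ℝ) :
    HasDerivAt (lineElement η) (deriv η x * deriv (deriv η) x / lineElement η x) x := by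
  have h1 := hasDerivAt_of_contDiff (contDiff_deriv h) x
  have h2 := ((h1.fun_pow 2).const_add 1).sqrt (by positivity)
  refine h2.congr_deriv ?_
  have := lineElement_pos η x
  change _ / (2 * lineElement η x) = _
  field_simp; push_cast; ring

/-- The slope `sin θ` of the graph. -/
def slope (η : ℝ → ℝ) (x : ℝ) : ℝ := deriv η x / lineElement η x

lemma contDiff_slope {η : ℝ → ℝ} (h : ContDiff ℝ ∞ η) : ContDiff ℝ ∞ (slope η) :=
  (contDiff_deriv h).div (contDiff_lineElement h) fun x => (lineElement_pos η x).ne'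

lemma contDiff_curvature {η : ℝ → ℝ} (h : ContDiff ℝ ∞ η) : ContDiff ℝ ∞ (curvature η) :=
  contDiff_deriv (contDiff_slope h)

lemma hasDerivAt_slope {η : ℝ → ℝ} (h : ContDiff ℝ ∞ η) (x : ℝ) :
    HasDerivAt (slope η) (curvature η x) x := hasDerivAt_of_contDiff (contDiff_slope h) x

lemma curvature_eq {η : ℝ → ℝ} (h : ContDiff ℝ ∞ η) (x : ℝ) :
    curvature η x = deriv (deriv η) x / lineElement η x ^ 3 := by
  have h1 := (hasDerivAt_of_contDiff (contDiff_deriv h) x).fun_div (hasDerivAt_lineElement h x)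
    (lineElement_pos η x).ne'
  refine (hasDerivAt_slope h x).unique (h1.congr_deriv ?_)
  have h2 := lineElement_pos η x
  have h3 := lineElement_sq η x
  field_simp
  rw [h3]; ring

lemma abs_slope_le (η : ℝ → ℝ) (x : ℝ) : |slope η x| ≤ |deriv η x| := by
  rw [slope, abs_div, abs_of_pos (lineElement_pos η x)]
  exact div_le_self (abs_nonneg _) (one_le_lineElement η x)

lemma abs_curvature_le {η : ℝ → ℝ} (h : ContDiff ℝ ∞ η) (x : ℝ) :
    |curvature η x| ≤ |deriv (deriv η) x| := by
  rw [curvature_eq h, abs_div, abs_of_pos (pow_pos (lineElement_pos η x) 3)]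
  exact div_le_self (abs_nonneg _) (one_le_pow₀ (one_le_lineElement η x))

lemma MemLp.of_abs_le {X : Type*} [MeasurableSpace X] {μ : Measure X} {f g : X → ℝ}
    (hg : MemLp g 2 μ) (hf : AEStronglyMeasurable f μ) (h : ∀ᵐ x ∂μ, |f x| ≤ |g x|) :
    MemLp f 2 μ := hg.mono hf h

/-- The curvature is the derivative of the slope `sin θ`, so this is one integration by parts: the
first variation of length in graph form. It serves the energy identity, the bound for `∫ κ²`, and
the sign of `∫ η κ`. -/
lemma integral_slope_mul {η v : ℝ → ℝ} (hη : ContDiff ℝ ∞ η) (h1 : MemLp (deriv η) 2)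
    (h2 : MemLp (deriv (deriv η)) 2) (hv : ContDiff ℝ ∞ v) (hv0 : MemLp v 2)
    (hv1 : MemLp (deriv v) 2) :
    ∫ x, slope η x * deriv v x = - ∫ x, curvature η x * v x := by
  have hs : MemLp (slope η) 2 := MemLp.of_abs_le h1 (contDiff_slope hη).continuous.aestronglyMeasurable
    (Eventually.of_forall (abs_slope_le η))
  have hk : MemLp (curvature η) 2 := MemLp.of_abs_le h2 (contDiff_curvature hη).continuous.aestronglyMeasurable
    (Eventually.of_forall (abs_curvature_le hη))
  exact integral_mul_deriv_eq_deriv_mul_of_integrable (fun x _ => hasDerivAt_slope hη x)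
    (fun x _ => hasDerivAt_of_contDiff hv x) (hs.integrable_mul hv1) (hk.integrable_mul hv0)
    (hs.integrable_mul hv0)

end MullinsSekerka

end

/-! ### Duality for normal jumps and the first-order identities -/

noncomputable section

namespace MullinsSekerka

open MeasureTheory Filter Set
open scoped Topology ContDiff

lemma integrable_mul_of_memLp {X : Type*} [MeasurableSpace X] {μ : Measure X} {f g : X → ℝ}
    (hf : MemLp f 2 μ) (hg : MemLp g 2 μ) : Integrable (fun x => f x * g x) μ :=
  hf.integrable_mul hg

lemma two_le_infty : (2 : ℕ∞ω) ≤ ∞ := WithTop.coe_le_coe.2 (le_top (a := (2 : ℕ∞)))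

/-- Minimisation over `l` is expressed by a discriminant: multiplied by `l`, the hypothesis says `Y
l² - X l + Z ≥ 0` for `l > 0`, and for `l ≤ 0` this is clear from the signs. -/
lemma sq_le_of_forall_le {X Y Z : ℝ} (hX : 0 ≤ X) (hY : 0 ≤ Y) (hZ : 0 ≤ Z)
    (h : ∀ l : ℝ, 0 < l → X ≤ l * Y + Z / l) : X ^ 2 ≤ 4 * Y * Z := by
  have key : ∀ l : ℝ, 0 ≤ Y * (l * l) + (-X) * l + Z := by
    intro l
    rcases le_or_gt l 0 with hl | hl
    · nlinarith [mul_nonneg hY (mul_self_nonneg l), mul_nonneg hX (neg_nonneg.2 hl)]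
    · have h1 := mul_le_mul_of_nonneg_right (h l hl) hl.le
      have : (l * Y + Z / l) * l = Y * (l * l) + Z := by field_simp
      linarith
  have := discrim_le_zero key
  simp only [discrim] at this
  nlinarith

lemma integral_exp_neg_two_abs_div {l : ℝ} (hl : 0 < l) :
    ∫ y : ℝ, Real.exp (-|y| / l) ^ 2 = l := by
  have h1 : (fun y : ℝ => Real.exp (-|y| / l) ^ 2) = fun y => (fun s => Real.exp (-(2 / l) * s)) |y| := by
    ext y; rw [← Real.exp_nat_mul]; congr 1; push_cast; field_simp
  rw [h1, integral_comp_abs (f := fun s => Real.exp (-(2 / l) * s)),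
    integral_exp_mul_Ioi (by simpa using hl)]
  simp; field_simp

/-- The extension of a function of `x` that decays exponentially in `|y|`. -/
def expExt (v : ℝ → ℝ) (l : ℝ) (i : Bool) (z : ℝ × ℝ) : ℝ := v z.1 * Real.exp (-(sgn i * z.2) / l)

lemma sgn_decide_mul (y : ℝ) : sgn (decide (0 < y)) * y = |y| := by
  rcases le_or_gt y 0 with h | h
  · simp [sgn, not_lt.2 h, abs_of_nonpos h]
  · simp [sgn, h, abs_of_pos h]

lemma abs_sgn (i : Bool) : |sgn i| = 1 := by cases i <;> simp [sgn]

lemma contDiff_expExt {v : ℝ → ℝ} (hv : ContDiff ℝ ∞ v) (l : ℝ) (i : Bool) :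
    ContDiff ℝ ∞ (expExt v l i) := by
  have h1 : ContDiff ℝ ∞ fun z : ℝ × ℝ => v z.1 := hv.comp contDiff_fst
  have h2 : ContDiff ℝ ∞ fun z : ℝ × ℝ => Real.exp (-(sgn i * z.2) / l) :=
    Real.contDiff_exp.comp (by fun_prop)
  exact h1.mul h2

lemma dx_expExt {v : ℝ → ℝ} (hv : ContDiff ℝ ∞ v) (l : ℝ) (i : Bool) (z : ℝ × ℝ) :
    dx (expExt v l i) z = deriv v z.1 * Real.exp (-(sgn i * z.2) / l) :=
  (hasDerivAt_dx ((contDiff_expExt hv l i).differentiable (by simp) z)).unique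
    ((hasDerivAt_of_contDiff hv z.1).mul_const (Real.exp (-(sgn i * z.2) / l)))

lemma dz_expExt {v : ℝ → ℝ} (hv : ContDiff ℝ ∞ v) (l : ℝ) (i : Bool) (z : ℝ × ℝ) :
    dz (expExt v l i) z = v z.1 * (Real.exp (-(sgn i * z.2) / l) * (-sgn i / l)) := by
  have h1 : HasDerivAt (fun y : ℝ => -(sgn i * y) / l) (-sgn i / l) z.2 := by
    have := (((hasDerivAt_id z.2).const_mul (sgn i)).neg).div_const l
    simpa using this
  exact (hasDerivAt_dz ((contDiff_expExt hv l i).differentiable (by simp) z)).unique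
    (h1.exp.const_mul (v z.1))

lemma memLp_mul_expExt {v : ℝ → ℝ} (hv : MemLp v 2) {l : ℝ} (hl : 0 < l) :
    MemLp (fun z : ℝ × ℝ => v z.1 * Real.exp (-|z.2| / l)) 2 ∧
      ∫ z : ℝ × ℝ, (v z.1 * Real.exp (-|z.2| / l)) ^ 2 = l * ∫ x, v x ^ 2 := by
  have hi : Integrable fun y : ℝ => Real.exp (-|y| / l) ^ 2 :=
    Integrable.of_integral_ne_zero (by rw [integral_exp_neg_two_abs_div hl]; exact hl.ne')
  have hp : Integrable fun z : ℝ × ℝ => v z.1 ^ 2 * Real.exp (-|z.2| / l) ^ 2 :=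
    hv.integrable_sq.mul_prod hi
  have e : (fun z : ℝ × ℝ => (v z.1 * Real.exp (-|z.2| / l)) ^ 2) =
      fun z : ℝ × ℝ => v z.1 ^ 2 * Real.exp (-|z.2| / l) ^ 2 := by ext z; ring
  refine ⟨memLp_two_of_sq ?_ (by rw [e]; exact hp), ?_⟩
  · refine (hv.1.comp_quasiMeasurePreserving Measure.quasiMeasurePreserving_fst).mul ?_
    exact (by fun_prop : Continuous fun z : ℝ × ℝ => Real.exp (-|z.2| / l)).aestronglyMeasurable
  · rw [e]
    have h2 : ∫ z : ℝ × ℝ, v z.1 ^ 2 * Real.exp (-|z.2| / l) ^ 2 =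
      (∫ x, v x ^ 2) * ∫ y, Real.exp (-|y| / l) ^ 2 :=
      integral_prod_mul (fun x => v x ^ 2) (fun y => Real.exp (-|y| / l) ^ 2)
    rw [h2, integral_exp_neg_two_abs_div hl, mul_comm]

/-- The normal jump of a divergence free field in `L²`, tested with a function in `H¹`. -/
lemma pow_four_integral_mul_jump_le {B1 B2 : Bool → ℝ × ℝ → ℝ} {v w : ℝ → ℝ} {D : ℝ}
    (hB1 : ∀ i, ContDiff ℝ 1 (B1 i)) (hB2 : ∀ i, ContDiff ℝ 1 (B2 i))
    (hdiv : ∀ i q, 0 < sgn i * q.2 → dx (B1 i) q + dz (B2 i) q = 0)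
    (hw : ∀ x, B2 false (x, 0) - B2 true (x, 0) = w x) (hwL : MemLp w 2)
    (L1 : MemLp (glue B1) 2) (L2 : MemLp (glue B2) 2) (hv : ContDiff ℝ ∞ v)
    (hv0 : MemLp v 2) (hv1 : MemLp (deriv v) 2)
    (D1 : ∫ z, glue B1 z ^ 2 ≤ D) (D2 : ∫ z, glue B2 z ^ 2 ≤ 2 * D) :
    (∫ x, v x * w x) ^ 4 ≤ 64 * D ^ 2 * (∫ x, deriv v x ^ 2) * ∫ x, v x ^ 2 := by
  have hD : 0 ≤ D := le_trans (integral_nonneg fun _ => sq_nonneg _) D1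
  have h0 : 0 ≤ ∫ x, v x ^ 2 := integral_nonneg fun _ => sq_nonneg _
  have h1 : 0 ≤ ∫ x, deriv v x ^ 2 := integral_nonneg fun _ => sq_nonneg _
  -- The extension `v(x) exp(-|y|/l)` makes the duality of H^{1/2} and H^{-1/2} explicit. Green's
  -- formula bounds `(∫ v w)²` by `4 D (l ∫ v'² + l⁻¹ ∫ v²)` for every `l > 0`, and optimising in
  -- `l` gives the fourth power.
  have key := sq_le_of_forall_le (X := (∫ x, v x * w x) ^ 2) (Y := 4 * D * ∫ x, deriv v x ^ 2)
    (Z := 4 * D * ∫ x, v x ^ 2) (sq_nonneg _) (by positivity) (by positivity) ?_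
  · calc _ = ((∫ x, v x * w x) ^ 2) ^ 2 := by ring
      _ ≤ _ := key
      _ = _ := by ring
  intro l hl
  obtain ⟨mx, ix⟩ := memLp_mul_expExt hv1 hl
  obtain ⟨mz, iz⟩ := memLp_mul_expExt hv0 hl
  have ex : (glue fun i => dx (expExt v l i)) =
      fun z : ℝ × ℝ => deriv v z.1 * Real.exp (-|z.2| / l) := by
    ext z; simp only [glue, dx_expExt hv, sgn_decide_mul]
  have ez : ∀ z : ℝ × ℝ, |glue (fun i => dz (expExt v l i)) z| =
      |1 / l * (v z.1 * Real.exp (-|z.2| / l))| := by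
    intro z; simp only [glue, dz_expExt hv, sgn_decide_mul]
    simp only [abs_mul, abs_div, abs_neg, abs_sgn, abs_one]; ring
  have hmz : MemLp (glue fun i => dz (expExt v l i)) 2 :=
    MemLp.of_abs_le (mz.const_mul (1 / l)) (measurable_glue fun i => (continuous_dz
      ((contDiff_expExt hv l i).of_le (by simp))).measurable).aestronglyMeasurable
      (Eventually.of_forall fun z => (ez z).le)
  have hmx : MemLp (glue fun i => dx (expExt v l i)) 2 := by rw [ex]; exact mx
  have iz' : ∫ z, glue (fun i => dz (expExt v l i)) z ^ 2 = (1 / l) ^ 2 * (l * ∫ x, v x ^ 2) := by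
    rw [← iz, ← integral_const_mul]
    congr 1; ext z; rw [← sq_abs, ez, sq_abs]; ring
  have hg := green hB1 hB2 (Ψ := expExt v l) (ψ₀ := v)
    (fun i => (contDiff_expExt hv l i).of_le (by simp)) hdiv
    (fun i x => by simp [expExt]) hv0 hw hwL L1 L2 hmx hmz
  rw [integral_add (integrable_mul_of_memLp L1 hmx) (integrable_mul_of_memLp L2 hmz)] at hg
  have c1 := sq_integral_mul_le L1 hmx
  have c2 := sq_integral_mul_le L2 hmz
  rw [iz'] at c2
  have ix' : ∫ z, glue (fun i => dx (expExt v l i)) z ^ 2 = l * ∫ x, deriv v x ^ 2 := by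
    rw [← ix, ex]
  rw [ix'] at c1
  have c1' := c1.trans (mul_le_mul_of_nonneg_right D1 (by positivity))
  have c2' := c2.trans (mul_le_mul_of_nonneg_right D2 (by positivity))
  have e2 : 2 * D * ((1 / l) ^ 2 * (l * ∫ x, v x ^ 2)) = 2 * D * (∫ x, v x ^ 2) / l := by
    field_simp
  rw [e2] at c2'
  have e3 : l * (4 * D * ∫ x, deriv v x ^ 2) + 4 * D * (∫ x, v x ^ 2) / l =
      4 * (D * (l * ∫ x, deriv v x ^ 2)) + 2 * (2 * D * (∫ x, v x ^ 2) / l) := by ring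
  rw [e3, ← hg]
  have p1 : 0 ≤ D * (l * ∫ x, deriv v x ^ 2) := by positivity
  nlinarith [sq_nonneg ((∫ z, glue B1 z * glue (fun i => dx (expExt v l i)) z) -
    ∫ z, glue B2 z * glue (fun i => dz (expExt v l i)) z)]

lemma dz_dx_comm {v : ℝ × ℝ → ℝ} (hv : ContDiff ℝ ∞ v) (z : ℝ × ℝ) : dz (dx v) z = dx (dz v) z := by
  have hs : IsSymmSndFDerivAt ℝ v z := hv.contDiffAt.isSymmSndFDerivAt (by simpa using two_le_infty)
  have hd : DifferentiableAt ℝ (fderiv ℝ v) z :=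
    (hv.fderiv_right (m := 1) (by rw [one_add_one_eq_two]; exact two_le_infty)).differentiable one_ne_zero z
  unfold dz
  have e : ∀ a b : ℝ × ℝ, fderiv ℝ (fun y => fderiv ℝ v y a) z b = fderiv ℝ (fderiv ℝ v) z b a := by
    intro a b
    rw [fderiv_clm_apply hd (differentiableAt_const a)]
    simp
  have e1 := e (1, 0) (0, 1)
  have e2 := e (0, 1) (1, 0)
  change fderiv ℝ (fun y => fderiv ℝ v y (1, 0)) z (0, 1) =
    fderiv ℝ (fun y => fderiv ℝ v y (0, 1)) z (1, 0)
  rw [e1, e2]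
  exact hs.eq _ _

lemma contDiff_dx {v : ℝ × ℝ → ℝ} (hv : ContDiff ℝ ∞ v) : ContDiff ℝ ∞ (dx v) :=
  (hv.fderiv_right (by simp)).clm_apply contDiff_const

lemma contDiff_dz {v : ℝ × ℝ → ℝ} (hv : ContDiff ℝ ∞ v) : ContDiff ℝ ∞ (dz v) :=
  (hv.fderiv_right (by simp)).clm_apply contDiff_const

lemma exists_abs_le {v : ℝ → ℝ} (hv : ContDiff ℝ ∞ v) (h0 : MemLp v 2) (h1 : MemLp (deriv v) 2) :
    ∃ A : ℝ, 0 ≤ A ∧ ∀ x, |v x| ≤ A := by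
  refine ⟨√(2 * (l2norm v * l2norm (deriv v))), Real.sqrt_nonneg _, fun x => ?_⟩
  exact Real.abs_le_sqrt (sq_le_l2norm_mul (hasDerivAt_of_contDiff hv) h0 h1 x)

lemma memLp_bounded_mul {X : Type*} [MeasurableSpace X] {μ : Measure X} {φ v : X → ℝ} {A : ℝ}
    (hφ : AEStronglyMeasurable φ μ) (hA : ∀ x, |φ x| ≤ A) (hv : MemLp v 2 μ) :
    MemLp (fun x => φ x * v x) 2 μ := by
  refine MemLp.of_abs_le (hv.const_mul A) (hφ.mul hv.1) (Eventually.of_forall fun x => ?_)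
  rw [abs_mul, abs_mul]
  exact mul_le_mul_of_nonneg_right ((hA x).trans (le_abs_self A)) (abs_nonneg _)

lemma memLp_weight_mul {w : ℝ → ℝ} {v vx : ℝ × ℝ → ℝ} (hw : MemLp w 2) (hv : MemLp v 2)
    (hvx : MemLp vx 2)
    (hd : ∀ q : ℝ × ℝ, q.2 ≠ 0 → HasDerivAt (fun x => v (x, q.2)) (vx q) q.1) :
    MemLp (fun z : ℝ × ℝ => w z.1 * v z) 2 ∧ ∫ z : ℝ × ℝ, (w z.1 * v z) ^ 2 ≤
      (∫ x, w x ^ 2) * (2 * (l2norm v * l2norm vx)) := by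
  obtain ⟨h1, h2⟩ := integral_weight_mul_sq_le hw.integrable_sq (fun _ => sq_nonneg _) hv hvx hd
  have e : (fun z : ℝ × ℝ => (w z.1 * v z) ^ 2) = fun z : ℝ × ℝ => w z.1 ^ 2 * v z ^ 2 := by
    ext z; ring
  rw [e]
  refine ⟨memLp_two_of_sq ?_ (by rw [e]; exact h1), h2⟩
  exact (hw.1.comp_quasiMeasurePreserving Measure.quasiMeasurePreserving_fst).mul hv.1

namespace FlatSolution

variable {η u : ℝ → ℝ} {g p q gt pt qt : Bool → ℝ × ℝ → ℝ}

lemma contDiff_slope_fst (S : FlatSolution η u g p q gt pt qt) :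
    ContDiff ℝ ∞ fun z : ℝ × ℝ => deriv η z.1 := (contDiff_deriv S.smooth_η).comp contDiff_fst

lemma hasDerivAt_glue {v : Bool → ℝ × ℝ → ℝ} (hv : ∀ i, ContDiff ℝ ∞ (v i)) (z : ℝ × ℝ) :
    HasDerivAt (fun x => glue v (x, z.2)) (glue (fun i => dx (v i)) z) z.1 :=
  hasDerivAt_dx (v := v (decide (0 < z.2))) ((hv _).differentiable (by simp) z)

/-- The second component of the flux. -/
def flux (η : ℝ → ℝ) (p q : Bool → ℝ × ℝ → ℝ) (i : Bool) (z : ℝ × ℝ) : ℝ :=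
  q i z - deriv η z.1 * p i z

lemma smooth_flux (S : FlatSolution η u g p q gt pt qt) (i : Bool) :
    ContDiff ℝ ∞ (flux η p q i) := (S.smooth_q i).sub (S.contDiff_slope_fst.mul (S.smooth_p i))

lemma memLp_slope_mul (S : FlatSolution η u g p q gt pt qt) {v : ℝ × ℝ → ℝ} (hv : MemLp v 2) :
    MemLp (fun z : ℝ × ℝ => deriv η z.1 * v z) 2 := by
  obtain ⟨A, -, hA⟩ := exists_abs_le (contDiff_deriv S.smooth_η) S.memLp_η1 S.memLp_η2
  exact memLp_bounded_mul S.contDiff_slope_fst.continuous.aestronglyMeasurable (fun z => hA z.1) hv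

lemma memLp_flux (S : FlatSolution η u g p q gt pt qt) : MemLp (glue (flux η p q)) 2 :=
  S.memLp_q.sub (S.memLp_slope_mul S.memLp_p)

lemma dz_slope_mul (S : FlatSolution η u g p q gt pt qt) {v : ℝ × ℝ → ℝ}
    (hv : ContDiff ℝ ∞ v) (z : ℝ × ℝ) :
    dz (fun z => deriv η z.1 * v z) z = deriv η z.1 * dz v z := by
  have h1 := hasDerivAt_dz ((S.contDiff_slope_fst.mul hv).differentiable (by simp) z)
  have h2 := (hasDerivAt_dz (hv.differentiable (by simp) z)).const_mul (deriv η z.1)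
  exact h1.unique h2

lemma dx_slope_mul (S : FlatSolution η u g p q gt pt qt) {v : ℝ × ℝ → ℝ}
    (hv : ContDiff ℝ ∞ v) (z : ℝ × ℝ) :
    dx (fun z => deriv η z.1 * v z) z = deriv (deriv η) z.1 * v z + deriv η z.1 * dx v z := by
  have h1 := hasDerivAt_dx ((S.contDiff_slope_fst.mul hv).differentiable (by simp) z)
  have h2 := (hasDerivAt_of_contDiff (contDiff_deriv S.smooth_η) z.1).fun_mul
    (hasDerivAt_dx (hv.differentiable (by simp) z))
  exact h1.unique h2

lemma dx_sub {v w : ℝ × ℝ → ℝ} (hv : ContDiff ℝ ∞ v) (hw : ContDiff ℝ ∞ w) (z : ℝ × ℝ) :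
    dx (fun z => v z - w z) z = dx v z - dx w z := by
  unfold dx
  rw [fderiv_fun_sub (hv.differentiable (by simp) z) (hw.differentiable (by simp) z)]; rfl

lemma dz_sub {v w : ℝ × ℝ → ℝ} (hv : ContDiff ℝ ∞ v) (hw : ContDiff ℝ ∞ w) (z : ℝ × ℝ) :
    dz (fun z => v z - w z) z = dz v z - dz w z := by
  unfold dz
  rw [fderiv_fun_sub (hv.differentiable (by simp) z) (hw.differentiable (by simp) z)]; rfl

lemma dx_add {v w : ℝ × ℝ → ℝ} (hv : ContDiff ℝ ∞ v) (hw : ContDiff ℝ ∞ w) (z : ℝ × ℝ) :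
    dx (fun z => v z + w z) z = dx v z + dx w z := by
  unfold dx
  rw [fderiv_fun_add (hv.differentiable (by simp) z) (hw.differentiable (by simp) z)]; rfl

/-- In the coordinates `shift η`, `∂ₓ` becomes `∂ₓ - η' ∂_y`. Since `η'` does not depend on `y`, the
extra term can be moved under `∂_y`, which puts the equation in divergence form. -/
lemma div_flux (S : FlatSolution η u g p q gt pt qt) (i : Bool) (z : ℝ × ℝ)
    (hz : 0 < sgn i * z.2) : dx (p i) z + dz (flux η p q i) z = 0 := by
  have h := S.divergence i z hz
  unfold flux
  rw [dz_sub (S.smooth_q i) (S.contDiff_slope_fst.mul (S.smooth_p i)), S.dz_slope_mul (S.smooth_p i)]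
  linarith

/-- The weak form of the equation. -/
lemma weak_form (S : FlatSolution η u g p q gt pt qt) {Ψ : Bool → ℝ × ℝ → ℝ} {ψ₀ : ℝ → ℝ}
    (hΨ : ∀ i, ContDiff ℝ 1 (Ψ i)) (htr : ∀ i x, Ψ i (x, 0) = ψ₀ x) (hψ₀ : MemLp ψ₀ 2)
    (Lx : MemLp (glue fun i => dx (Ψ i)) 2) (Ly : MemLp (glue fun i => dz (Ψ i)) 2) :
    ∫ z, (glue p z * glue (fun i => dx (Ψ i)) z +
      (glue q z - deriv η z.1 * glue p z) * glue (fun i => dz (Ψ i)) z) = ∫ x, ψ₀ x * u x :=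
  green (fun i => (S.smooth_p i).of_le (by simp)) (fun i => (S.smooth_flux i).of_le (by simp)) hΨ
    S.div_flux htr hψ₀ S.jump S.memLp_u S.memLp_p S.memLp_flux Lx Ly

lemma memLp_curvature (S : FlatSolution η u g p q gt pt qt) : MemLp (curvature η) 2 :=
  MemLp.of_abs_le S.memLp_η2 (contDiff_curvature S.smooth_η).continuous.aestronglyMeasurable
    (Eventually.of_forall (abs_curvature_le S.smooth_η))

lemma memLp_dx_g (S : FlatSolution η u g p q gt pt qt) : MemLp (glue fun i => dx (g i)) 2 := by
  have : (glue fun i => dx (g i)) = fun z => glue p z + deriv η z.1 * glue q z := by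
    ext z; simp only [glue, S.dx_g]
  rw [this]; exact S.memLp_p.add (S.memLp_slope_mul S.memLp_q)

lemma memLp_dz_g (S : FlatSolution η u g p q gt pt qt) : MemLp (glue fun i => dz (g i)) 2 := by
  have : (glue fun i => dz (g i)) = glue q := by ext z; simp only [glue, S.dz_g]
  rw [this]; exact S.memLp_q

/-- `D = ∫ κ h_t`. -/
lemma integral_curvature_mul (S : FlatSolution η u g p q gt pt qt) :
    ∫ x, curvature η x * u x = ∫ z, (glue p z ^ 2 + glue q z ^ 2) := by
  -- The test function is `g` itself; the two cross terms `η' p q` cancel.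
  rw [← S.weak_form (fun i => (S.smooth_g i).of_le (by simp)) S.trace_g S.memLp_curvature
    S.memLp_dx_g S.memLp_dz_g]
  congr 1; ext z; simp only [glue, S.dx_g, S.dz_g]; ring

/-- Expanding the derivative gives `u''/ℓ³`, which is in L², and a bounded multiple of `u' η''`,
where `u'` is bounded by Agmon's inequality. The function is the trace of the time derivative of
`f`, so Green's formula needs it in L². -/
lemma memLp_curvature_rate (S : FlatSolution η u g p q gt pt qt) :
    MemLp (deriv fun y => deriv u y / lineElement η y ^ 3) 2 ∧
    ContDiff ℝ ∞ (fun y => deriv u y / lineElement η y ^ 3) := by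
  have hc : ContDiff ℝ ∞ (fun y => deriv u y / lineElement η y ^ 3) :=
    (contDiff_deriv S.smooth_u).div ((contDiff_lineElement S.smooth_η).pow 3)
      fun x => (pow_pos (lineElement_pos η x) 3).ne'
  refine ⟨?_, hc⟩
  obtain ⟨A, hA0, hA⟩ := exists_abs_le (contDiff_deriv S.smooth_u) S.memLp_u1 S.memLp_u2
  have hd : ∀ x, deriv (fun y => deriv u y / lineElement η y ^ 3) x =
      deriv (deriv u) x / lineElement η x ^ 3 -
        3 * (deriv η x / lineElement η x) * deriv u x * (deriv (deriv η) x) / lineElement η x ^ 4 := by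
    intro x
    have h1 := (hasDerivAt_of_contDiff (contDiff_deriv S.smooth_u) x).fun_div
      ((hasDerivAt_lineElement S.smooth_η x).fun_pow 3) (pow_pos (lineElement_pos η x) 3).ne'
    rw [h1.deriv]
    have := lineElement_pos η x
    field_simp; push_cast; ring
  have hsum := S.memLp_u2.abs.add (S.memLp_η2.abs.const_mul (3 * A))
  refine MemLp.of_abs_le hsum (contDiff_deriv hc).continuous.aestronglyMeasurable
    (Eventually.of_forall fun x => ?_)
  have hl := one_le_lineElement η x
  have h1 : |deriv (deriv u) x / lineElement η x ^ 3| ≤ |deriv (deriv u) x| := by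
    rw [abs_div, abs_of_pos (pow_pos (lineElement_pos η x) 3)]
    exact div_le_self (abs_nonneg _) (one_le_pow₀ hl)
  have h2 : |3 * (deriv η x / lineElement η x) * deriv u x * (deriv (deriv η) x) /
      lineElement η x ^ 4| ≤ 3 * A * |deriv (deriv η) x| := by
    rw [abs_div, abs_of_pos (pow_pos (lineElement_pos η x) 4)]
    refine (div_le_self (abs_nonneg _) (one_le_pow₀ hl)).trans ?_
    rw [abs_mul, abs_mul, abs_mul, abs_of_pos (by norm_num : (0 : ℝ) < 3)]
    refine mul_le_mul_of_nonneg_right ?_ (abs_nonneg _)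
    have h3 : |deriv η x / lineElement η x| ≤ 1 := by
      rw [abs_div, abs_of_pos (lineElement_pos η x), div_le_one (lineElement_pos η x)]
      exact Real.abs_le_sqrt (by linarith)
    calc 3 * |deriv η x / lineElement η x| * |deriv u x| ≤ 3 * 1 * A := by
          gcongr; exact hA x
      _ = 3 * A := by ring
  rw [hd]
  simp only [Pi.add_apply, Pi.abs_apply]
  rw [abs_of_nonneg (a := |deriv (deriv u) x| + _) (by positivity)]
  exact (abs_sub _ _).trans (add_le_add h1 h2)

/-- The rate of change of the dissipation, up to a commutator. -/
lemma integral_rate (S : FlatSolution η u g p q gt pt qt) :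
    Integrable (fun z : ℝ × ℝ => deriv u z.1 * (glue p z * glue q z)) ∧
    ∫ z, (glue p z * glue pt z + glue q z * glue qt z) =
      - (∫ x, deriv u x ^ 2 / lineElement η x ^ 3) -
        ∫ z, deriv u z.1 * (glue p z * glue q z) := by
  obtain ⟨A, hA0, hA⟩ := exists_abs_le (contDiff_deriv S.smooth_u) S.memLp_u1 S.memLp_u2
  obtain ⟨hr, hrc⟩ := S.memLp_curvature_rate
  have hmu : MemLp (fun z : ℝ × ℝ => deriv u z.1 * glue q z) 2 :=
    memLp_bounded_mul ((contDiff_deriv S.smooth_u).continuous.comp continuous_fst).aestronglyMeasurable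
      (fun z => hA z.1) S.memLp_q
  have hint : Integrable (fun z : ℝ × ℝ => deriv u z.1 * (glue p z * glue q z)) :=
    (S.memLp_p.integrable_mul hmu).congr (Eventually.of_forall fun z => by
      simp only [Pi.mul_apply]; ring)
  refine ⟨hint, ?_⟩
  have hx : (glue fun i => dx (gt i)) =
      fun z => glue pt z + deriv η z.1 * glue qt z + deriv u z.1 * glue q z := by
    ext z; simp only [glue, S.dx_gt]
  have hz : (glue fun i => dz (gt i)) = glue qt := by ext z; simp only [glue, S.dz_gt]
  -- The test function is the time derivative of `f` in the moving coordinates. Its `x`-derivative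
  -- contains the additional term `u' q`, because the slope of the coordinate lines changes in time;
  -- this term is the commutator.
  have hw := S.weak_form (Ψ := gt) (fun i => (S.smooth_gt i).of_le (by simp)) S.trace_gt hr
    (by rw [hx]; exact (S.memLp_pt.add (S.memLp_slope_mul S.memLp_qt)).add hmu)
    (by rw [hz]; exact S.memLp_qt)
  have hm1 : Integrable fun z => glue p z * glue pt z + glue q z * glue qt z :=
    (S.memLp_p.integrable_mul S.memLp_pt).add (S.memLp_q.integrable_mul S.memLp_qt)
  have hl : ∫ z, (glue p z * glue (fun i => dx (gt i)) z +
      (glue q z - deriv η z.1 * glue p z) * glue (fun i => dz (gt i)) z) =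
      (∫ z, (glue p z * glue pt z + glue q z * glue qt z)) +
        ∫ z, deriv u z.1 * (glue p z * glue q z) := by
    rw [hx, hz, ← integral_add hm1 hint]
    congr 1; ext z; ring
  have hv : MemLp (fun y => deriv u y / lineElement η y ^ 3) 2 :=
    MemLp.of_abs_le S.memLp_u1 hrc.continuous.aestronglyMeasurable (Eventually.of_forall fun x => by
      rw [abs_div, abs_of_pos (pow_pos (lineElement_pos η x) 3)]
      exact div_le_self (abs_nonneg _) (one_le_pow₀ (one_le_lineElement η x)))
  have hparts := integral_mul_deriv_eq_deriv_mul_of_integrable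
    (u := u) (v := fun y => deriv u y / lineElement η y ^ 3)
    (fun x _ => hasDerivAt_of_contDiff S.smooth_u x) (fun x _ => hasDerivAt_of_contDiff hrc x)
    (S.memLp_u.integrable_mul hr) (S.memLp_u1.integrable_mul hv) (S.memLp_u.integrable_mul hv)
  have e1 : ∫ x, deriv (fun y => deriv u y / lineElement η y ^ 3) x * u x =
      - ∫ x, deriv u x ^ 2 / lineElement η x ^ 3 := by
    rw [show (fun x => deriv (fun y => deriv u y / lineElement η y ^ 3) x * u x) =
      fun x => u x * deriv (fun y => deriv u y / lineElement η y ^ 3) x by ext x; ring, hparts]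
    congr 2; ext x; ring
  rw [hl, e1] at hw
  linarith

end FlatSolution

end MullinsSekerka

end

/-! ### Absorption of the cubic terms and the tangentially differentiated equation -/

noncomputable section

namespace MullinsSekerka

open MeasureTheory Filter Set
open scoped Topology ContDiff

/-- Young's inequality with exponents 3/2 and 3: the cube of `ε Z + M X` contains `3 ε M² X² Z`, and
`M = c/ε + 1` ensures `ε M² ≥ c`. -/
lemma le_of_cube_le {z X Z c ε : ℝ} (hε : 0 < ε) (hc : 0 ≤ c) (hX : 0 ≤ X) (hZ : 0 ≤ Z)
    (h : z ^ 3 ≤ c * X ^ 2 * Z) : z ≤ ε * Z + (c / ε + 1) * X := by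
  by_contra! hcon
  set M := c / ε + 1 with hM
  have hM1 : 1 ≤ M := by rw [hM]; linarith [div_nonneg hc hε.le]
  have hMc : c ≤ M ^ 2 * ε := by
    have : c = (M - 1) * ε := by rw [hM]; field_simp; ring
    nlinarith
  have h0 : 0 ≤ ε * Z + M * X := by positivity
  have h1 : (ε * Z + M * X) ^ 3 < z ^ 3 := pow_lt_pow_left₀ hcon h0 (by norm_num)
  have h2 : 3 * (M ^ 2 * ε) * (X ^ 2 * Z) ≤ (ε * Z + M * X) ^ 3 := by
    have : (ε * Z + M * X) ^ 3 - 3 * (M ^ 2 * ε) * (X ^ 2 * Z) =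
      (ε * Z) ^ 3 + 3 * (ε * Z) ^ 2 * (M * X) + (M * X) ^ 3 := by ring
    have : 0 ≤ (ε * Z) ^ 3 + 3 * (ε * Z) ^ 2 * (M * X) + (M * X) ^ 3 := by positivity
    linarith
  have h3 : c * (X ^ 2 * Z) ≤ (M ^ 2 * ε) * (X ^ 2 * Z) :=
    mul_le_mul_of_nonneg_right hMc (by positivity)
  have h4 : 0 ≤ (M ^ 2 * ε) * (X ^ 2 * Z) := by positivity
  linarith

/-- Absorption of the cubic terms in the differential inequality for the dissipation. -/
lemma exists_absorption (c₀ : ℝ) (hc₀ : 0 ≤ c₀) : ∃ C : ℝ, 0 < C ∧ ∀ r n k w e z : ℝ, 0 ≤ r → 0 ≤ n → 0 ≤ k →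
    0 ≤ w → 0 ≤ e → n ^ 4 ≤ 2 * r * n * w + 3 * k * r * n ^ 3 → k ^ 6 ≤ c₀ * r ^ 8 * e ^ 2 →
    z ^ 3 ≤ c₀ * r ^ 12 * e ^ 2 * w ^ 4 →
    3 * (w * r ^ 3 * n) + 3 * z ≤ w ^ 2 / 6 + C * (r ^ 10 + e ^ 2 * r ^ 12) := by
  set c₁ := 32 + 2048 * c₀ with hc₁
  have hc₁0 : 0 ≤ c₁ := by positivity
  refine ⟨10000 * c₀ + 3 + 27 * (c₁ / (1 / 600) + 1) + 27, by positivity, ?_⟩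
  intro r n k w e z hr hn hk hw he h1 h2 h3
  -- In the application `r⁴ = D`, `n⁴` is the integral of `p_x² + q_x²`, `k` and `w` are the L²
  -- norms of `η''` and `u'`, `e² = E`, and `z` dominates `∫ u² η''²`. Thus `X = D^{5/2}` and `Y = E
  -- D³`.
  set X := r ^ 10 with hX
  set Y := e ^ 2 * r ^ 12 with hY
  have hX0 : 0 ≤ X := by positivity
  have hY0 : 0 ≤ Y := by positivity
  -- The coefficients are such that one mixed term in the cube of the right-hand side is exactly `c₀
  -- Y w⁴`.
  have hz : z ≤ (1 / 100) * w ^ 2 + (c₀ * 10000) * Y / 3 + Y := by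
    by_contra! hcon
    have h0 : 0 ≤ (1 / 100) * w ^ 2 + (c₀ * 10000) * Y / 3 + Y := by positivity
    have h4 := pow_lt_pow_left₀ hcon h0 (by norm_num : 3 ≠ 0)
    have h5 : c₀ * Y * w ^ 4 ≤ ((1 / 100) * w ^ 2 + (c₀ * 10000) * Y / 3 + Y) ^ 3 := by
      have e1 : ((1 / 100) * w ^ 2 + (c₀ * 10000) * Y / 3 + Y) ^ 3 =
        3 * ((1 / 100) * w ^ 2) ^ 2 * ((c₀ * 10000) * Y / 3) + (((1 / 100) * w ^ 2) ^ 3 +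
        3 * ((1 / 100) * w ^ 2) ^ 2 * Y + 3 * ((1 / 100) * w ^ 2) * ((c₀ * 10000) * Y / 3 + Y) ^ 2 +
        ((c₀ * 10000) * Y / 3 + Y) ^ 3) := by ring
      have e2 : 0 ≤ ((1 / 100) * w ^ 2) ^ 3 +
        3 * ((1 / 100) * w ^ 2) ^ 2 * Y + 3 * ((1 / 100) * w ^ 2) * ((c₀ * 10000) * Y / 3 + Y) ^ 2 +
        ((c₀ * 10000) * Y / 3 + Y) ^ 3 := by positivity
      have e3 : 0 ≤ c₀ * Y * w ^ 4 := by positivity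
      rw [e1]
      have e4 : 3 * ((1 / 100) * w ^ 2) ^ 2 * ((c₀ * 10000) * Y / 3) =
        (1) * (c₀ * Y * w ^ 4) := by ring
      rw [e4]
      linarith
    have h6 : c₀ * r ^ 12 * e ^ 2 * w ^ 4 = c₀ * Y * w ^ 4 := by rw [hY]; ring
    linarith
  -- The hypothesis is divided by `n`, and with `a = k r` the quadratic term is absorbed through `3
  -- a n² ≤ n³/2 + 16 a³`.
  have hn3 : n ^ 3 ≤ 4 * r * w + 32 * (k * r) ^ 3 := by
    rcases hn.eq_or_lt with h0 | h0
    · rw [← h0]; simp only [ne_eq, OfNat.ofNat_ne_zero, not_false_eq_true, zero_pow]; positivity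
    have e1 : n ^ 3 ≤ 2 * r * w + 3 * (k * r) * n ^ 2 := by
      have : n * n ^ 3 ≤ n * (2 * r * w + 3 * (k * r) * n ^ 2) := by nlinarith
      exact le_of_mul_le_mul_left this h0
    have e2 : 3 * (k * r) * n ^ 2 ≤ n ^ 3 / 2 + 16 * (k * r) ^ 3 := by
      have hkr : 0 ≤ k * r := mul_nonneg hk hr
      have : n ^ 3 / 2 + 16 * (k * r) ^ 3 - 3 * (k * r) * n ^ 2 =
        (n - 4 * (k * r)) ^ 2 * (n / 2 + k * r) := by ring
      have : 0 ≤ (n - 4 * (k * r)) ^ 2 * (n / 2 + k * r) := by positivity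
      linarith
    linarith
  have hn6 : n ^ 6 ≤ 32 * r ^ 2 * w ^ 2 + 2048 * (k ^ 6 * r ^ 6) := by
    have e1 : (n ^ 3) ^ 2 ≤ (4 * r * w + 32 * (k * r) ^ 3) ^ 2 :=
      pow_le_pow_left₀ (by positivity) hn3 2
    nlinarith [sq_nonneg (4 * r * w - 32 * (k * r) ^ 3)]
  have hy : (r ^ 6 * n ^ 2) ^ 3 ≤ c₁ * X ^ 2 * (w ^ 2 + Y) := by
    have e1 : (r ^ 6 * n ^ 2) ^ 3 = r ^ 18 * n ^ 6 := by ring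
    have e2 : r ^ 18 * n ^ 6 ≤ r ^ 18 * (32 * r ^ 2 * w ^ 2 + 2048 * (c₀ * r ^ 8 * e ^ 2 * r ^ 6)) := by
      apply mul_le_mul_of_nonneg_left _ (by positivity)
      have := mul_le_mul_of_nonneg_right h2 (by positivity : 0 ≤ r ^ 6)
      linarith
    have e3 : c₁ * X ^ 2 * (w ^ 2 + Y) = r ^ 18 * (32 * r ^ 2 * w ^ 2 +
        2048 * (c₀ * r ^ 8 * e ^ 2 * r ^ 6)) + (2048 * c₀ * X ^ 2 * w ^ 2 + 32 * X ^ 2 * Y) := by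
      rw [hc₁, hX, hY]; ring
    have e4 : 0 ≤ 2048 * c₀ * X ^ 2 * w ^ 2 + 32 * X ^ 2 * Y := by positivity
    linarith
  -- The budget for `w²`: 27/600 from here, 1/12 from `hT` and 3/100 from `hz`, together less than
  -- 1/6.
  have hy' := le_of_cube_le (by norm_num : (0 : ℝ) < 1 / 600) hc₁0 hX0 (by positivity) hy
  have hT : 3 * (w * r ^ 3 * n) ≤ w ^ 2 / 12 + 27 * (r ^ 6 * n ^ 2) := by
    nlinarith [sq_nonneg (w - 18 * (r ^ 3 * n))]
  have hp2 : 0 ≤ c₁ / (1 / 600) * Y := by positivity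
  have hp3 : 0 ≤ c₀ * X := by positivity
  have hp4 : 0 ≤ c₀ * Y := by positivity
  have hw2 : 0 ≤ w ^ 2 := sq_nonneg w
  generalize c₁ / (1 / 600) = c₂ at hy' hp2 ⊢
  have e1 : (10000 * c₀ + 3 + 27 * (c₂ + 1) + 27) * (X + Y) = 10000 * (c₀ * X) + 10000 * (c₀ * Y) +
    57 * X + 57 * Y + 27 * (c₂ * X) + 27 * (c₂ * Y) := by ring
  have e2 : (c₂ + 1) * X = c₂ * X + X := by ring
  linarith

namespace FlatSolution

variable {η u : ℝ → ℝ} {g p q gt pt qt : Bool → ℝ × ℝ → ℝ}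

/-- `κ'` is the trace of `∂ₓ g`, and the `y`-derivative of `∂ₓ g` is `∂ₓ q`. Second derivatives of
`f` in the bulk thus control the third derivative of the height, whose square integrability is not
among the assumptions. -/
lemma memLp_dcurvature (S : FlatSolution η u g p q gt pt qt) :
    MemLp (deriv (curvature η)) 2 ∧ ∫ x, deriv (curvature η) x ^ 2 ≤
      2 * (l2norm (glue fun i => dx (g i)) * l2norm (glue fun i => dx (q i))) := by
  have e : (fun x => dx (g true) (x, 0)) = deriv (curvature η) := by
    ext x
    have h1 := hasDerivAt_dx ((S.smooth_g true).differentiable (by simp) (x, 0))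
    have h2 : (fun y => g true (y, ((x, 0) : ℝ × ℝ).2)) = curvature η :=
      funext fun y => S.trace_g true y
    rw [h2] at h1
    exact h1.deriv.symm
  have := integral_trace_sq_le (v := dx (g true)) (V := glue fun i => dx (g i))
    (Vy := glue fun i => dx (q i)) ((contDiff_dx (S.smooth_g true)).of_le (by simp)) S.memLp_dx_g
    S.memLp_qx (fun z hz => glue_of_pos _ hz) (fun z hz => by
      rw [glue_of_pos _ hz, dz_dx_comm (S.smooth_g true)]
      congr 1; ext y; exact (S.dz_g true y).symm)
  rw [e] at this
  refine ⟨this.1, le_trans (le_of_eq ?_) this.2⟩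
  congr 1; ext x
  rw [← e]

lemma memLp_curv_mul_p (S : FlatSolution η u g p q gt pt qt) {w : ℝ → ℝ} (hw : MemLp w 2) :
    MemLp (fun z : ℝ × ℝ => w z.1 * glue p z) 2 ∧ ∫ z : ℝ × ℝ, (w z.1 * glue p z) ^ 2 ≤
      (∫ x, w x ^ 2) * (2 * (l2norm (glue p) * l2norm (glue fun i => dx (p i)))) :=
  memLp_weight_mul hw S.memLp_p S.memLp_px fun z _ => hasDerivAt_glue S.smooth_p z

lemma memLp_curv_mul_q (S : FlatSolution η u g p q gt pt qt) {w : ℝ → ℝ} (hw : MemLp w 2) :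
    MemLp (fun z : ℝ × ℝ => w z.1 * glue q z) 2 ∧ ∫ z : ℝ × ℝ, (w z.1 * glue q z) ^ 2 ≤
      (∫ x, w x ^ 2) * (2 * (l2norm (glue q) * l2norm (glue fun i => dx (q i)))) :=
  memLp_weight_mul hw S.memLp_q S.memLp_qx fun z _ => hasDerivAt_glue S.smooth_q z

/-- The equation differentiated in `x`, tested with `∂ₓ g`. -/
lemma second_order_identity (S : FlatSolution η u g p q gt pt qt) :
    (∫ z, (glue (fun i => dx (p i)) z ^ 2 + glue (fun i => dx (q i)) z ^ 2)) +
      ∫ z : ℝ × ℝ, ((deriv (deriv η) z.1 * glue q z) * glue (fun i => dx (p i)) z -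
        (deriv (deriv η) z.1 * glue p z) * glue (fun i => dx (q i)) z) =
      ∫ x, deriv (curvature η) x * deriv u x := by
  have hfl : ∀ i z, dx (flux η p q i) z = dx (q i) z - (deriv (deriv η) z.1 * p i z +
      deriv η z.1 * dx (p i) z) := fun i z => by
    unfold flux
    rw [dx_sub (S.smooth_q i) (S.contDiff_slope_fst.mul (S.smooth_p i)), S.dx_slope_mul (S.smooth_p i)]
  have hdxx : ∀ i z, dx (dx (g i)) z = dx (p i) z + (deriv (deriv η) z.1 * q i z +
      deriv η z.1 * dx (q i) z) := fun i z => by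
    have : dx (g i) = fun z => p i z + deriv η z.1 * q i z := funext (S.dx_g i)
    rw [this, dx_add (S.smooth_p i) (S.contDiff_slope_fst.mul (S.smooth_q i)),
      S.dx_slope_mul (S.smooth_q i)]
  have hdxz : ∀ i z, dz (dx (g i)) z = dx (q i) z := fun i z => by
    rw [dz_dx_comm (S.smooth_g i)]; congr 1; ext y; exact S.dz_g i y
  have mp := (S.memLp_curv_mul_p S.memLp_η2).1
  have mq := (S.memLp_curv_mul_q S.memLp_η2).1
  -- Tangential differentiation keeps the field divergence free and turns the jump into `u'` and the
  -- trace into `κ'`. The commutators arise where `∂ₓ` falls on `η'`.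
  have hw := green (B1 := fun i => dx (p i)) (B2 := fun i => dx (flux η p q i))
    (Ψ := fun i => dx (g i)) (ψ₀ := deriv (curvature η)) (w := deriv u)
    (fun i => (contDiff_dx (S.smooth_p i)).of_le (by simp))
    (fun i => (contDiff_dx (S.smooth_flux i)).of_le (by simp))
    (fun i => (contDiff_dx (S.smooth_g i)).of_le (by simp)) ?_ ?_ S.memLp_dcurvature.1 ?_
    S.memLp_u1 S.memLp_px ?_ ?_ ?_
  · rw [← hw]
    have i1 : Integrable fun z => glue (fun i => dx (p i)) z ^ 2 + glue (fun i => dx (q i)) z ^ 2 :=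
      S.memLp_px.integrable_sq.add S.memLp_qx.integrable_sq
    have i2 : Integrable fun z : ℝ × ℝ => (deriv (deriv η) z.1 * glue q z) * glue (fun i => dx (p i)) z -
        (deriv (deriv η) z.1 * glue p z) * glue (fun i => dx (q i)) z :=
      (mq.integrable_mul S.memLp_px).sub (mp.integrable_mul S.memLp_qx)
    rw [← integral_add i1 i2]
    congr 1; ext z
    simp only [glue, hfl, hdxx, hdxz]; ring
  · intro i z hz
    have ho : IsOpen {z : ℝ × ℝ | 0 < sgn i * z.2} :=
      isOpen_lt continuous_const (by fun_prop)
    have he : (fun z => dx (p i) z + dz (flux η p q i) z) =ᶠ[𝓝 z] fun _ => 0 := by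
      filter_upwards [ho.mem_nhds hz] with y hy using S.div_flux i y hy
    rw [dz_dx_comm (S.smooth_flux i), ← dx_add (contDiff_dx (S.smooth_p i)) (contDiff_dz (S.smooth_flux i))]
    unfold dx at he ⊢
    rw [he.fderiv_eq]; simp
  · intro i x
    have h1 := hasDerivAt_dx ((S.smooth_g i).differentiable (by simp) (x, 0))
    have h2 : (fun y => g i (y, ((x, 0) : ℝ × ℝ).2)) = curvature η :=
      funext fun y => S.trace_g i y
    rw [h2] at h1
    exact h1.deriv.symm
  · intro x
    have h1 : ∀ i, HasDerivAt (fun y => flux η p q i (y, 0)) (dx (flux η p q i) (x, 0)) x := fun i =>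
      hasDerivAt_dx (q := (x, 0)) ((S.smooth_flux i).differentiable (by simp) (x, 0))
    have h2 := (h1 false).fun_sub (h1 true)
    have h3 : (fun y => flux η p q false (y, 0) - flux η p q true (y, 0)) = u :=
      funext fun y => S.jump y
    rw [h3] at h2
    exact h2.deriv.symm
  · have : (glue fun i => dx (flux η p q i)) = fun z => glue (fun i => dx (q i)) z -
        (deriv (deriv η) z.1 * glue p z + deriv η z.1 * glue (fun i => dx (p i)) z) := by
      ext z; simp only [glue, hfl]
    rw [this]
    exact S.memLp_qx.sub (mp.add (S.memLp_slope_mul S.memLp_px))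
  · have : (glue fun i => dx (dx (g i))) = fun z => glue (fun i => dx (p i)) z +
        (deriv (deriv η) z.1 * glue q z + deriv η z.1 * glue (fun i => dx (q i)) z) := by
      ext z; simp only [glue, hdxx]
    rw [this]
    exact S.memLp_px.add (mq.add (S.memLp_slope_mul S.memLp_qx))
  · have : (glue fun i => dz (dx (g i))) = glue fun i => dx (q i) := by
      ext z; simp only [glue, hdxz]
    rw [this]; exact S.memLp_qx

end FlatSolution

end MullinsSekerka

end

/-! ### Interpolation inequalities and the bound for the rate of the dissipation -/

noncomputable section

namespace MullinsSekerka

open MeasureTheory Filter Set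
open scoped Topology ContDiff

lemma lineElement_le_two {η : ℝ → ℝ} (h : ∀ x, |deriv η x| ≤ 1) (x : ℝ) :
    lineElement η x ^ 2 ≤ 2 ∧ lineElement η x ≤ 3 / 2 := by
  have h1 : deriv η x ^ 2 ≤ 1 := by
    rw [← sq_abs]; exact pow_le_one₀ (abs_nonneg _) (h x)
  have h2 := lineElement_sq η x
  have h3 := lineElement_pos η x
  exact ⟨by linarith, by nlinarith⟩

lemma lineElement_sub_one_bounds (η : ℝ → ℝ) (x : ℝ) :
    0 ≤ lineElement η x - 1 ∧ lineElement η x - 1 ≤ deriv η x ^ 2 / 2 := by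
  have h1 := one_le_lineElement η x
  have h2 := lineElement_sq η x
  exact ⟨by linarith, by nlinarith⟩

lemma integrable_lineElement_sub_one {η : ℝ → ℝ} (hη : ContDiff ℝ ∞ η) (h : MemLp (deriv η) 2) :
    Integrable fun x => lineElement η x - 1 := by
  refine (h.integrable_sq.div_const 2).mono'
    ((contDiff_lineElement hη).continuous.sub continuous_const).aestronglyMeasurable
    (Eventually.of_forall fun x => ?_)
  have := lineElement_sub_one_bounds η x
  rw [Real.norm_eq_abs, abs_of_nonneg this.1]; exact this.2

lemma energy_nonneg (η : ℝ → ℝ) : 0 ≤ energy η :=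
  integral_nonneg fun x => (lineElement_sub_one_bounds η x).1

/-- With `ℓ` the line element, `η'² = (ℓ - 1)(ℓ + 1)`, and `1 ≤ ℓ ≤ 3/2` for slopes at most one. -/
lemma energy_bounds {η : ℝ → ℝ} (hη : ContDiff ℝ ∞ η) (h : MemLp (deriv η) 2)
    (hL : ∀ x, |deriv η x| ≤ 1) :
    ∫ x, deriv η x ^ 2 ≤ 3 * energy η ∧ energy η ≤ ∫ x, deriv η x ^ 2 := by
  have hi := integrable_lineElement_sub_one hη h
  constructor
  · unfold energy
    rw [← integral_const_mul]
    refine integral_mono h.integrable_sq (hi.const_mul 3) fun x => ?_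
    have h1 := one_le_lineElement η x
    have h2 := lineElement_sq η x
    have h3 := (lineElement_le_two hL x).2
    simp only; nlinarith
  · refine integral_mono hi h.integrable_sq fun x => ?_
    have := (lineElement_sub_one_bounds η x).2
    simp only; nlinarith [sq_nonneg (deriv η x)]

namespace FlatSolution

variable {η u : ℝ → ℝ} {g p q gt pt qt : Bool → ℝ × ℝ → ℝ}

lemma sq_deriv_le_one (hL : ∀ x, |deriv η x| ≤ 1) (x : ℝ) : deriv η x ^ 2 ≤ 1 := by
  rw [← sq_abs]; exact pow_le_one₀ (abs_nonneg _) (hL x)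

lemma integral_sq_le_of_le {v w : ℝ × ℝ → ℝ} (hw : Integrable w) (h : ∀ z, v z ^ 2 ≤ w z) :
    ∫ z, v z ^ 2 ≤ ∫ z, w z :=
  integral_mono_of_nonneg (Eventually.of_forall fun _ => sq_nonneg _) hw (Eventually.of_forall h)

lemma integrable_sq_add_sq (S : FlatSolution η u g p q gt pt qt) :
    Integrable fun z => glue p z ^ 2 + glue q z ^ 2 :=
  S.memLp_p.integrable_sq.add S.memLp_q.integrable_sq

/-- The rotated gradient `(∂_y g, -∂ₓ g)` of the upper phase is divergence free by the symmetry of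
second derivatives; extended by zero below, it has normal jump `κ'`. Paired with the slope, this
jump gives `-∫ κ²`. The duality estimate reads `K⁴ ≤ 64 D² K ∫ η'²` for `K = ∫ κ²`, and one factor
`K` is cancelled. -/
lemma integral_curvature_sq_pow_le (S : FlatSolution η u g p q gt pt qt)
    (hL : ∀ x, |deriv η x| ≤ 1) :
    (∫ x, curvature η x ^ 2) ^ 3 ≤ 64 * (∫ z, (glue p z ^ 2 + glue q z ^ 2)) ^ 2 *
      ∫ x, deriv η x ^ 2 := by
  set D := ∫ z, (glue p z ^ 2 + glue q z ^ 2) with hD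
  have hκ := S.memLp_curvature
  have hs : MemLp (slope η) 2 := MemLp.of_abs_le S.memLp_η1
    (contDiff_slope S.smooth_η).continuous.aestronglyMeasurable
    (Eventually.of_forall (abs_slope_le η))
  have hpar := integral_slope_mul S.smooth_η S.memLp_η1 S.memLp_η2 (contDiff_curvature S.smooth_η)
    hκ S.memLp_dcurvature.1
  set B1 : Bool → ℝ × ℝ → ℝ := fun i z => if i then q i z else 0 with hB1
  set B2 : Bool → ℝ × ℝ → ℝ := fun i z => if i then - dx (g i) z else 0 with hB2
  have hdg : ContDiff ℝ ∞ (dx (g true)) := contDiff_dx (S.smooth_g true)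
  have c1 : ∀ i, ContDiff ℝ 1 (B1 i) := fun i => by
    cases i
    · simpa [hB1] using contDiff_const
    · simpa [hB1] using (S.smooth_q true).of_le (by simp)
  have c2 : ∀ i, ContDiff ℝ 1 (B2 i) := fun i => by
    cases i
    · simpa [hB2] using contDiff_const
    · have h1 : ContDiff ℝ 1 (dx (g true)) := hdg.of_le (by simp)
      have h2 : B2 true = fun z => -dx (g true) z := rfl
      rw [h2]; exact h1.neg
  have b1 : ∀ z, |glue B1 z| ≤ |glue q z| := fun z => by
    simp only [glue, hB1]; split_ifs <;> simp
  have b2 : ∀ z, |glue B2 z| ≤ |glue (fun i => dx (g i)) z| := fun z => by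
    simp only [glue, hB2]; split_ifs <;> simp
  have key := pow_four_integral_mul_jump_le (B1 := B1) (B2 := B2) (v := slope η)
    (w := deriv (curvature η)) (D := D) c1 c2 ?_ ?_ S.memLp_dcurvature.1
    (MemLp.of_abs_le S.memLp_q (measurable_glue fun i => (c1 i).continuous.measurable).aestronglyMeasurable
      (Eventually.of_forall b1))
    (MemLp.of_abs_le S.memLp_dx_g (measurable_glue fun i => (c2 i).continuous.measurable).aestronglyMeasurable
      (Eventually.of_forall b2)) (contDiff_slope S.smooth_η) hs hκ ?_ ?_
  · rw [hpar] at key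
    have e1 : ∫ x, curvature η x * curvature η x = ∫ x, curvature η x ^ 2 := by
      congr 1; ext x; ring
    have e2 : ∫ x, slope η x ^ 2 ≤ ∫ x, deriv η x ^ 2 :=
      integral_mono hs.integrable_sq S.memLp_η1.integrable_sq fun x => sq_le_sq.2 (abs_slope_le η x)
    rw [e1] at key
    change (-∫ x, curvature η x ^ 2) ^ 4 ≤ 64 * D ^ 2 * (∫ x, curvature η x ^ 2) * _ at key
    set K := ∫ x, curvature η x ^ 2 with hK
    have hK0 : 0 ≤ K := integral_nonneg fun _ => sq_nonneg _
    have hA0 : 0 ≤ ∫ x, deriv η x ^ 2 := integral_nonneg fun _ => sq_nonneg _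
    rcases hK0.eq_or_lt with h0 | h0
    · rw [← h0]; simp only [ne_eq, OfNat.ofNat_ne_zero, not_false_eq_true, zero_pow]; positivity
    have h1 : K * K ^ 3 ≤ K * (64 * D ^ 2 * ∫ x, deriv η x ^ 2) := by
      have := mul_le_mul_of_nonneg_left e2 (by positivity : 0 ≤ 64 * D ^ 2 * K)
      nlinarith
    exact le_of_mul_le_mul_left h1 h0
  · intro i z hz
    cases i
    · have e1 : B1 false = fun _ => 0 := rfl
      have e2 : B2 false = fun _ => 0 := rfl
      simp [e1, e2, dx, dz]
    · have e1 : B1 true = dz (g true) := by ext z; simp [hB1, S.dz_g]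
      have e2 : B2 true = fun z => - dx (g true) z := rfl
      rw [e1, e2, ← dz_dx_comm (S.smooth_g true)]
      simp [dz, fderiv_fun_neg]
  · intro x
    have h1 := hasDerivAt_dx ((S.smooth_g true).differentiable (by simp) (x, 0))
    have h2 : (fun y => g true (y, ((x, 0) : ℝ × ℝ).2)) = curvature η :=
      funext fun y => S.trace_g true y
    rw [h2] at h1
    simp [hB2, h1.deriv]
  · refine integral_sq_le_of_le S.integrable_sq_add_sq fun z => ?_
    have := sq_le_sq.2 (b1 z)
    nlinarith [sq_nonneg (glue p z)]
  · rw [hD, ← integral_const_mul]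
    refine integral_sq_le_of_le (S.integrable_sq_add_sq.const_mul 2) fun z => ?_
    refine (sq_le_sq.2 (b2 z)).trans ?_
    have e : glue (fun i => dx (g i)) z = glue p z + deriv η z.1 * glue q z := by
      simp only [glue, S.dx_g]
    rw [e]
    have := sq_deriv_le_one hL z.1
    nlinarith [sq_nonneg (glue p z - deriv η z.1 * glue q z), mul_le_mul_of_nonneg_right this (sq_nonneg (glue q z))]

/-- The flux has jump `u` and is paired with `u` itself; one factor `∫ u²` is then cancelled. -/
lemma integral_velocity_sq_pow_le (S : FlatSolution η u g p q gt pt qt)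
    (hL : ∀ x, |deriv η x| ≤ 1) :
    (∫ x, u x ^ 2) ^ 3 ≤ 64 * (∫ z, (glue p z ^ 2 + glue q z ^ 2)) ^ 2 *
      ∫ x, deriv u x ^ 2 := by
  set D := ∫ z, (glue p z ^ 2 + glue q z ^ 2) with hD
  have key := pow_four_integral_mul_jump_le (B1 := p) (B2 := flux η p q) (v := u)
    (w := u) (D := D) (fun i => (S.smooth_p i).of_le (by simp))
    (fun i => (S.smooth_flux i).of_le (by simp)) S.div_flux S.jump S.memLp_u S.memLp_p S.memLp_flux
    S.smooth_u S.memLp_u S.memLp_u1 ?_ ?_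
  · have e1 : ∫ x, u x * u x = ∫ x, u x ^ 2 := by congr 1; ext x; ring
    rw [e1] at key
    set K := ∫ x, u x ^ 2 with hK
    have hK0 : 0 ≤ K := integral_nonneg fun _ => sq_nonneg _
    have hA0 : 0 ≤ ∫ x, deriv u x ^ 2 := integral_nonneg fun _ => sq_nonneg _
    rcases hK0.eq_or_lt with h0 | h0
    · rw [← h0]; simp only [ne_eq, OfNat.ofNat_ne_zero, not_false_eq_true, zero_pow]; positivity
    have h1 : K * K ^ 3 ≤ K * (64 * D ^ 2 * ∫ x, deriv u x ^ 2) := by nlinarith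
    exact le_of_mul_le_mul_left h1 h0
  · refine integral_sq_le_of_le S.integrable_sq_add_sq fun z => ?_
    nlinarith [sq_nonneg (glue q z)]
  · rw [hD, ← integral_const_mul]
    refine integral_sq_le_of_le (S.integrable_sq_add_sq.const_mul 2) fun z => ?_
    have e : glue (flux η p q) z = glue q z - deriv η z.1 * glue p z := rfl
    rw [e]
    have := sq_deriv_le_one hL z.1
    nlinarith [sq_nonneg (glue q z + deriv η z.1 * glue p z), mul_le_mul_of_nonneg_right this (sq_nonneg (glue p z))]

/-- For slopes at most one, `η''² = κ² ℓ⁶ ≤ 8 κ²` and `∫ η'² ≤ 3 E`; the constant is `8³ · 64 · 3`.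
-/
lemma integral_curv_sq_pow_le (S : FlatSolution η u g p q gt pt qt) (hL : ∀ x, |deriv η x| ≤ 1) :
    (∫ x, deriv (deriv η) x ^ 2) ^ 3 ≤ 98304 * (∫ z, (glue p z ^ 2 + glue q z ^ 2)) ^ 2 *
      energy η := by
  have h1 : ∫ x, deriv (deriv η) x ^ 2 ≤ 8 * ∫ x, curvature η x ^ 2 := by
    rw [← integral_const_mul]
    refine integral_mono S.memLp_η2.integrable_sq (S.memLp_curvature.integrable_sq.const_mul 8)
      fun x => ?_
    have h2 := (lineElement_le_two hL x).1
    have h3 : deriv (deriv η) x = curvature η x * lineElement η x ^ 3 := by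
      rw [curvature_eq S.smooth_η]
      have := lineElement_pos η x
      field_simp
    have h4 : (lineElement η x ^ 2) ^ 3 ≤ 2 ^ 3 := pow_le_pow_left₀ (sq_nonneg _) h2 3
    simp only
    rw [h3, mul_pow]
    nlinarith [sq_nonneg (curvature η x), mul_le_mul_of_nonneg_left h4 (sq_nonneg (curvature η x))]
  have h0 : 0 ≤ ∫ x, deriv (deriv η) x ^ 2 := integral_nonneg fun _ => sq_nonneg _
  have h2 := pow_le_pow_left₀ h0 h1 3
  have h3 := S.integral_curvature_sq_pow_le hL
  have h4 := (energy_bounds S.smooth_η S.memLp_η1 hL).1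
  have h5 := mul_le_mul_of_nonneg_left h4
    (by positivity : 0 ≤ 64 * (∫ z, (glue p z ^ 2 + glue q z ^ 2)) ^ 2)
  calc _ ≤ _ := h2
    _ = 512 * (∫ x, curvature η x ^ 2) ^ 3 := by ring
    _ ≤ 512 * (64 * (∫ z, (glue p z ^ 2 + glue q z ^ 2)) ^ 2 * (3 * energy η)) := by
      gcongr; exact h3.trans h5
    _ = _ := by ring

lemma l2norm_le_of_sq_le {X : Type*} [MeasureSpace X] {f : X → ℝ} {c : ℝ} (hc : 0 ≤ c)
    (h : ∫ x, f x ^ 2 ≤ c ^ 2) : l2norm f ≤ c := Real.sqrt_le_iff.2 ⟨hc, h⟩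

/-- The bound for the second derivatives of `f`, with `n⁴ = ∫ p_x² + q_x²`. -/
lemma second_order_bound (S : FlatSolution η u g p q gt pt qt) (hL : ∀ x, |deriv η x| ≤ 1)
    {r n : ℝ} (hr : 0 ≤ r) (hn : 0 ≤ n)
    (hD : ∫ z, (glue p z ^ 2 + glue q z ^ 2) = r ^ 4)
    (hN : ∫ z, (glue (fun i => dx (p i)) z ^ 2 + glue (fun i => dx (q i)) z ^ 2) = n ^ 4) :
    n ^ 4 ≤ 2 * r * n * l2norm (deriv u) + 3 * l2norm (deriv (deriv η)) * r * n ^ 3 := by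
  have i2 := S.memLp_px.integrable_sq.add S.memLp_qx.integrable_sq
  have np : l2norm (glue p) ≤ r ^ 2 := l2norm_le_of_sq_le (by positivity) (by
    rw [← pow_mul, ← hD]
    exact integral_sq_le_of_le S.integrable_sq_add_sq fun z => by nlinarith [sq_nonneg (glue q z)])
  have nq : l2norm (glue q) ≤ r ^ 2 := l2norm_le_of_sq_le (by positivity) (by
    rw [← pow_mul, ← hD]
    exact integral_sq_le_of_le S.integrable_sq_add_sq fun z => by nlinarith [sq_nonneg (glue p z)])
  have npx : l2norm (glue fun i => dx (p i)) ≤ n ^ 2 := l2norm_le_of_sq_le (by positivity) (by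
    rw [← pow_mul, ← hN]
    exact integral_sq_le_of_le i2 fun z => le_add_of_nonneg_right (sq_nonneg _))
  have nqx : l2norm (glue fun i => dx (q i)) ≤ n ^ 2 := l2norm_le_of_sq_le (by positivity) (by
    rw [← pow_mul, ← hN]
    exact integral_sq_le_of_le i2 fun z => le_add_of_nonneg_left (sq_nonneg _))
  have ngx : l2norm (glue fun i => dx (g i)) ≤ 2 * r ^ 2 := l2norm_le_of_sq_le (by positivity) (by
    have : (2 * r ^ 2) ^ 2 = 4 * r ^ 4 := by ring
    rw [this, ← hD, ← integral_const_mul]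
    refine integral_sq_le_of_le (S.integrable_sq_add_sq.const_mul 4) fun z => ?_
    have e : glue (fun i => dx (g i)) z = glue p z + deriv η z.1 * glue q z := by
      simp only [glue, S.dx_g]
    rw [e]
    have := sq_deriv_le_one hL z.1
    nlinarith [sq_nonneg (glue p z - deriv η z.1 * glue q z), mul_le_mul_of_nonneg_right this (sq_nonneg (glue q z)), sq_nonneg (glue p z), sq_nonneg (glue q z)])
  set k := l2norm (deriv (deriv η)) with hk
  have hk0 : 0 ≤ k := l2norm_nonneg _
  set w := l2norm (deriv u) with hw
  have hw0 : 0 ≤ w := l2norm_nonneg _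
  have nκ : l2norm (deriv (curvature η)) ≤ 2 * r * n := l2norm_le_of_sq_le (by positivity) (by
    refine S.memLp_dcurvature.2.trans ?_
    have : (2 * r * n) ^ 2 = 2 * ((2 * r ^ 2) * n ^ 2) := by ring
    rw [this]
    exact mul_le_mul_of_nonneg_left (mul_le_mul ngx nqx (l2norm_nonneg _) (by positivity)) zero_le_two)
  -- The factor 3/2 stands for `√2`, the constant in the weighted inequality `memLp_weight_mul`.
  have h32 : (3 / 2 * k * r * n) ^ 2 = k ^ 2 * (9 / 4 * (r ^ 2 * n ^ 2)) := by ring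
  have nap : l2norm (fun z : ℝ × ℝ => deriv (deriv η) z.1 * glue p z) ≤ 3 / 2 * k * r * n :=
    l2norm_le_of_sq_le (by positivity) (by
      refine (S.memLp_curv_mul_p S.memLp_η2).2.trans ?_
      rw [h32, hk, l2norm_sq]
      refine mul_le_mul_of_nonneg_left ?_ (integral_nonneg fun _ => sq_nonneg _)
      have := mul_le_mul np npx (l2norm_nonneg _) (by positivity)
      nlinarith [mul_nonneg (sq_nonneg r) (sq_nonneg n)])
  have naq : l2norm (fun z : ℝ × ℝ => deriv (deriv η) z.1 * glue q z) ≤ 3 / 2 * k * r * n :=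
    l2norm_le_of_sq_le (by positivity) (by
      refine (S.memLp_curv_mul_q S.memLp_η2).2.trans ?_
      rw [h32, hk, l2norm_sq]
      refine mul_le_mul_of_nonneg_left ?_ (integral_nonneg fun _ => sq_nonneg _)
      have := mul_le_mul nq nqx (l2norm_nonneg _) (by positivity)
      nlinarith [mul_nonneg (sq_nonneg r) (sq_nonneg n)])
  have hid := S.second_order_identity
  have mp := (S.memLp_curv_mul_p S.memLp_η2).1
  have mq := (S.memLp_curv_mul_q S.memLp_η2).1
  rw [integral_sub (integrable_mul_of_memLp mq S.memLp_px) (integrable_mul_of_memLp mp S.memLp_qx), hN] at hid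
  have a1 := (abs_integral_mul_le mq S.memLp_px).trans
    (mul_le_mul naq npx (l2norm_nonneg _) (by positivity))
  have a2 := (abs_integral_mul_le mp S.memLp_qx).trans
    (mul_le_mul nap nqx (l2norm_nonneg _) (by positivity))
  have a3 := (abs_integral_mul_le S.memLp_dcurvature.1 S.memLp_u1).trans
    (mul_le_mul_of_nonneg_right nκ hw0)
  have b1 := abs_le.1 a1
  have b2 := abs_le.1 a2
  have b3 := abs_le.1 a3
  have e : 3 / 2 * k * r * n * n ^ 2 + 3 / 2 * k * r * n * n ^ 2 = 3 * k * r * n ^ 3 := by ring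
  linarith

/-- Cauchy-Schwarz for `u' q` against `p`. The weight `u'` depends on `x` only, so one horizontal
derivative of `q` is enough to put `u' q` into L². -/
lemma cubic_term_bound (S : FlatSolution η u g p q gt pt qt)
    {r n : ℝ} (hr : 0 ≤ r) (hn : 0 ≤ n)
    (hD : ∫ z, (glue p z ^ 2 + glue q z ^ 2) = r ^ 4)
    (hN : ∫ z, (glue (fun i => dx (p i)) z ^ 2 + glue (fun i => dx (q i)) z ^ 2) = n ^ 4) :
    2 * |∫ z, deriv u z.1 * (glue p z * glue q z)| ≤ 3 * (l2norm (deriv u) * r ^ 3 * n) := by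
  have i2 := S.memLp_px.integrable_sq.add S.memLp_qx.integrable_sq
  have np : l2norm (glue p) ≤ r ^ 2 := l2norm_le_of_sq_le (by positivity) (by
    rw [← pow_mul, ← hD]
    exact integral_sq_le_of_le S.integrable_sq_add_sq fun z => by nlinarith [sq_nonneg (glue q z)])
  have nq : l2norm (glue q) ≤ r ^ 2 := l2norm_le_of_sq_le (by positivity) (by
    rw [← pow_mul, ← hD]
    exact integral_sq_le_of_le S.integrable_sq_add_sq fun z => by nlinarith [sq_nonneg (glue p z)])
  have nqx : l2norm (glue fun i => dx (q i)) ≤ n ^ 2 := l2norm_le_of_sq_le (by positivity) (by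
    rw [← pow_mul, ← hN]
    exact integral_sq_le_of_le i2 fun z => le_add_of_nonneg_left (sq_nonneg _))
  set w := l2norm (deriv u) with hw
  have hw0 : 0 ≤ w := l2norm_nonneg _
  have naq : l2norm (fun z : ℝ × ℝ => deriv u z.1 * glue q z) ≤ 3 / 2 * w * r * n :=
    l2norm_le_of_sq_le (by positivity) (by
      refine (S.memLp_curv_mul_q S.memLp_u1).2.trans ?_
      have h32 : (3 / 2 * w * r * n) ^ 2 = w ^ 2 * (9 / 4 * (r ^ 2 * n ^ 2)) := by ring
      rw [h32, hw, l2norm_sq]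
      refine mul_le_mul_of_nonneg_left ?_ (integral_nonneg fun _ => sq_nonneg _)
      have := mul_le_mul nq nqx (l2norm_nonneg _) (by positivity)
      nlinarith [mul_nonneg (sq_nonneg r) (sq_nonneg n)])
  have a1 := (abs_integral_mul_le (S.memLp_curv_mul_q S.memLp_u1).1 S.memLp_p).trans
    (mul_le_mul naq np (l2norm_nonneg _) (by positivity))
  have e : ∫ z : ℝ × ℝ, deriv u z.1 * (glue p z * glue q z) =
      ∫ z : ℝ × ℝ, (deriv u z.1 * glue q z) * glue p z := by congr 1; ext z; ring
  rw [e]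
  nlinarith

/-- `V_s² ds` in terms of `h_t`. -/
lemma arcDeriv_velocity_sq_le (S : FlatSolution η u g p q gt pt qt) (x : ℝ) :
    arcDeriv η (fun y => -u y / lineElement η y) x ^ 2 * lineElement η x ≤
      3 / 2 * (deriv u x ^ 2 / lineElement η x ^ 3) + 3 * (u x ^ 2 * deriv (deriv η) x ^ 2) := by
  have hl := lineElement_pos η x
  have hl1 := one_le_lineElement η x
  have h1 := (hasDerivAt_of_contDiff S.smooth_u x).fun_neg.fun_div
    (hasDerivAt_lineElement S.smooth_η x) hl.ne'
  set α := deriv u x / lineElement η x ^ 2 with hα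
  set β := u x * deriv η x * deriv (deriv η) x / lineElement η x ^ 4 with hβ
  have e1 : arcDeriv η (fun y => -u y / lineElement η y) x = β - α := by
    unfold arcDeriv
    rw [h1.deriv, hα, hβ]
    field_simp; ring
  have e2 : α ^ 2 * lineElement η x = deriv u x ^ 2 / lineElement η x ^ 3 := by
    rw [hα]; field_simp
  have e3 : β ^ 2 * lineElement η x ≤ u x ^ 2 * deriv (deriv η) x ^ 2 := by
    have : β ^ 2 * lineElement η x = (u x ^ 2 * deriv (deriv η) x ^ 2) *
        (deriv η x ^ 2 / lineElement η x ^ 7) := by rw [hβ]; field_simp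
    rw [this]
    apply mul_le_of_le_one_right (by positivity)
    rw [div_le_one (by positivity)]
    have h2 := lineElement_sq η x
    have h3 : lineElement η x ^ 2 ≤ lineElement η x ^ 7 := pow_le_pow_right₀ hl1 (by norm_num)
    linarith
  rw [e1]
  -- The split is uneven on purpose: with 3/2 in front of `α²`, adding `∫ V_s²` still leaves one
  -- half of `∫ u'²/ℓ³` from the coefficient 2 in the rate of the dissipation.
  have : (β - α) ^ 2 ≤ 3 / 2 * α ^ 2 + 3 * β ^ 2 := by nlinarith [sq_nonneg (α + 2 * β)]
  calc _ ≤ (3 / 2 * α ^ 2 + 3 * β ^ 2) * lineElement η x := by gcongr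
    _ = 3 / 2 * (α ^ 2 * lineElement η x) + 3 * (β ^ 2 * lineElement η x) := by ring
    _ ≤ _ := by rw [e2]; linarith

end FlatSolution

open FlatSolution in
/-- The differential inequality for the dissipation. -/
theorem exists_dissipation_bound : ∃ C : ℝ, 0 < C ∧
    ∀ (η u : ℝ → ℝ) (g p q gt pt qt : Bool → ℝ × ℝ → ℝ), FlatSolution η u g p q gt pt qt →
      (∀ x, |deriv η x| ≤ 1) →
      Integrable (fun x => arcDeriv η (fun y => -u y / lineElement η y) x ^ 2 * lineElement η x) ∧
      2 * (∫ z, (glue p z * glue pt z + glue q z * glue qt z)) +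
        ∫ x, arcDeriv η (fun y => -u y / lineElement η y) x ^ 2 * lineElement η x ≤
      C * ((∫ z, (glue p z ^ 2 + glue q z ^ 2)) ^ (5 / 2 : ℝ) +
        energy η * (∫ z, (glue p z ^ 2 + glue q z ^ 2)) ^ 3) := by
  -- One constant serves both hypotheses: 98304 comes from the bound for `k⁶`, and the further
  -- factor 64 from the bound for `s³`.
  obtain ⟨C, hC, H⟩ := exists_absorption (64 * 98304) (by norm_num)
  refine ⟨C, hC, fun η u g p q gt pt qt S hL => ?_⟩
  set D := ∫ z, (glue p z ^ 2 + glue q z ^ 2) with hD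
  have hD0 : 0 ≤ D := integral_nonneg fun _ => add_nonneg (sq_nonneg _) (sq_nonneg _)
  set N := ∫ z, (glue (fun i => dx (p i)) z ^ 2 + glue (fun i => dx (q i)) z ^ 2) with hN
  have hN0 : 0 ≤ N := integral_nonneg fun _ => add_nonneg (sq_nonneg _) (sq_nonneg _)
  set E := energy η with hE
  have hE0 : 0 ≤ E := energy_nonneg η
  have root : ∀ y : ℝ, 0 ≤ y → y = √√y ^ 4 := fun y hy => by
    rw [show √√y ^ 4 = (√√y ^ 2) ^ 2 by ring, Real.sq_sqrt (Real.sqrt_nonneg _), Real.sq_sqrt hy]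
  set r := √√D with hr
  set n := √√N with hn
  have hr0 : 0 ≤ r := Real.sqrt_nonneg _
  have hn0 : 0 ≤ n := Real.sqrt_nonneg _
  have hDr : D = r ^ 4 := root D hD0
  have hNn : N = n ^ 4 := root N hN0
  set k := l2norm (deriv (deriv η)) with hk
  set w := l2norm (deriv u) with hw
  have hw0 : 0 ≤ w := l2norm_nonneg _
  set e := √E with he
  have hEe : E = e ^ 2 := (Real.sq_sqrt hE0).symm
  have h1 := S.second_order_bound hL hr0 hn0 hDr hNn
  have h2 := S.cubic_term_bound hr0 hn0 hDr hNn
  have hK := S.integral_curv_sq_pow_le hL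
  rw [← hD, ← hE, hDr, hEe, ← l2norm_sq, ← hk] at hK
  have hk6 : k ^ 6 ≤ 98304 * r ^ 8 * e ^ 2 := by nlinarith
  -- the term `∫ u² h_xx²`
  set P := ∫ x, u x ^ 2 with hP
  have hP0 : 0 ≤ P := integral_nonneg fun _ => sq_nonneg _
  have hPv := S.integral_velocity_sq_pow_le hL
  rw [← hD, ← hP, hDr, ← l2norm_sq, ← hw] at hPv
  -- By Agmon's inequality `s` bounds `u²` uniformly, so `∫ u² η''² ≤ s k²`. Interpolating the norm
  -- of `u` gives `s³ ≤ 64 D w⁴`.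
  set s := 2 * (l2norm u * w) with hs
  have hs0 : 0 ≤ s := mul_nonneg zero_le_two (mul_nonneg (l2norm_nonneg _) hw0)
  have hsup : ∀ x, u x ^ 2 ≤ s :=
    sq_le_l2norm_mul (hasDerivAt_of_contDiff S.smooth_u) S.memLp_u S.memLp_u1
  have hs2 : s ^ 2 = 4 * P * w ^ 2 := by rw [hs, hP, ← l2norm_sq]; ring
  have hs3 : s ^ 3 ≤ 64 * r ^ 4 * w ^ 4 := by
    have : (s ^ 3) ^ 2 ≤ (64 * r ^ 4 * w ^ 4) ^ 2 := by
      calc (s ^ 3) ^ 2 = (s ^ 2) ^ 3 := by ring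
        _ = 64 * w ^ 6 * P ^ 3 := by rw [hs2]; ring
        _ ≤ 64 * w ^ 6 * (64 * (r ^ 4) ^ 2 * w ^ 2) := by gcongr
        _ = _ := by ring
    exact le_of_sq_le_sq this (by positivity)
  have hz3 : (s * k ^ 2) ^ 3 ≤ 64 * 98304 * r ^ 12 * e ^ 2 * w ^ 4 := by
    calc (s * k ^ 2) ^ 3 = s ^ 3 * k ^ 6 := by ring
      _ ≤ (64 * r ^ 4 * w ^ 4) * (98304 * r ^ 8 * e ^ 2) :=
        mul_le_mul hs3 hk6 (by positivity) (by positivity)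
      _ = _ := by ring
  have hk6' : k ^ 6 ≤ 64 * 98304 * r ^ 8 * e ^ 2 := by
    have : 0 ≤ r ^ 8 * e ^ 2 := by positivity
    linarith
  have habs := H r n k w e (s * k ^ 2) hr0 hn0 (l2norm_nonneg _) hw0 (Real.sqrt_nonneg _) h1 hk6' hz3
  -- integrability and the bound for `∫ V_s²`
  have iu : Integrable fun x => u x ^ 2 * deriv (deriv η) x ^ 2 := by
    refine (S.memLp_η2.integrable_sq.const_mul s).mono'
      ((S.smooth_u.continuous.pow 2).mul ((contDiff_deriv (contDiff_deriv S.smooth_η)).continuous.pow 2)).aestronglyMeasurable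
      (Eventually.of_forall fun x => ?_)
    rw [Real.norm_eq_abs, abs_of_nonneg (by positivity)]
    exact mul_le_mul_of_nonneg_right (hsup x) (sq_nonneg _)
  have iv : Integrable fun x => deriv u x ^ 2 / lineElement η x ^ 3 := by
    refine S.memLp_u1.integrable_sq.mono'
      (((contDiff_deriv S.smooth_u).continuous.pow 2).div
        ((contDiff_lineElement S.smooth_η).continuous.pow 3)
        fun x => (pow_pos (lineElement_pos η x) 3).ne').aestronglyMeasurable
      (Eventually.of_forall fun x => ?_)
    have := lineElement_pos η x
    rw [Real.norm_eq_abs, abs_of_nonneg (by positivity)]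
    exact div_le_self (sq_nonneg _) (one_le_pow₀ (one_le_lineElement η x))
  have ib : Integrable fun x => 3 / 2 * (deriv u x ^ 2 / lineElement η x ^ 3) +
      3 * (u x ^ 2 * deriv (deriv η) x ^ 2) := (iv.const_mul _).add (iu.const_mul _)
  have hVc : Continuous fun x =>
      arcDeriv η (fun y => -u y / lineElement η y) x ^ 2 * lineElement η x := by
    have c1 : ContDiff ℝ ∞ fun y => -u y / lineElement η y :=
      S.smooth_u.neg.div (contDiff_lineElement S.smooth_η) fun x => (lineElement_pos η x).ne'
    have c2 : Continuous (arcDeriv η fun y => -u y / lineElement η y) :=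
      (contDiff_deriv c1).continuous.div (contDiff_lineElement S.smooth_η).continuous
        fun x => (lineElement_pos η x).ne'
    exact (c2.pow 2).mul (contDiff_lineElement S.smooth_η).continuous
  have iV : Integrable fun x =>
      arcDeriv η (fun y => -u y / lineElement η y) x ^ 2 * lineElement η x := by
    refine ib.mono' hVc.aestronglyMeasurable (Eventually.of_forall fun x => ?_)
    rw [Real.norm_eq_abs, abs_of_nonneg (mul_nonneg (sq_nonneg _) (lineElement_pos η x).le)]
    exact S.arcDeriv_velocity_sq_le x
  refine ⟨iV, ?_⟩
  have bV := integral_mono iV ib S.arcDeriv_velocity_sq_le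
  rw [integral_add (iv.const_mul _) (iu.const_mul _), integral_const_mul, integral_const_mul] at bV
  have bu : ∫ x, u x ^ 2 * deriv (deriv η) x ^ 2 ≤ s * k ^ 2 := by
    rw [hk, l2norm_sq, ← integral_const_mul]
    exact integral_mono iu (S.memLp_η2.integrable_sq.const_mul s)
      fun x => mul_le_mul_of_nonneg_right (hsup x) (sq_nonneg _)
  -- Since `ℓ³ ≤ 3`, the remaining half of `∫ u'²/ℓ³` is at least `w²/6`, which is what the
  -- absorption uses up.
  have bU : w ^ 2 / 3 ≤ ∫ x, deriv u x ^ 2 / lineElement η x ^ 3 := by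
    rw [hw, l2norm_sq, ← integral_div]
    refine integral_mono (S.memLp_u1.integrable_sq.div_const 3) iv fun x => ?_
    have h5 := lineElement_pos η x
    have h6 := lineElement_le_two hL x
    have h7 : lineElement η x ^ 3 ≤ 3 := by
      calc lineElement η x ^ 3 = lineElement η x ^ 2 * lineElement η x := by ring
        _ ≤ 2 * (3 / 2) := mul_le_mul h6.1 h6.2 h5.le (by norm_num)
        _ = 3 := by norm_num
    exact div_le_div_of_nonneg_left (sq_nonneg _) (by positivity) h7
  have hrate := S.integral_rate.2
  rw [hrate]
  have e5 : D ^ (5 / 2 : ℝ) = r ^ 10 := by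
    rw [hDr, ← Real.rpow_natCast, ← Real.rpow_natCast, ← Real.rpow_mul hr0]; norm_num
  have e6 : D ^ 3 = r ^ 12 := by rw [hDr]; ring
  rw [e5, e6, hEe]
  have h2' := neg_abs_le (∫ z, deriv u z.1 * (glue p z * glue q z))
  linarith

end MullinsSekerka

end

/-! ### Calculus in space-time and the straightening map -/

noncomputable section

namespace MullinsSekerka

open MeasureTheory Filter Set
open scoped Topology ContDiff

/-- Space-time points are `(t, (x, z))`; this is the derivative in the direction `v`. -/
def pd (F : ℝ × (ℝ × ℝ) → ℝ) (v : ℝ × (ℝ × ℝ)) (P : ℝ × (ℝ × ℝ)) : ℝ := fderiv ℝ F P v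

/-- The slab of times in `J`. -/
def slab (J : Set ℝ) : Set (ℝ × (ℝ × ℝ)) := J ×ˢ univ

/-- The direction of time. -/
def e0 : ℝ × (ℝ × ℝ) := (1, (0, 0))
/-- The direction of `x`. -/
def e1 : ℝ × (ℝ × ℝ) := (0, (1, 0))
/-- The direction of `z`. -/
def e2 : ℝ × (ℝ × ℝ) := (0, (0, 1))

section Slab

variable {J : Set ℝ} {F : ℝ × (ℝ × ℝ) → ℝ}

lemma isOpen_slab (hJ : IsOpen J) : IsOpen (slab J) := hJ.prod isOpen_univ

lemma mem_slab {t : ℝ} (ht : t ∈ J) (z : ℝ × ℝ) : (t, z) ∈ slab J := ⟨ht, mem_univ _⟩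

lemma contDiffOn_pd (hJ : IsOpen J) (hF : ContDiffOn ℝ ∞ F (slab J)) (v : ℝ × (ℝ × ℝ)) :
    ContDiffOn ℝ ∞ (pd F v) (slab J) :=
  (hF.fderiv_of_isOpen (isOpen_slab hJ) (by simp)).clm_apply contDiffOn_const

lemma contDiffAt_slab (hJ : IsOpen J) (hF : ContDiffOn ℝ ∞ F (slab J)) {P : ℝ × (ℝ × ℝ)}
    (hP : P ∈ slab J) : ContDiffAt ℝ ∞ F P := hF.contDiffAt ((isOpen_slab hJ).mem_nhds hP)

lemma differentiableAt_slab (hJ : IsOpen J) (hF : ContDiffOn ℝ ∞ F (slab J)) {P : ℝ × (ℝ × ℝ)}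
    (hP : P ∈ slab J) : DifferentiableAt ℝ F P :=
  (contDiffAt_slab hJ hF hP).differentiableAt (by simp)

lemma pd_comm (hJ : IsOpen J) (hF : ContDiffOn ℝ ∞ F (slab J)) {P : ℝ × (ℝ × ℝ)}
    (hP : P ∈ slab J) (v w : ℝ × (ℝ × ℝ)) : pd (pd F v) w P = pd (pd F w) v P := by
  have hs : IsSymmSndFDerivAt ℝ F P :=
    (contDiffAt_slab hJ hF hP).isSymmSndFDerivAt (by simpa using two_le_infty)
  have hd : DifferentiableAt ℝ (fderiv ℝ F) P :=
    ((hF.fderiv_of_isOpen (m := ∞) (isOpen_slab hJ) (by simp)).contDiffAt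
      ((isOpen_slab hJ).mem_nhds hP)).differentiableAt (by simp)
  have e : ∀ a b, fderiv ℝ (fun y => fderiv ℝ F y a) P b = fderiv ℝ (fderiv ℝ F) P b a := by
    intro a b
    rw [fderiv_clm_apply hd (differentiableAt_const a)]
    simp
  change fderiv ℝ (fun y => fderiv ℝ F y v) P w = fderiv ℝ (fun y => fderiv ℝ F y w) P v
  rw [e, e]
  exact hs.eq _ _

lemma contDiff_slice (hJ : IsOpen J) (hF : ContDiffOn ℝ ∞ F (slab J)) {t : ℝ} (ht : t ∈ J) :
    ContDiff ℝ ∞ fun z => F (t, z) := by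
  rw [contDiff_iff_contDiffAt]
  intro z
  exact (contDiffAt_slab hJ hF (mem_slab ht z)).comp z (contDiffAt_const.prodMk contDiffAt_id)

lemma hasDerivAt_time {t : ℝ} {z : ℝ × ℝ} (hF : DifferentiableAt ℝ F (t, z)) :
    HasDerivAt (fun s => F (s, z)) (pd F e0 (t, z)) t := by
  have h2 : HasDerivAt (fun s : ℝ => (s, z)) ((1 : ℝ), (0 : ℝ × ℝ)) t :=
    (hasDerivAt_id t).prodMk (hasDerivAt_const t z)
  exact hF.hasFDerivAt.comp_hasDerivAt t h2

lemma hasFDerivAt_slice {t : ℝ} {z : ℝ × ℝ} (hF : DifferentiableAt ℝ F (t, z)) :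
    HasFDerivAt (fun y => F (t, y))
      ((fderiv ℝ F (t, z)).comp (ContinuousLinearMap.inr ℝ ℝ (ℝ × ℝ))) z :=
  hF.hasFDerivAt.comp z (hasFDerivAt_prodMk_right t z)

lemma fderiv_slice {t : ℝ} {z : ℝ × ℝ} (hF : DifferentiableAt ℝ F (t, z)) (v : ℝ × ℝ) :
    fderiv ℝ (fun y => F (t, y)) z v = pd F (0, v) (t, z) := by
  rw [(hasFDerivAt_slice hF).fderiv]; rfl

lemma dx_slice {t : ℝ} {z : ℝ × ℝ} (hF : DifferentiableAt ℝ F (t, z)) :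
    dx (fun y => F (t, y)) z = pd F e1 (t, z) := fderiv_slice hF _

lemma dz_slice {t : ℝ} {z : ℝ × ℝ} (hF : DifferentiableAt ℝ F (t, z)) :
    dz (fun y => F (t, y)) z = pd F e2 (t, z) := fderiv_slice hF _

lemma hasDerivAt_space {t x y : ℝ} (hF : DifferentiableAt ℝ F (t, (x, y))) :
    HasDerivAt (fun s => F (t, (s, y))) (pd F e1 (t, (x, y))) x := by
  have := hasDerivAt_dx (v := fun y => F (t, y)) (q := (x, y)) (hasFDerivAt_slice hF).differentiableAt
  rwa [dx_slice hF] at this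

/-- Derivatives of a family of functions on the plane that agrees with `F` on an open set. -/
lemma fderiv_family {k : ℝ → ℝ × ℝ → ℝ} {U : Set (ℝ × (ℝ × ℝ))} (hU : IsOpen U)
    (hk : ∀ P ∈ U, k P.1 P.2 = F P) {P : ℝ × (ℝ × ℝ)} (hP : P ∈ U) (hF : DifferentiableAt ℝ F P)
    (v : ℝ × ℝ) : fderiv ℝ (k P.1) P.2 v = pd F (0, v) P := by
  have h1 : k P.1 =ᶠ[𝓝 P.2] fun y => F (P.1, y) := by
    have hc : Continuous fun y : ℝ × ℝ => (P.1, y) := by fun_prop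
    filter_upwards [(hU.preimage hc).mem_nhds hP] with y hy using hk (P.1, y) hy
  rw [h1.fderiv_eq]
  exact fderiv_slice hF v

lemma hasDerivAt_family {k : ℝ → ℝ × ℝ → ℝ} {U : Set (ℝ × (ℝ × ℝ))} (hU : IsOpen U)
    (hk : ∀ P ∈ U, k P.1 P.2 = F P) {P : ℝ × (ℝ × ℝ)} (hP : P ∈ U) (hF : DifferentiableAt ℝ F P) :
    HasDerivAt (fun s => k s P.2) (pd F e0 P) P.1 := by
  have h1 : (fun s => k s P.2) =ᶠ[𝓝 P.1] fun s => F (s, P.2) := by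
    have hc : Continuous fun s : ℝ => (s, P.2) := by fun_prop
    filter_upwards [(hU.preimage hc).mem_nhds hP] with y hy using hk (y, P.2) hy
  exact (hasDerivAt_time hF).congr_of_eventuallyEq h1

end Slab

/-- The height as a function on space-time. -/
def lift (h : ℝ → ℝ → ℝ) (P : ℝ × (ℝ × ℝ)) : ℝ := h P.1 P.2.1

/-- The map from coordinates in which the interface is at rest. -/
def straighten (h : ℝ → ℝ → ℝ) (P : ℝ × (ℝ × ℝ)) : ℝ × (ℝ × ℝ) := (P.1, shift (h P.1) P.2)

section Height

variable {J : Set ℝ} {h : ℝ → ℝ → ℝ} {F : ℝ × (ℝ × ℝ) → ℝ}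

lemma RegularHeight.smooth_lift (hh : RegularHeight J h) : ContDiffOn ℝ ∞ (lift h) (slab J) := by
  have : ContDiff ℝ ∞ fun P : ℝ × (ℝ × ℝ) => ((P.1, P.2.1) : ℝ × ℝ) := by fun_prop
  exact hh.smooth.comp this.contDiffOn fun P hP => ⟨hP.1, mem_univ _⟩

lemma smooth_straighten (hl : ContDiffOn ℝ ∞ (lift h) (slab J)) :
    ContDiffOn ℝ ∞ (straighten h) (slab J) := by
  have h1 : ContDiffOn ℝ ∞ (fun P : ℝ × (ℝ × ℝ) => P.1) (slab J) := contDiff_fst.contDiffOn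
  have h2 : ContDiffOn ℝ ∞ (fun P : ℝ × (ℝ × ℝ) => P.2.1) (slab J) := by fun_prop
  have h3 : ContDiffOn ℝ ∞ (fun P : ℝ × (ℝ × ℝ) => P.2.2) (slab J) := by fun_prop
  exact h1.prodMk (h2.prodMk (hl.add h3))

lemma smooth_comp_straighten (hl : ContDiffOn ℝ ∞ (lift h) (slab J))
    (hF : ContDiffOn ℝ ∞ F (slab J)) : ContDiffOn ℝ ∞ (F ∘ straighten h) (slab J) :=
  hF.comp (smooth_straighten hl) fun _ hP => ⟨hP.1, mem_univ _⟩

lemma pd_comp_straighten (hJ : IsOpen J) (hl : ContDiffOn ℝ ∞ (lift h) (slab J))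
    (hF : ContDiffOn ℝ ∞ F (slab J)) {P : ℝ × (ℝ × ℝ)} (hP : P ∈ slab J) (v : ℝ × (ℝ × ℝ)) :
    pd (F ∘ straighten h) v P =
      pd F v (straighten h P) + pd (lift h) v P * pd F e2 (straighten h P) := by
  have d1 := (differentiableAt_slab hJ hl hP).hasFDerivAt
  have dS : HasFDerivAt (straighten h) ((ContinuousLinearMap.fst ℝ ℝ (ℝ × ℝ)).prod
      (((ContinuousLinearMap.fst ℝ ℝ ℝ).comp (ContinuousLinearMap.snd ℝ ℝ (ℝ × ℝ))).prod
        (fderiv ℝ (lift h) P +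
          (ContinuousLinearMap.snd ℝ ℝ ℝ).comp (ContinuousLinearMap.snd ℝ ℝ (ℝ × ℝ))))) P := by
    have hs : HasFDerivAt (fun P : ℝ × (ℝ × ℝ) => P.2) (ContinuousLinearMap.snd ℝ ℝ (ℝ × ℝ)) P :=
      hasFDerivAt_snd
    exact hasFDerivAt_fst.prodMk (hs.fst.prodMk (d1.add hs.snd))
  have dF := (differentiableAt_slab hJ hF (P := straighten h P) ⟨hP.1, mem_univ _⟩).hasFDerivAt
  have := dF.comp P dS
  unfold pd
  rw [this.fderiv]
  simp only [ContinuousLinearMap.comp_apply, ContinuousLinearMap.prod_apply,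
    add_apply, ContinuousLinearMap.coe_fst', ContinuousLinearMap.coe_snd']
  have : ((v.1, v.2.1, (fderiv ℝ (lift h) P) v + v.2.2) : ℝ × (ℝ × ℝ)) =
      v + (fderiv ℝ (lift h) P v) • e2 := by
    ext <;> simp [e2, add_comm]
  rw [this, map_add, map_smul, smul_eq_mul]

lemma lift_indep (hJ : IsOpen J) (hl : ContDiffOn ℝ ∞ (lift h) (slab J)) {P : ℝ × (ℝ × ℝ)}
    (hP : P ∈ slab J) : pd (lift h) e2 P = 0 := by
  have h1 := hasDerivAt_dz (v := fun y => lift h (P.1, y)) (q := P.2)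
    (hasFDerivAt_slice (differentiableAt_slab hJ hl (P := (P.1, P.2)) hP)).differentiableAt
  rw [dz_slice (differentiableAt_slab hJ hl (P := (P.1, P.2)) hP)] at h1
  exact h1.unique (hasDerivAt_const P.2.2 (h P.1 P.2.1))

lemma hasDerivAt_height (hJ : IsOpen J) (hl : ContDiffOn ℝ ∞ (lift h) (slab J)) {t : ℝ}
    (ht : t ∈ J) (x y : ℝ) : HasDerivAt (h t) (pd (lift h) e1 (t, (x, y))) x :=
  hasDerivAt_space (differentiableAt_slab hJ hl (mem_slab ht (x, y)))

lemma hasDerivAt_height_time (hJ : IsOpen J) (hl : ContDiffOn ℝ ∞ (lift h) (slab J)) {t : ℝ}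
    (ht : t ∈ J) (x y : ℝ) : HasDerivAt (fun s => h s x) (pd (lift h) e0 (t, (x, y))) t :=
  hasDerivAt_time (differentiableAt_slab hJ hl (mem_slab ht (x, y)))

/-- `h_t`. -/
def heightRate (h : ℝ → ℝ → ℝ) (t x : ℝ) : ℝ := deriv (fun s => h s x) t

lemma heightRate_eq (hJ : IsOpen J) (hl : ContDiffOn ℝ ∞ (lift h) (slab J)) {t : ℝ}
    (ht : t ∈ J) (x y : ℝ) : heightRate h t x = pd (lift h) e0 (t, (x, y)) :=
  (hasDerivAt_height_time hJ hl ht x y).deriv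

lemma deriv_heightRate_eq (hJ : IsOpen J) (hl : ContDiffOn ℝ ∞ (lift h) (slab J)) {t : ℝ}
    (ht : t ∈ J) (x y : ℝ) : deriv (heightRate h t) x = pd (pd (lift h) e0) e1 (t, (x, y)) := by
  have : heightRate h t = fun x => pd (lift h) e0 (t, (x, y)) :=
    funext fun x => heightRate_eq hJ hl ht x y
  rw [this]
  exact (hasDerivAt_space (differentiableAt_slab hJ (contDiffOn_pd hJ hl e0) (mem_slab ht _))).deriv

lemma hasDerivAt_slope_time (hJ : IsOpen J) (hl : ContDiffOn ℝ ∞ (lift h) (slab J)) {t : ℝ}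
    (ht : t ∈ J) (x : ℝ) : HasDerivAt (fun s => deriv (h s) x) (deriv (heightRate h t) x) t := by
  have h1 := hasDerivAt_time (differentiableAt_slab hJ (contDiffOn_pd hJ hl e1) (mem_slab ht (x, 0)))
  rw [pd_comm hJ hl (mem_slab ht (x, 0)), ← deriv_heightRate_eq hJ hl ht x 0] at h1
  refine h1.congr_of_eventuallyEq ?_
  filter_upwards [hJ.mem_nhds ht] with s hs using (hasDerivAt_height hJ hl hs x 0).deriv

lemma contDiff_height (hJ : IsOpen J) (hl : ContDiffOn ℝ ∞ (lift h) (slab J)) {t : ℝ}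
    (ht : t ∈ J) : ContDiff ℝ ∞ (h t) := by
  have h1 := contDiff_slice hJ hl ht
  have h2 : ContDiff ℝ ∞ fun x : ℝ => ((x, 0) : ℝ × ℝ) := by fun_prop
  exact h1.comp h2

lemma contDiff_heightRate (hJ : IsOpen J) (hl : ContDiffOn ℝ ∞ (lift h) (slab J)) {t : ℝ}
    (ht : t ∈ J) : ContDiff ℝ ∞ (heightRate h t) := by
  have h1 := contDiff_slice hJ (contDiffOn_pd hJ hl e0) ht
  have h2 : ContDiff ℝ ∞ fun x : ℝ => ((x, 0) : ℝ × ℝ) := by fun_prop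
  have : heightRate h t = fun x => pd (lift h) e0 (t, (x, 0)) :=
    funext fun x => heightRate_eq hJ hl ht x 0
  rw [this]
  exact h1.comp h2

/-- The time derivative of the curvature. -/
lemma hasDerivAt_curvature_time (hJ : IsOpen J) (hl : ContDiffOn ℝ ∞ (lift h) (slab J)) {t : ℝ}
    (ht : t ∈ J) (x : ℝ) : HasDerivAt (fun s => curvature (h s) x)
      (deriv (fun y => deriv (heightRate h t) y / lineElement (h t) y ^ 3) x) t := by
  set a := pd (lift h) e1 with ha
  have hac : ContDiffOn ℝ ∞ a (slab J) := contDiffOn_pd hJ hl e1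
  -- The slope `sin θ` as a smooth function on space-time. Its `x`-derivative is the curvature and
  -- its time derivative is `u'/ℓ³`, so the claim is an exchange of derivatives.
  set b : ℝ × (ℝ × ℝ) → ℝ := fun P => a P / √(1 + a P ^ 2) with hb
  have hbc : ContDiffOn ℝ ∞ b (slab J) := by
    refine hac.div ((contDiffOn_const.add (hac.pow 2)).sqrt fun P _ => ?_) fun P _ => ?_ <;> positivity
  have hslope : ∀ s ∈ J, ∀ y, slope (h s) y = b (s, (y, 0)) := fun s hs y => by
    rw [slope, lineElement, (hasDerivAt_height hJ hl hs y 0).deriv]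
  have hcurv : ∀ s ∈ J, ∀ y, curvature (h s) y = pd b e1 (s, (y, 0)) := fun s hs y => by
    have h1 := hasDerivAt_space (differentiableAt_slab hJ hbc (mem_slab hs (y, 0)))
    have h2 : (fun x => b (s, (x, 0))) = slope (h s) := funext fun x => (hslope s hs x).symm
    rw [h2] at h1
    exact h1.deriv
  have h1 := hasDerivAt_time (differentiableAt_slab hJ (contDiffOn_pd hJ hbc e1) (mem_slab ht (x, 0)))
  rw [pd_comm hJ hbc (mem_slab ht (x, 0))] at h1
  have h2 : ∀ y, pd b e0 (t, (y, 0)) = deriv (heightRate h t) y / lineElement (h t) y ^ 3 := by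
    intro y
    have h3 := hasDerivAt_time (differentiableAt_slab hJ hbc (mem_slab ht (y, 0)))
    have h4 : (fun s => b (s, (y, 0))) =ᶠ[𝓝 t] fun s => deriv (h s) y / √(1 + deriv (h s) y ^ 2) := by
      filter_upwards [hJ.mem_nhds ht] with s hs using (hslope s hs y).symm
    have h5 := hasDerivAt_slope_time hJ hl ht y
    have h6 := ((h5.fun_pow 2).const_add 1).sqrt (by positivity)
    have h7 := (h5.fun_div h6 (by positivity)).congr_of_eventuallyEq h4
    rw [h3.unique h7]
    have hp := lineElement_pos (h t) y
    have hq := lineElement_sq (h t) y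
    rw [show √(1 + deriv (h t) y ^ 2) = lineElement (h t) y from rfl]
    field_simp
    rw [hq]; push_cast; ring
  have h8 := hasDerivAt_space (differentiableAt_slab hJ (contDiffOn_pd hJ hbc e0) (mem_slab ht (x, 0)))
  have h9 : (fun s => pd b e0 (t, (s, 0))) =
      fun y => deriv (heightRate h t) y / lineElement (h t) y ^ 3 := funext h2
  rw [h9] at h8
  rw [h8.deriv]
  refine h1.congr_of_eventuallyEq ?_
  filter_upwards [hJ.mem_nhds ht] with s hs using hcurv s hs x

end Height

end MullinsSekerka

end

/-! ### Smooth extensions from the two phases and domination in L² -/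

noncomputable section

namespace MullinsSekerka

open MeasureTheory Filter Set
open scoped Topology ContDiff

/-- The upper (`true`) or lower (`false`) phase in space-time. -/
def phase (J : Set ℝ) (h : ℝ → ℝ → ℝ) (i : Bool) : Set (ℝ × (ℝ × ℝ)) :=
  {P | P ∈ slab J ∧ 0 < sgn i * (P.2.2 - h P.1 P.2.1)}

/-- `F i` are smooth functions that agree with `f` in the upper and in the lower phase. -/
structure IsExtension (J : Set ℝ) (h : ℝ → ℝ → ℝ) (f : ℝ → ℝ × ℝ → ℝ)
    (F : Bool → ℝ × (ℝ × ℝ) → ℝ) : Prop where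
  smooth : ∀ i, ContDiffOn ℝ ∞ (F i) (slab J)
  eq : ∀ i, ∀ t ∈ J, ∀ p : ℝ × ℝ, 0 ≤ sgn i * (p.2 - h t p.1) → f t p = F i (t, p)

lemma RegularField.exists_isExtension {J : Set ℝ} {h : ℝ → ℝ → ℝ} {f : ℝ → ℝ × ℝ → ℝ}
    (hf : RegularField J h f) : ∃ F, IsExtension J h f F := by
  obtain ⟨F1, h1, h1'⟩ := hf.smooth_upper
  obtain ⟨F2, h2, h2'⟩ := hf.smooth_lower
  refine ⟨fun i => if i then F1 else F2, fun i => ?_, fun i t ht p hp => ?_⟩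
  · cases i
    · exact h2
    · exact h1
  · cases i
    · exact h2' t ht p (by simp [sgn] at hp; linarith)
    · exact h1' t ht p (by simp [sgn] at hp; linarith)

section Phase

variable {J : Set ℝ} {h : ℝ → ℝ → ℝ} {f : ℝ → ℝ × ℝ → ℝ} {F : Bool → ℝ × (ℝ × ℝ) → ℝ}

lemma isOpen_phase (hJ : IsOpen J) (hl : ContDiffOn ℝ ∞ (lift h) (slab J)) (i : Bool) :
    IsOpen (phase J h i) := by
  have hc : ContinuousOn (fun P : ℝ × (ℝ × ℝ) => sgn i * (P.2.2 - lift h P)) (slab J) := by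
    have := hl.continuousOn
    fun_prop
  exact hc.isOpen_inter_preimage (isOpen_slab hJ) isOpen_Ioi

lemma straighten_mem_phase {t : ℝ} (ht : t ∈ J) {z : ℝ × ℝ} {i : Bool} (hz : 0 < sgn i * z.2) :
    straighten h (t, z) ∈ phase J h i :=
  ⟨⟨ht, mem_univ _⟩, by simpa [straighten, shift] using hz⟩

/-- A phase is open in space-time, so `f` and its extension have the same derivatives there. On the
interface `f` may fail to be differentiable, and only the extension is used. -/
lemma IsExtension.fderiv_eq (hF : IsExtension J h f F) (hJ : IsOpen J)
    (hl : ContDiffOn ℝ ∞ (lift h) (slab J)) {i : Bool} {P : ℝ × (ℝ × ℝ)} (hP : P ∈ phase J h i)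
    (v : ℝ × ℝ) : fderiv ℝ (f P.1) P.2 v = pd (F i) (0, v) P :=
  fderiv_family (isOpen_phase hJ hl i) (fun Q hQ => hF.eq i Q.1 hQ.1.1 Q.2 hQ.2.le) hP
    (differentiableAt_slab hJ (hF.smooth i) hP.1) v

lemma IsExtension.fderiv_fderiv_eq (hF : IsExtension J h f F) (hJ : IsOpen J)
    (hl : ContDiffOn ℝ ∞ (lift h) (slab J)) {i : Bool} {P : ℝ × (ℝ × ℝ)} (hP : P ∈ phase J h i)
    (v w : ℝ × ℝ) :
    fderiv ℝ (fun p => fderiv ℝ (f P.1) p v) P.2 w = pd (pd (F i) (0, v)) (0, w) P :=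
  fderiv_family (k := fun s p => fderiv ℝ (f s) p v) (isOpen_phase hJ hl i)
    (fun _ hQ => hF.fderiv_eq hJ hl hQ v) hP
    (differentiableAt_slab hJ (contDiffOn_pd hJ (hF.smooth i) _) hP.1) w

lemma IsExtension.deriv_fderiv_eq (hF : IsExtension J h f F) (hJ : IsOpen J)
    (hl : ContDiffOn ℝ ∞ (lift h) (slab J)) {i : Bool} {P : ℝ × (ℝ × ℝ)} (hP : P ∈ phase J h i)
    (v : ℝ × ℝ) :
    deriv (fun s => fderiv ℝ (f s) P.2 v) P.1 = pd (pd (F i) (0, v)) e0 P :=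
  (hasDerivAt_family (k := fun s p => fderiv ℝ (f s) p v) (isOpen_phase hJ hl i)
    (fun _ hQ => hF.fderiv_eq hJ hl hQ v) hP
    (differentiableAt_slab hJ (contDiffOn_pd hJ (hF.smooth i) _) hP.1)).deriv

lemma IsExtension.laplace (hF : IsExtension J h f F) (hJ : IsOpen J)
    (hl : ContDiffOn ℝ ∞ (lift h) (slab J))
    (hh : ∀ t ∈ J, ∀ p ∈ upperPhase (h t) ∪ lowerPhase (h t), lap (f t) p = 0)
    {i : Bool} {P : ℝ × (ℝ × ℝ)} (hP : P ∈ phase J h i) :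
    pd (pd (F i) e1) e1 P + pd (pd (F i) e2) e2 P = 0 := by
  have h1 := hF.fderiv_fderiv_eq hJ hl hP (1, 0) (1, 0)
  have h2 := hF.fderiv_fderiv_eq hJ hl hP (0, 1) (0, 1)
  have h3 := hh P.1 hP.1.1 P.2 (by
    have := hP.2
    cases i
    · right; simp [sgn] at this; exact this
    · left; simp [sgn] at this; exact this)
  exact (congrArg₂ (· + ·) h1 h2).symm.trans h3

end Phase

section Domination

variable {J : Set ℝ} {h : ℝ → ℝ → ℝ} {f : ℝ → ℝ × ℝ → ℝ} {F : Bool → ℝ × (ℝ × ℝ) → ℝ}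

/-- Dominating functions for the height and its derivatives near a time. -/
lemma RegularHeight.dominated (hh : RegularHeight J h) {t : ℝ} (ht : t ∈ J) :
    ∃ G : ℝ → ℝ, MemLp G 2 ∧ ∀ᶠ s in 𝓝 t, ∀ x,
      |h s x| ≤ G x ∧ |deriv (h s) x| ≤ G x ∧ |deriv (deriv (h s)) x| ≤ G x ∧
      |heightRate h s x| ≤ G x ∧ |deriv (heightRate h s) x| ≤ G x ∧
      |deriv (deriv (heightRate h s)) x| ≤ G x := by
  obtain ⟨g00, m00, d00⟩ := hh.sobolev 0 (by norm_num) 0 (by norm_num) t ht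
  obtain ⟨g01, m01, d01⟩ := hh.sobolev 0 (by norm_num) 1 (by norm_num) t ht
  obtain ⟨g02, m02, d02⟩ := hh.sobolev 0 (by norm_num) 2 (by norm_num) t ht
  obtain ⟨g10, m10, d10⟩ := hh.sobolev 1 (by norm_num) 0 (by norm_num) t ht
  obtain ⟨g11, m11, d11⟩ := hh.sobolev 1 (by norm_num) 1 (by norm_num) t ht
  obtain ⟨g12, m12, d12⟩ := hh.sobolev 1 (by norm_num) 2 (by norm_num) t ht
  refine ⟨fun x => |g00 x| + |g01 x| + |g02 x| + |g10 x| + |g11 x| + |g12 x|,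
    ((((m00.abs.add m01.abs).add m02.abs).add m10.abs).add m11.abs).add m12.abs, ?_⟩
  filter_upwards [d00, d01, d02, d10, d11, d12] with s a00 a01 a02 a10 a11 a12 x
  have b00 := a00 x (mem_univ _)
  have b01 := a01 x (mem_univ _)
  have b02 := a02 x (mem_univ _)
  have b10 := a10 x (mem_univ _)
  have b11 := a11 x (mem_univ _)
  have b12 := a12 x (mem_univ _)
  simp only [iteratedDeriv_zero, iteratedDeriv_succ] at b00 b01 b02 b10 b11 b12
  have c : ∀ y : ℝ, y ≤ |y| := le_abs_self
  have n : ∀ y : ℝ, 0 ≤ |y| := abs_nonneg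
  have := c (g00 x); have := c (g01 x); have := c (g02 x)
  have := c (g10 x); have := c (g11 x); have := c (g12 x)
  have := n (g00 x); have := n (g01 x); have := n (g02 x)
  have := n (g10 x); have := n (g11 x); have := n (g12 x)
  refine ⟨?_, ?_, ?_, ?_, ?_, ?_⟩
  · linarith
  · linarith
  · linarith
  · exact b10.trans (by linarith)
  · exact b11.trans (by linarith)
  · exact b12.trans (by linarith)

/-- Agmon's inequality with both norms replaced by the norm of the dominating function, so that the
bound is uniform over the times it dominates. -/
lemma abs_le_of_dominated {v G : ℝ → ℝ} (hv : ContDiff ℝ ∞ v) (hG : MemLp G 2)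
    (h0 : ∀ x, |v x| ≤ G x) (h1 : ∀ x, |deriv v x| ≤ G x) (x : ℝ) :
    |v x| ≤ √2 * l2norm G := by
  have m0 : MemLp v 2 := hG.mono' hv.continuous.aestronglyMeasurable (Eventually.of_forall h0)
  have m1 : MemLp (deriv v) 2 :=
    hG.mono' (contDiff_deriv hv).continuous.aestronglyMeasurable (Eventually.of_forall h1)
  have n0 : l2norm v ≤ 1 * l2norm G := l2norm_le_of_le zero_le_one hG
    (Eventually.of_forall fun x => by rw [one_mul]; exact (h0 x).trans (le_abs_self _))
  have n1 : l2norm (deriv v) ≤ 1 * l2norm G := l2norm_le_of_le zero_le_one hG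
    (Eventually.of_forall fun x => by rw [one_mul]; exact (h1 x).trans (le_abs_self _))
  rw [one_mul] at n0 n1
  apply abs_le_of_sq_le_sq _ (mul_nonneg (Real.sqrt_nonneg _) (l2norm_nonneg _))
  rw [mul_pow, Real.sq_sqrt zero_le_two, sq (l2norm G)]
  refine (sq_le_l2norm_mul (hasDerivAt_of_contDiff hv) m0 m1 x).trans ?_
  exact mul_le_mul_of_nonneg_left (mul_le_mul n0 n1 (l2norm_nonneg _) (l2norm_nonneg _)) zero_le_two

/-- Uniform bounds for the height and its derivatives near a time. -/
lemma RegularHeight.bounded (hh : RegularHeight J h) (hJ : IsOpen J) {t : ℝ} (ht : t ∈ J) :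
    ∃ A : ℝ, 0 ≤ A ∧ ∀ᶠ s in 𝓝 t, ∀ x,
      |h s x| ≤ A ∧ |deriv (h s) x| ≤ A ∧ |heightRate h s x| ≤ A ∧ |deriv (heightRate h s) x| ≤ A := by
  obtain ⟨G, hG, hd⟩ := hh.dominated ht
  refine ⟨√2 * l2norm G, mul_nonneg (Real.sqrt_nonneg _) (l2norm_nonneg _), ?_⟩
  filter_upwards [hd, hJ.mem_nhds ht] with s hs hsJ x
  have c1 := contDiff_height hJ hh.smooth_lift hsJ
  have c2 := contDiff_heightRate hJ hh.smooth_lift hsJ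
  exact ⟨abs_le_of_dominated c1 hG (fun x => (hs x).1) (fun x => (hs x).2.1) x,
    abs_le_of_dominated (contDiff_deriv c1) hG (fun x => (hs x).2.1) (fun x => (hs x).2.2.1) x,
    abs_le_of_dominated c2 hG (fun x => (hs x).2.2.2.1) (fun x => (hs x).2.2.2.2.1) x,
    abs_le_of_dominated (contDiff_deriv c2) hG (fun x => (hs x).2.2.2.2.1)
      (fun x => (hs x).2.2.2.2.2) x⟩

/-- `f` in straightened coordinates. -/
def flatG (h : ℝ → ℝ → ℝ) (F : Bool → ℝ × (ℝ × ℝ) → ℝ) (i : Bool) : ℝ × (ℝ × ℝ) → ℝ :=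
  F i ∘ straighten h

/-- `∂ₓ f` in straightened coordinates. -/
def flatP (h : ℝ → ℝ → ℝ) (F : Bool → ℝ × (ℝ × ℝ) → ℝ) (i : Bool) : ℝ × (ℝ × ℝ) → ℝ :=
  pd (F i) e1 ∘ straighten h

/-- `∂_z f` in straightened coordinates. -/
def flatQ (h : ℝ → ℝ → ℝ) (F : Bool → ℝ × (ℝ × ℝ) → ℝ) (i : Bool) : ℝ × (ℝ × ℝ) → ℝ :=
  pd (F i) e2 ∘ straighten h

lemma IsExtension.smooth_flatG (hF : IsExtension J h f F)
    (hl : ContDiffOn ℝ ∞ (lift h) (slab J)) (i : Bool) :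
    ContDiffOn ℝ ∞ (flatG h F i) (slab J) := smooth_comp_straighten hl (hF.smooth i)

lemma IsExtension.smooth_flatP (hF : IsExtension J h f F) (hJ : IsOpen J)
    (hl : ContDiffOn ℝ ∞ (lift h) (slab J)) (i : Bool) :
    ContDiffOn ℝ ∞ (flatP h F i) (slab J) :=
  smooth_comp_straighten hl (contDiffOn_pd hJ (hF.smooth i) _)

lemma IsExtension.smooth_flatQ (hF : IsExtension J h f F) (hJ : IsOpen J)
    (hl : ContDiffOn ℝ ∞ (lift h) (slab J)) (i : Bool) :
    ContDiffOn ℝ ∞ (flatQ h F i) (slab J) :=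
  smooth_comp_straighten hl (contDiffOn_pd hJ (hF.smooth i) _)

lemma IsExtension.flatP_eq (hF : IsExtension J h f F) (hJ : IsOpen J)
    (hl : ContDiffOn ℝ ∞ (lift h) (slab J)) {i : Bool} {t : ℝ} (ht : t ∈ J) {z : ℝ × ℝ}
    (hz : 0 < sgn i * z.2) : flatP h F i (t, z) = dx (f t) (shift (h t) z) :=
  (hF.fderiv_eq hJ hl (straighten_mem_phase ht hz) (1, 0)).symm

lemma IsExtension.flatQ_eq (hF : IsExtension J h f F) (hJ : IsOpen J)
    (hl : ContDiffOn ℝ ∞ (lift h) (slab J)) {i : Bool} {t : ℝ} (ht : t ∈ J) {z : ℝ × ℝ}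
    (hz : 0 < sgn i * z.2) : flatQ h F i (t, z) = dz (f t) (shift (h t) z) :=
  (hF.fderiv_eq hJ hl (straighten_mem_phase ht hz) (0, 1)).symm

/-- One function in `L²` dominates the derivatives of `f` near a time. -/
lemma IsExtension.dominated (hF : IsExtension J h f F) (hJ : IsOpen J) (hh : RegularHeight J h)
    (hf : RegularField J h f) {t : ℝ} (ht : t ∈ J) :
    ∃ G : ℝ × ℝ → ℝ, MemLp G 2 ∧ ∀ᶠ s in 𝓝 t, ∀ i, ∀ z : ℝ × ℝ, 0 < sgn i * z.2 →
      |flatP h F i (s, z)| ≤ G z ∧ |flatQ h F i (s, z)| ≤ G z ∧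
      |pd (flatP h F i) e1 (s, z)| ≤ G z ∧ |pd (flatQ h F i) e1 (s, z)| ≤ G z ∧
      |pd (flatP h F i) e0 (s, z)| ≤ G z ∧ |pd (flatQ h F i) e0 (s, z)| ≤ G z := by
  have hl := hh.smooth_lift
  obtain ⟨A, hA0, hA⟩ := hh.bounded hJ ht
  obtain ⟨g1, m1, d1⟩ := hf.grad (1, 0) t ht
  obtain ⟨g2, m2, d2⟩ := hf.grad (0, 1) t ht
  obtain ⟨g11, m11, d11⟩ := hf.hess (1, 0) (1, 0) t ht
  obtain ⟨g12, m12, d12⟩ := hf.hess (1, 0) (0, 1) t ht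
  obtain ⟨g21, m21, d21⟩ := hf.hess (0, 1) (1, 0) t ht
  obtain ⟨g22, m22, d22⟩ := hf.hess (0, 1) (0, 1) t ht
  obtain ⟨g10, m10, d10⟩ := hf.grad_t (1, 0) t ht
  obtain ⟨g20, m20, d20⟩ := hf.grad_t (0, 1) t ht
  refine ⟨fun z => |g1 z| + |g2 z| + |g11 z| + |g21 z| + |g10 z| + |g20 z| + A * |g12 z| + A * |g22 z|,
    ((((((m1.abs.add m2.abs).add m11.abs).add m21.abs).add m10.abs).add m20.abs).add
      (m12.abs.const_mul A)).add (m22.abs.const_mul A), ?_⟩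
  filter_upwards [hA, d1, d2, d11, d12, d21, d22, d10, d20, hJ.mem_nhds ht] with s a b1 b2 b11 b12 b21
    b22 b10 b20 hs i z hz
  have hz0 : z ∈ {q : ℝ × ℝ | q.2 ≠ 0} := fun h0 => by
    have h0' : z.2 = 0 := h0
    rw [h0', mul_zero] at hz; exact lt_irrefl _ hz
  have hP : straighten h (s, z) ∈ phase J h i := straighten_mem_phase hs hz
  have c1 := b1 z hz0
  have c2 := b2 z hz0
  have c11 := b11 z hz0
  have c12 := b12 z hz0
  have c21 := b21 z hz0
  have c22 := b22 z hz0
  have c10 := b10 z hz0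
  have c20 := b20 z hz0
  have q1 := hF.fderiv_eq hJ hl hP (1, 0)
  have q2 := hF.fderiv_eq hJ hl hP (0, 1)
  have q11 := hF.fderiv_fderiv_eq hJ hl hP (1, 0) (1, 0)
  have q12 := hF.fderiv_fderiv_eq hJ hl hP (1, 0) (0, 1)
  have q21 := hF.fderiv_fderiv_eq hJ hl hP (0, 1) (1, 0)
  have q22 := hF.fderiv_fderiv_eq hJ hl hP (0, 1) (0, 1)
  have q10 := hF.deriv_fderiv_eq hJ hl hP (1, 0)
  have q20 := hF.deriv_fderiv_eq hJ hl hP (0, 1)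
  simp only [straighten] at q1 q2 q11 q12 q21 q22 q10 q20
  rw [q1] at c1
  rw [q2] at c2
  rw [q11] at c11
  rw [q12] at c12
  rw [q21] at c21
  rw [q22] at c22
  rw [q10] at c10
  rw [q20] at c20
  have r1 : |pd (lift h) e1 (s, z)| ≤ A := by
    rw [← (hasDerivAt_height hJ hl hs z.1 z.2).deriv]; exact (a z.1).2.1
  have r0 : |pd (lift h) e0 (s, z)| ≤ A := by
    rw [← heightRate_eq hJ hl hs z.1 z.2]; exact (a z.1).2.2.1
  have c : ∀ y : ℝ, y ≤ |y| := le_abs_self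
  have n : ∀ y : ℝ, 0 ≤ |y| := abs_nonneg
  have := c (g1 z); have := c (g2 z); have := c (g11 z); have := c (g12 z)
  have := c (g21 z); have := c (g22 z); have := c (g10 z); have := c (g20 z)
  have := n (g1 z); have := n (g2 z); have := n (g11 z); have := n (g12 z)
  have := n (g21 z); have := n (g22 z); have := n (g10 z); have := n (g20 z)
  have w12 := mul_nonneg hA0 (n (g12 z))
  have w22 := mul_nonneg hA0 (n (g22 z))
  have hsz := mem_slab hs z
  have hD1 := contDiffOn_pd hJ (hF.smooth i) e1
  have hD2 := contDiffOn_pd hJ (hF.smooth i) e2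
  -- The chain rule in the moving coordinates: an `x`- or `t`-derivative produces an additional
  -- vertical derivative with coefficient `h_x` or `h_t`, both at most `A`.
  have ch : ∀ {α β γ δ : ℝ}, |β| ≤ A → |γ| ≤ δ → |α + β * γ| ≤ |α| + A * |δ| := fun {α β γ δ} hb hg => by
    refine (abs_add_le _ _).trans ?_
    rw [abs_mul]
    have h1 : |γ| ≤ |δ| := hg.trans (le_abs_self _)
    have := mul_le_mul hb h1 (abs_nonneg _) hA0
    linarith
  refine ⟨?_, ?_, ?_, ?_, ?_, ?_⟩
  · exact c1.trans (by linarith)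
  · exact c2.trans (by linarith)
  · rw [flatP, pd_comp_straighten hJ hl hD1 hsz]
    exact (ch r1 c12).trans ((add_le_add_left c11 _).trans (by linarith))
  · rw [flatQ, pd_comp_straighten hJ hl hD2 hsz]
    exact (ch r1 c22).trans ((add_le_add_left c21 _).trans (by linarith))
  · rw [flatP, pd_comp_straighten hJ hl hD1 hsz]
    exact (ch r0 c12).trans ((add_le_add_left c10 _).trans (by linarith))
  · rw [flatQ, pd_comp_straighten hJ hl hD2 hsz]
    exact (ch r0 c22).trans ((add_le_add_left c20 _).trans (by linarith))

end Domination

end MullinsSekerka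

end

/-! ### Solutions at a frozen time, and the derivatives of the energy and the dissipation -/

noncomputable section

namespace MullinsSekerka

open MeasureTheory Filter Set
open scoped Topology ContDiff

section Trace

variable {J : Set ℝ} {h : ℝ → ℝ → ℝ} {f : ℝ → ℝ × ℝ → ℝ} {F : Bool → ℝ × (ℝ × ℝ) → ℝ}

lemma straighten_zero (t x : ℝ) : straighten h (t, (x, 0)) = (t, (x, h t x)) := by
  simp [straighten, shift]

/-- The point is approached vertically from side `i`. This makes the one-sided limits in the jump
condition unique. -/
lemma neBot_nhdsWithin_phase (η : ℝ → ℝ) (x : ℝ) (i : Bool) :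
    (𝓝[{p : ℝ × ℝ | 0 < sgn i * (p.2 - η p.1)}] (x, η x)).NeBot := by
  have hs : sgn i * sgn i = 1 := by cases i <;> simp [sgn]
  have h1 : Tendsto (fun ε : ℝ => ((x, η x + sgn i * ε) : ℝ × ℝ)) (𝓝[>] 0)
      (𝓝[{p : ℝ × ℝ | 0 < sgn i * (p.2 - η p.1)}] (x, η x)) := by
    apply tendsto_nhdsWithin_of_tendsto_nhds_of_eventually_within
    · have : Continuous fun ε : ℝ => ((x, η x + sgn i * ε) : ℝ × ℝ) := by fun_prop
      have h2 := this.tendsto 0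
      simp only [mul_zero, add_zero] at h2
      exact h2.mono_left nhdsWithin_le_nhds
    · filter_upwards [self_mem_nhdsWithin] with ε hε
      simp only [mem_Ioi] at hε
      rw [add_sub_cancel_left, ← mul_assoc, hs, one_mul]; exact hε
  exact h1.neBot

/-- The one-sided trace of the normal derivative. -/
lemma IsExtension.tendsto_normalComponent (hF : IsExtension J h f F) (hJ : IsOpen J)
    (hl : ContDiffOn ℝ ∞ (lift h) (slab J)) {t : ℝ} (ht : t ∈ J) (x : ℝ) (i : Bool) :
    Tendsto (normalComponent (h t) x (f t)) (𝓝[{p : ℝ × ℝ | 0 < sgn i * (p.2 - h t p.1)}] (x, h t x))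
      (𝓝 ((flatP h F i (t, (x, 0)) * deriv (h t) x - flatQ h F i (t, (x, 0))) /
        lineElement (h t) x)) := by
  have c1 : Continuous fun p => pd (F i) e1 (t, p) :=
    (contDiff_slice hJ (contDiffOn_pd hJ (hF.smooth i) e1) ht).continuous
  have c2 : Continuous fun p => pd (F i) e2 (t, p) :=
    (contDiff_slice hJ (contDiffOn_pd hJ (hF.smooth i) e2) ht).continuous
  have c3 : Continuous fun p : ℝ × ℝ => (pd (F i) e1 (t, p) * deriv (h t) x - pd (F i) e2 (t, p)) /
      lineElement (h t) x := ((c1.mul continuous_const).sub c2).div_const _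
  have h1 := c3.tendsto (x, h t x)
  simp only [flatP, flatQ, Function.comp, straighten_zero]
  refine (h1.mono_left nhdsWithin_le_nhds).congr' ?_
  filter_upwards [self_mem_nhdsWithin] with p hp
  have hP : ((t, p) : ℝ × (ℝ × ℝ)) ∈ phase J h i := ⟨⟨ht, mem_univ _⟩, hp⟩
  have q1 := hF.fderiv_eq hJ hl hP (1, 0)
  have q2 := hF.fderiv_eq hJ hl hP (0, 1)
  unfold normalComponent dx dz
  rw [q1, q2]; rfl

lemma upperPhase_eq (η : ℝ → ℝ) : upperPhase η = {p : ℝ × ℝ | 0 < sgn true * (p.2 - η p.1)} := by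
  ext p; simp [upperPhase, sgn]

lemma lowerPhase_eq (η : ℝ → ℝ) : lowerPhase η = {p : ℝ × ℝ | 0 < sgn false * (p.2 - η p.1)} := by
  ext p; simp [lowerPhase, sgn]

lemma IsExtension.jump (hF : IsExtension J h f F) (hJ : IsOpen J)
    (hl : ContDiffOn ℝ ∞ (lift h) (slab J)) {t : ℝ} (ht : t ∈ J) (x : ℝ)
    (hv : HasNormalJump (h t) (f t) x (-normalVelocity h t x)) :
    (flatQ h F false (t, (x, 0)) - deriv (h t) x * flatP h F false (t, (x, 0))) -
    (flatQ h F true (t, (x, 0)) - deriv (h t) x * flatP h F true (t, (x, 0))) =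
      heightRate h t x := by
  obtain ⟨a, b, ha, hb, hab⟩ := hv
  rw [upperPhase_eq] at ha
  rw [lowerPhase_eq] at hb
  have n1 := neBot_nhdsWithin_phase (h t) x true
  have n2 := neBot_nhdsWithin_phase (h t) x false
  have ea := tendsto_nhds_unique ha (hF.tendsto_normalComponent hJ hl ht x true)
  have eb := tendsto_nhds_unique hb (hF.tendsto_normalComponent hJ hl ht x false)
  have hp := lineElement_pos (h t) x
  rw [ea, eb] at hab
  unfold normalVelocity at hab
  change - (-(heightRate h t x) / _) = _ at hab
  field_simp at hab
  linarith

end Trace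

section Solution

variable {J : Set ℝ} {h : ℝ → ℝ → ℝ} {f : ℝ → ℝ × ℝ → ℝ} {F : Bool → ℝ × (ℝ × ℝ) → ℝ}

lemma memLp_glue_of_dominated {v : Bool → ℝ × ℝ → ℝ} {G : ℝ × ℝ → ℝ} (hG : MemLp G 2)
    (hc : ∀ i, Continuous (v i)) (hd : ∀ i (z : ℝ × ℝ), 0 < sgn i * z.2 → |v i z| ≤ G z) :
    MemLp (glue v) 2 := by
  refine hG.mono' (measurable_glue fun i => (hc i).measurable).aestronglyMeasurable ?_
  filter_upwards [ae_snd_ne 0] with z hz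
  exact hd _ z (sgn_decide_mul_pos hz)

/-- A solution at a fixed time. -/
theorem IsSolution.flatSolution (hS : IsSolution J h f) (hJ : IsOpen J) (hF : IsExtension J h f F)
    {t : ℝ} (ht : t ∈ J) :
    FlatSolution (h t) (heightRate h t) (fun i z => flatG h F i (t, z)) (fun i z => flatP h F i (t, z))
      (fun i z => flatQ h F i (t, z)) (fun i z => pd (flatG h F i) e0 (t, z))
      (fun i z => pd (flatP h F i) e0 (t, z)) (fun i z => pd (flatQ h F i) e0 (t, z)) := by
  have hh := hS.regular_height
  have hl := hh.smooth_lift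
  have sG := hF.smooth_flatG hl
  have sP := hF.smooth_flatP hJ hl
  have sQ := hF.smooth_flatQ hJ hl
  have cη := contDiff_height hJ hl ht
  have cu := contDiff_heightRate hJ hl ht
  obtain ⟨G, hG, hd⟩ := hh.dominated ht
  have hd' := hd.self_of_nhds
  obtain ⟨K, hK, hk⟩ := hF.dominated hJ hh hS.regular_field ht
  have hk' := hk.self_of_nhds
  have sl : ∀ z : ℝ × ℝ, (t, z) ∈ slab J := mem_slab ht
  have a_eq : ∀ z : ℝ × ℝ, deriv (h t) z.1 = pd (lift h) e1 (t, z) := fun z =>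
    (hasDerivAt_height hJ hl ht z.1 z.2).deriv
  have u_eq : ∀ z : ℝ × ℝ, heightRate h t z.1 = pd (lift h) e0 (t, z) := fun z =>
    heightRate_eq hJ hl ht z.1 z.2
  have u1_eq : ∀ z : ℝ × ℝ, deriv (heightRate h t) z.1 = pd (pd (lift h) e0) e1 (t, z) := fun z =>
    deriv_heightRate_eq hJ hl ht z.1 z.2
  have Gx : ∀ i, ∀ P ∈ slab J, pd (flatG h F i) e1 P = flatP h F i P + pd (lift h) e1 P * flatQ h F i P :=
    fun i P hP => pd_comp_straighten hJ hl (hF.smooth i) hP e1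
  have Gz : ∀ i, ∀ P ∈ slab J, pd (flatG h F i) e2 P = flatQ h F i P := fun i P hP => by
    rw [flatG, pd_comp_straighten hJ hl (hF.smooth i) hP e2, lift_indep hJ hl hP, zero_mul, add_zero]; rfl
  have cont : ∀ {w : Bool → ℝ × (ℝ × ℝ) → ℝ}, (∀ i, ContDiffOn ℝ ∞ (w i) (slab J)) →
      ∀ i, Continuous fun z => w i (t, z) := fun hw i => (contDiff_slice hJ (hw i) ht).continuous
  have dxs : ∀ {w : ℝ × (ℝ × ℝ) → ℝ}, ContDiffOn ℝ ∞ w (slab J) → ∀ z,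
      dx (fun z => w (t, z)) z = pd w e1 (t, z) := fun hw z => dx_slice (differentiableAt_slab hJ hw (sl z))
  have dzs : ∀ {w : ℝ × (ℝ × ℝ) → ℝ}, ContDiffOn ℝ ∞ w (slab J) → ∀ z,
      dz (fun z => w (t, z)) z = pd w e2 (t, z) := fun hw z => dz_slice (differentiableAt_slab hJ hw (sl z))
  have pdmul : ∀ {a b : ℝ × (ℝ × ℝ) → ℝ} (_ : ContDiffOn ℝ ∞ a (slab J))
      (_ : ContDiffOn ℝ ∞ b (slab J)) {P : ℝ × (ℝ × ℝ)} (_ : P ∈ slab J) (v : ℝ × (ℝ × ℝ)),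
      pd (fun P => a P * b P) v P = a P * pd b v P + b P * pd a v P := by
    intro a b ha hb P hP v
    unfold pd
    rw [fderiv_fun_mul (differentiableAt_slab hJ ha hP) (differentiableAt_slab hJ hb hP)]; simp
  have pdadd : ∀ {a b : ℝ × (ℝ × ℝ) → ℝ} (_ : ContDiffOn ℝ ∞ a (slab J))
      (_ : ContDiffOn ℝ ∞ b (slab J)) {P : ℝ × (ℝ × ℝ)} (_ : P ∈ slab J) (v : ℝ × (ℝ × ℝ)),
      pd (fun P => a P + b P) v P = pd a v P + pd b v P := by
    intro a b ha hb P hP v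
    unfold pd
    rw [fderiv_fun_add (differentiableAt_slab hJ ha hP) (differentiableAt_slab hJ hb hP)]; simp
  have la := contDiffOn_pd hJ hl e1
  have pdcongr : ∀ {a b : ℝ × (ℝ × ℝ) → ℝ} (_ : ∀ P ∈ slab J, a P = b P) {P : ℝ × (ℝ × ℝ)}
      (_ : P ∈ slab J) (v : ℝ × (ℝ × ℝ)), pd a v P = pd b v P := by
    intro a b hab P hP v
    have : a =ᶠ[𝓝 P] b := by
      filter_upwards [(isOpen_slab hJ).mem_nhds hP] with Q hQ using hab Q hQ
    unfold pd
    rw [this.fderiv_eq]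
  -- The relation `∂ₓ g = p + h_x q` is differentiated in time. The last summand `h_tx q` is the
  -- origin of the cubic term in the rate of the dissipation.
  have Gt_x : ∀ i z, pd (pd (flatG h F i) e0) e1 (t, z) = pd (flatP h F i) e0 (t, z) +
      pd (lift h) e1 (t, z) * pd (flatQ h F i) e0 (t, z) +
      pd (pd (lift h) e0) e1 (t, z) * flatQ h F i (t, z) := fun i z => by
    rw [pd_comm hJ (sG i) (sl z), pdcongr (Gx i) (sl z), pdadd (sP i) (la.mul (sQ i)) (sl z),
      pdmul la (sQ i) (sl z), pd_comm hJ hl (sl z)]; ring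
  have Gt_z : ∀ i z, pd (pd (flatG h F i) e0) e2 (t, z) = pd (flatQ h F i) e0 (t, z) := fun i z => by
    rw [pd_comm hJ (sG i) (sl z), pdcongr (Gz i) (sl z)]
  constructor
  · exact cη
  · exact cu
  · exact fun i => contDiff_slice hJ (sG i) ht
  · exact fun i => contDiff_slice hJ (sP i) ht
  · exact fun i => contDiff_slice hJ (sQ i) ht
  · exact fun i => contDiff_slice hJ (contDiffOn_pd hJ (sG i) e0) ht
  · exact hG.mono' cη.continuous.aestronglyMeasurable (Eventually.of_forall fun x => (hd' x).1)
  · exact hG.mono' (contDiff_deriv cη).continuous.aestronglyMeasurable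
      (Eventually.of_forall fun x => (hd' x).2.1)
  · exact hG.mono' (contDiff_deriv (contDiff_deriv cη)).continuous.aestronglyMeasurable
      (Eventually.of_forall fun x => (hd' x).2.2.1)
  · exact hG.mono' cu.continuous.aestronglyMeasurable (Eventually.of_forall fun x => (hd' x).2.2.2.1)
  · exact hG.mono' (contDiff_deriv cu).continuous.aestronglyMeasurable
      (Eventually.of_forall fun x => (hd' x).2.2.2.2.1)
  · exact hG.mono' (contDiff_deriv (contDiff_deriv cu)).continuous.aestronglyMeasurable
      (Eventually.of_forall fun x => (hd' x).2.2.2.2.2)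
  · exact memLp_glue_of_dominated hK (cont sP) fun i z hz => (hk' i z hz).1
  · exact memLp_glue_of_dominated hK (cont sQ) fun i z hz => (hk' i z hz).2.1
  · have e : (fun i => dx fun z => flatP h F i (t, z)) = fun i z => pd (flatP h F i) e1 (t, z) := by
      funext i z; exact dxs (sP i) z
    change MemLp (glue fun i => dx fun z => flatP h F i (t, z)) 2
    rw [e]
    exact memLp_glue_of_dominated hK (cont fun i => contDiffOn_pd hJ (sP i) e1)
      fun i z hz => (hk' i z hz).2.2.1
  · have e : (fun i => dx fun z => flatQ h F i (t, z)) = fun i z => pd (flatQ h F i) e1 (t, z) := by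
      funext i z; exact dxs (sQ i) z
    change MemLp (glue fun i => dx fun z => flatQ h F i (t, z)) 2
    rw [e]
    exact memLp_glue_of_dominated hK (cont fun i => contDiffOn_pd hJ (sQ i) e1)
      fun i z hz => (hk' i z hz).2.2.2.1
  · exact memLp_glue_of_dominated hK (cont fun i => contDiffOn_pd hJ (sP i) e0)
      fun i z hz => (hk' i z hz).2.2.2.2.1
  · exact memLp_glue_of_dominated hK (cont fun i => contDiffOn_pd hJ (sQ i) e0)
      fun i z hz => (hk' i z hz).2.2.2.2.2
  · intro i z
    rw [dxs (sG i), Gx i _ (sl z), a_eq]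
  · intro i z
    rw [dzs (sG i), Gz i _ (sl z)]
  · intro i z
    rw [dxs (contDiffOn_pd hJ (sG i) e0), Gt_x, a_eq, u1_eq]
  · intro i z
    rw [dzs (contDiffOn_pd hJ (sG i) e0), Gt_z]
  · intro i z hz
    have h1 := contDiffOn_pd hJ (hF.smooth i) e1
    have h2 := contDiffOn_pd hJ (hF.smooth i) e2
    have hlap := hF.laplace hJ hl hS.harmonic (straighten_mem_phase ht hz)
    have hz2 := lift_indep hJ hl (sl z)
    have hst : straighten h (t, z) ∈ slab J := ⟨ht, mem_univ _⟩
    rw [dxs (sP i), dzs (sQ i), dzs (sP i), flatP, flatQ, pd_comp_straighten hJ hl h1 (sl z),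
      pd_comp_straighten hJ hl h2 (sl z), pd_comp_straighten hJ hl h1 (sl z), hz2, a_eq]
    linarith
  · intro i x
    change F i (straighten h (t, (x, 0))) = _
    rw [straighten_zero, ← hF.eq i t ht (x, h t x) (by simp)]
    exact hS.gibbs_thomson t ht x
  · intro i x
    -- The interface is the fixed line `y = 0` in these coordinates, so the law `f = κ` can be
    -- differentiated in time along it.
    have h1 := hasDerivAt_time (differentiableAt_slab hJ (sG i) (sl (x, 0)))
    have h2 := hasDerivAt_curvature_time hJ hl ht x
    refine h1.unique (h2.congr_of_eventuallyEq ?_)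
    filter_upwards [hJ.mem_nhds ht] with s hs
    change F i (straighten h (s, (x, 0))) = _
    rw [straighten_zero, ← hF.eq i s hs (x, h s x) (by simp)]
    exact hS.gibbs_thomson s hs x
  · exact fun x => hF.jump hJ hl ht x (hS.velocity t ht x)

end Solution

/-! ### The change of variables -/

/-- `shift η` as a homeomorphism. -/
def shiftHomeomorph {η : ℝ → ℝ} (hη : Continuous η) : ℝ × ℝ ≃ₜ ℝ × ℝ where
  toFun := shift η
  invFun p := (p.1, p.2 - η p.1)
  left_inv q := by simp [shift]
  right_inv p := by simp [shift]
  continuous_toFun := by unfold shift; fun_prop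
  continuous_invFun := by fun_prop

lemma measurePreserving_shift {η : ℝ → ℝ} (hη : Continuous η) :
    MeasurePreserving (shift η) volume volume := by
  rw [Measure.volume_eq_prod]
  refine MeasurePreserving.skew_product (g := fun x y => η x + y) (MeasurePreserving.id volume) ?_ ?_
  · exact (by fun_prop : Continuous (Function.uncurry fun x y => η x + y)).measurable
  · exact Eventually.of_forall fun x => (measurePreserving_add_left volume (η x)).map_eq

lemma measurableEmbedding_shift {η : ℝ → ℝ} (hη : Continuous η) : MeasurableEmbedding (shift η) :=
  (shiftHomeomorph hη).measurableEmbedding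

lemma integral_comp_shift {η : ℝ → ℝ} (hη : Continuous η) (v : ℝ × ℝ → ℝ) :
    ∫ z, v (shift η z) = ∫ p, v p :=
  (measurePreserving_shift hη).integral_comp (measurableEmbedding_shift hη) v

section Derivatives

variable {J : Set ℝ} {h : ℝ → ℝ → ℝ} {f : ℝ → ℝ × ℝ → ℝ} {F : Bool → ℝ × (ℝ × ℝ) → ℝ}

lemma IsExtension.dirichlet_eq (hF : IsExtension J h f F) (hJ : IsOpen J)
    (hl : ContDiffOn ℝ ∞ (lift h) (slab J)) {t : ℝ} (ht : t ∈ J) :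
    dirichlet (f t) = ∫ z, (glue (fun i z => flatP h F i (t, z)) z ^ 2 +
      glue (fun i z => flatQ h F i (t, z)) z ^ 2) := by
  unfold dirichlet
  rw [← integral_comp_shift (contDiff_height hJ hl ht).continuous]
  apply integral_congr_ae
  filter_upwards [ae_snd_ne 0] with z hz
  have hs := sgn_decide_mul_pos hz
  simp only [glue, hF.flatP_eq hJ hl ht hs, hF.flatQ_eq hJ hl ht hs]

/-- The dissipation is differentiable. -/
theorem IsSolution.hasDerivAt_dirichlet (hS : IsSolution J h f) (hJ : IsOpen J)
    (hF : IsExtension J h f F) {t : ℝ} (ht : t ∈ J) :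
    HasDerivAt (fun s => dirichlet (f s)) (2 * ∫ z, (glue (fun i z => flatP h F i (t, z)) z *
      glue (fun i z => pd (flatP h F i) e0 (t, z)) z + glue (fun i z => flatQ h F i (t, z)) z *
      glue (fun i z => pd (flatQ h F i) e0 (t, z)) z)) t := by
  have hl := hS.regular_height.smooth_lift
  have sP := hF.smooth_flatP hJ hl
  have sQ := hF.smooth_flatQ hJ hl
  obtain ⟨K, hK, hk⟩ := hF.dominated hJ hS.regular_height hS.regular_field ht
  obtain ⟨ε, hε, hball⟩ := Metric.eventually_nhds_iff_ball.1 (hk.and (hJ.mem_nhds ht))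
  -- In straightened coordinates the two phases do not move and the Jacobian is one, so no boundary
  -- term appears when differentiating in time.
  set I : ℝ → ℝ × ℝ → ℝ := fun s z => glue (fun i z => flatP h F i (s, z)) z ^ 2 +
    glue (fun i z => flatQ h F i (s, z)) z ^ 2 with hI
  set I' : ℝ → ℝ × ℝ → ℝ := fun s z => 2 * (glue (fun i z => flatP h F i (s, z)) z *
      glue (fun i z => pd (flatP h F i) e0 (s, z)) z + glue (fun i z => flatQ h F i (s, z)) z *
      glue (fun i z => pd (flatQ h F i) e0 (s, z)) z) with hI'
  have hm : ∀ {w : Bool → ℝ × (ℝ × ℝ) → ℝ}, (∀ i, ContDiffOn ℝ ∞ (w i) (slab J)) → ∀ s ∈ J,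
      AEStronglyMeasurable (glue fun i z => w i (s, z)) := fun hw s hs =>
    (measurable_glue fun i => (contDiff_slice hJ (hw i) hs).continuous.measurable).aestronglyMeasurable
  have hmI : ∀ s ∈ J, AEStronglyMeasurable (I s) := fun s hs => ((hm sP s hs).pow 2).add ((hm sQ s hs).pow 2)
  have key := hasDerivAt_integral_of_dominated_loc_of_deriv_le (F := I) (F' := I') (x₀ := t)
    (bound := fun z => 4 * K z ^ 2) (μ := volume) (Metric.ball_mem_nhds t hε) ?_ ?_ ?_ ?_ ?_ ?_
  · have h2 := key.2
    have e1 : ∫ z, I' t z = 2 * ∫ z, (glue (fun i z => flatP h F i (t, z)) z *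
      glue (fun i z => pd (flatP h F i) e0 (t, z)) z + glue (fun i z => flatQ h F i (t, z)) z *
      glue (fun i z => pd (flatQ h F i) e0 (t, z)) z) := integral_const_mul _ _
    rw [e1] at h2
    refine h2.congr_of_eventuallyEq ?_
    filter_upwards [hJ.mem_nhds ht] with s hs using hF.dirichlet_eq hJ hl hs
  · filter_upwards [hJ.mem_nhds ht] with s hs using hmI s hs
  · have S := hS.flatSolution hJ hF ht
    exact S.integrable_sq_add_sq
  · exact (((hm sP t ht).mul (hm (fun i => contDiffOn_pd hJ (sP i) e0) t ht)).add
      ((hm sQ t ht).mul (hm (fun i => contDiffOn_pd hJ (sQ i) e0) t ht))).const_mul 2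
  · filter_upwards [ae_snd_ne 0] with z hz s hs
    have hb := (hball s hs).1 _ z (sgn_decide_mul_pos hz)
    have hK0 : 0 ≤ K z := (abs_nonneg _).trans hb.1
    have m1 := mul_le_mul hb.1 hb.2.2.2.2.1 (abs_nonneg _) hK0
    have m2 := mul_le_mul hb.2.1 hb.2.2.2.2.2 (abs_nonneg _) hK0
    rw [← abs_mul] at m1 m2
    rw [Real.norm_eq_abs, hI', abs_mul, abs_two]
    have := abs_add_le (glue (fun i z => flatP h F i (s, z)) z *
      glue (fun i z => pd (flatP h F i) e0 (s, z)) z) (glue (fun i z => flatQ h F i (s, z)) z *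
      glue (fun i z => pd (flatQ h F i) e0 (s, z)) z)
    simp only [glue] at this m1 m2 ⊢
    linarith
  · exact hK.integrable_sq.const_mul 4
  · refine Eventually.of_forall fun z s hs => ?_
    have hsJ := (hball s hs).2
    simp only [hI, hI', glue]
    have d1 := hasDerivAt_time (differentiableAt_slab hJ (sP (decide (0 < z.2))) (mem_slab hsJ z))
    have d2 := hasDerivAt_time (differentiableAt_slab hJ (sQ (decide (0 < z.2))) (mem_slab hsJ z))
    refine ((d1.fun_pow 2).fun_add (d2.fun_pow 2)).congr_deriv ?_
    push_cast; ring

/-- The energy identity `dE/dt = -D`. -/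
theorem IsSolution.hasDerivAt_energy (hS : IsSolution J h f) (hJ : IsOpen J) {t : ℝ} (ht : t ∈ J) :
    HasDerivAt (fun s => energy (h s)) (-dirichlet (f t)) t := by
  obtain ⟨F, hF⟩ := hS.regular_field.exists_isExtension
  have hl := hS.regular_height.smooth_lift
  have S := hS.flatSolution hJ hF ht
  obtain ⟨K, hK, hk⟩ := hS.regular_height.dominated ht
  obtain ⟨ε, hε, hball⟩ := Metric.eventually_nhds_iff_ball.1 (hk.and (hJ.mem_nhds ht))
  have key := hasDerivAt_integral_of_dominated_loc_of_deriv_le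
    (F := fun s x => lineElement (h s) x - 1)
    (F' := fun s x => slope (h s) x * deriv (heightRate h s) x) (x₀ := t)
    (bound := fun x => K x ^ 2) (μ := volume) (Metric.ball_mem_nhds t hε) ?_ ?_ ?_ ?_ ?_ ?_
  · have h2 := key.2
    -- The integrand is the time derivative of the line element; integration by parts turns it into
    -- `-κ h_t`, whose integral is `-D`.
    have e : ∫ x, slope (h t) x * deriv (heightRate h t) x = -dirichlet (f t) := by
      rw [integral_slope_mul S.smooth_η S.memLp_η1 S.memLp_η2 S.smooth_u S.memLp_u S.memLp_u1,
        S.integral_curvature_mul, hF.dirichlet_eq hJ hl ht]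
    rw [e] at h2
    exact h2
  · filter_upwards [hJ.mem_nhds ht] with s hs
    exact ((contDiff_lineElement (contDiff_height hJ hl hs)).continuous.sub
      continuous_const).aestronglyMeasurable
  · exact integrable_lineElement_sub_one S.smooth_η S.memLp_η1
  · exact ((contDiff_slope S.smooth_η).continuous.mul
      (contDiff_deriv S.smooth_u).continuous).aestronglyMeasurable
  · refine Eventually.of_forall fun x s hs => ?_
    have hb := (hball s hs).1 x
    rw [norm_mul, sq]
    exact mul_le_mul ((abs_slope_le _ _).trans hb.2.1) hb.2.2.2.2.1 (abs_nonneg _)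
      ((abs_nonneg _).trans hb.1)
  · exact hK.integrable_sq
  · refine Eventually.of_forall fun x s hs => ?_
    have hsJ := (hball s hs).2
    have h5 := hasDerivAt_slope_time hJ hl hsJ x
    have h6 := (((h5.fun_pow 2).const_add 1).sqrt (by positivity)).sub_const 1
    refine h6.congr_deriv ?_
    have hp := lineElement_pos (h s) x
    change _ / (2 * lineElement (h s) x) = deriv (h s) x / lineElement (h s) x * _
    field_simp; push_cast; ring

end Derivatives

end MullinsSekerka

end

noncomputable section

namespace MullinsSekerka

open MeasureTheory Filter Set
open scoped Topology ContDiff Convolution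

/-! ### Lipschitz test functions -/

/-- A sequence of mollifiers. -/
def mollifier (n : ℕ) : ContDiffBump (0 : ℝ × ℝ) where
  rIn := 1 / (n + 1)
  rOut := 2 / (n + 1)
  rIn_pos := by positivity
  rIn_lt_rOut := by gcongr; norm_num

/-- The mollification of a function. -/
def mollify (n : ℕ) (v : ℝ × ℝ → ℝ) : ℝ × ℝ → ℝ :=
  (mollifier n).normed volume ⋆[ContinuousLinearMap.lsmul ℝ ℝ, volume] v

lemma mollify_apply (n : ℕ) (v : ℝ × ℝ → ℝ) (p : ℝ × ℝ) :
    mollify n v p = ∫ q, (mollifier n).normed volume q * v (p - q) := rfl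

lemma integrable_mollifier_mul (n : ℕ) {v : ℝ × ℝ → ℝ} {C : ℝ} (hv : Measurable v)
    (hC : ∀ p, |v p| ≤ C) (p : ℝ × ℝ) :
    Integrable fun q => (mollifier n).normed volume q * v (p - q) := by
  refine ((mollifier n).integrable_normed (μ := volume)).mul_bdd (c := C)
    (hv.comp (measurable_const.sub measurable_id)).aestronglyMeasurable
    (Eventually.of_forall fun q => hC _)

lemma abs_mollify_le (n : ℕ) {v : ℝ × ℝ → ℝ} {C : ℝ} (hC : ∀ p, |v p| ≤ C) (p : ℝ × ℝ) :
    |mollify n v p| ≤ C := by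
  rw [mollify_apply]
  have h := norm_integral_le_of_norm_le
    (((mollifier n).integrable_normed (μ := volume)).mul_const C)
    (f := fun q => (mollifier n).normed volume q * v (p - q)) (Eventually.of_forall fun q => by
      rw [norm_mul, Real.norm_of_nonneg ((mollifier n).nonneg_normed q)]
      exact mul_le_mul_of_nonneg_left (hC _) ((mollifier n).nonneg_normed q))
  rwa [integral_mul_const, (mollifier n).integral_normed, one_mul] at h

lemma contDiff_mollify (n : ℕ) {v : ℝ × ℝ → ℝ} (hv : LocallyIntegrable v) :
    ContDiff ℝ ∞ (mollify n v) :=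
  (mollifier n).hasCompactSupport_normed.contDiff_convolution_left _
    (mollifier n).contDiff_normed hv

lemma mollify_eq_zero (n : ℕ) {v : ℝ × ℝ → ℝ} {R : ℝ} (hv : ∀ p, R ≤ ‖p‖ → v p = 0) {p : ℝ × ℝ}
    (hp : R + 2 ≤ ‖p‖) : mollify n v p = 0 := by
  rw [mollify_apply]
  apply integral_eq_zero_of_ae
  refine Eventually.of_forall fun q => ?_
  by_cases hq : q ∈ Function.support ((mollifier n).normed volume)
  · rw [(mollifier n).support_normed_eq, Metric.mem_ball, dist_zero_right] at hq
    have h1 : (mollifier n).rOut ≤ 2 := by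
      change (2 : ℝ) / (n + 1) ≤ 2
      exact div_le_self zero_le_two (by have : (0 : ℝ) ≤ n := n.cast_nonneg
                                        linarith)
    have h2 := norm_sub_norm_le p q
    simp [hv (p - q) (by linarith)]
  · simp [Function.notMem_support.1 hq]

lemma tendsto_rOut_mollifier : Tendsto (fun n => (mollifier n).rOut) atTop (𝓝 0) :=
  tendsto_const_div_atTop_nhds_zero_nat 2 |>.comp (tendsto_add_atTop_nat 1) |>.congr fun n => by
    change (2 : ℝ) / ((n + 1 : ℕ) : ℝ) = 2 / ((n : ℝ) + 1)
    push_cast; rfl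

lemma ae_tendsto_mollify {v : ℝ × ℝ → ℝ} (hv : LocallyIntegrable v) :
    ∀ᵐ p, Tendsto (fun n => mollify n v p) atTop (𝓝 (v p)) :=
  ContDiffBump.ae_convolution_tendsto_right_of_locallyIntegrable (K := 2)
    tendsto_rOut_mollifier (Eventually.of_forall fun n => by
      change (2 : ℝ) / (n + 1) ≤ 2 * (1 / (n + 1))
      apply le_of_eq; ring) hv

/-- Mollification commutes with derivatives of Lipschitz functions. -/
lemma fderiv_mollify (n : ℕ) {v : ℝ × ℝ → ℝ} {C : NNReal} (hv : LipschitzWith C v) {B : ℝ}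
    (hB : ∀ p, |v p| ≤ B) (p e : ℝ × ℝ) :
    fderiv ℝ (mollify n v) p e = mollify n (fun q => fderiv ℝ v q e) p := by
  have hs := contDiff_mollify n (hv.continuous.locallyIntegrable (μ := volume))
  have hd : HasDerivAt (fun s : ℝ => mollify n v (p + s • e)) (fderiv ℝ (mollify n v) p e) 0 := by
    have h1 : HasFDerivAt (mollify n v) (fderiv ℝ (mollify n v) p) (p + (0 : ℝ) • e) := by
      simpa using ((hs.differentiable (by simp)) p).hasFDerivAt
    have h2 : HasDerivAt (fun s : ℝ => p + s • e) ((1 : ℝ) • e) 0 :=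
      ((hasDerivAt_id (0 : ℝ)).smul_const e).const_add p
    have h3 := h1.comp_hasDerivAt (0 : ℝ) h2
    rw [one_smul] at h3
    exact h3
  set b := (mollifier n).normed (volume : Measure (ℝ × ℝ)) with hb
  have hb0 : ∀ q, 0 ≤ b q := (mollifier n).nonneg_normed
  have hbi : Integrable b := (mollifier n).integrable_normed
  have hm : Measurable fun q => fderiv ℝ v q e := measurable_fderiv_apply_const ℝ v e
  -- Rademacher's theorem supplies the derivative under the integral almost everywhere, and the
  -- Lipschitz constant dominates the difference quotients.
  have hdiff : ∀ᵐ q, DifferentiableAt ℝ v (p - q) :=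
    (quasiMeasurePreserving_sub_left volume p).ae hv.ae_differentiableAt
  have key := hasDerivAt_integral_of_dominated_loc_of_lip (μ := volume) (x₀ := (0 : ℝ))
    (F := fun s q => b q * v (p + s • e - q)) (F' := fun q => b q * fderiv ℝ v (p - q) e)
    (bound := fun q => b q * (C * ‖e‖)) univ_mem ?_ ?_ ?_ ?_ ?_ ?_
  · exact hd.unique key.2
  · exact Eventually.of_forall fun s =>
      (integrable_mollifier_mul n hv.continuous.measurable hB _).1
  · exact integrable_mollifier_mul n hv.continuous.measurable hB _
  · exact hbi.1.mul (hm.comp (measurable_const.sub measurable_id)).aestronglyMeasurable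
  · refine Eventually.of_forall fun q => LipschitzWith.lipschitzOnWith ?_
    refine LipschitzWith.of_dist_le_mul fun s r => ?_
    rw [Real.coe_nnabs, abs_of_nonneg (mul_nonneg (hb0 q) (by positivity)), Real.dist_eq,
      ← mul_sub, abs_mul, abs_of_nonneg (hb0 q), mul_assoc]
    apply mul_le_mul_of_nonneg_left _ (hb0 q)
    have h1 := hv.dist_le_mul (p + s • e - q) (p + r • e - q)
    rw [dist_sub_right, dist_add_left, dist_eq_norm (s • e), ← sub_smul, norm_smul] at h1
    rw [← Real.dist_eq, mul_assoc, mul_comm ‖e‖]; exact h1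
  · exact hbi.mul_const _
  · filter_upwards [hdiff] with q hq
    have h1 : HasFDerivAt v (fderiv ℝ v (p - q)) (p + (0 : ℝ) • e - q) := by
      simpa using hq.hasFDerivAt
    have h2 : HasDerivAt (fun s : ℝ => p + s • e - q) ((1 : ℝ) • e) 0 :=
      (((hasDerivAt_id (0 : ℝ)).smul_const e).const_add p).sub_const q
    have h3 := h1.comp_hasDerivAt (0 : ℝ) h2
    rw [one_smul] at h3
    exact h3.const_mul _

/-- The source `1_{Ω₊} - 1_{Ω₀}`. -/
def source (η : ℝ → ℝ) (p : ℝ × ℝ) : ℝ :=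
  (upperPhase η).indicator (fun _ => (1 : ℝ)) p - (upperPhase fun _ => 0).indicator (fun _ => (1 : ℝ)) p

lemma measurable_source {η : ℝ → ℝ} (hη : Measurable η) : Measurable (source η) := by
  have h1 : MeasurableSet (upperPhase η) :=
    measurableSet_lt (hη.comp measurable_fst) measurable_snd
  have h2 : MeasurableSet (upperPhase fun _ => 0) := measurableSet_lt measurable_const measurable_snd
  exact (measurable_const.indicator h1).sub (measurable_const.indicator h2)

lemma abs_source_le (η : ℝ → ℝ) (p : ℝ × ℝ) : |source η p| ≤ 1 := by
  unfold source indicator; split_ifs <;> simp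

lemma exists_zero_of_hasCompactSupport {v : ℝ × ℝ → ℝ} (hc : HasCompactSupport v) :
    ∃ R : ℝ, ∀ p, R ≤ ‖p‖ → v p = 0 := by
  obtain ⟨R, hR⟩ := hc.isCompact.isBounded.exists_norm_le
  refine ⟨R + 1, fun p hp => ?_⟩
  by_contra h
  have := hR p (subset_tsupport v h)
  linarith

/-- The weak equation for Lipschitz test functions. -/
theorem IsPotential.weak_lipschitz {η : ℝ → ℝ} {φ : ℝ × ℝ → ℝ} (hφ : IsPotential η φ)
    (hη : Measurable η) {ψ : ℝ × ℝ → ℝ} {C : NNReal} (hψ : LipschitzWith C ψ)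
    (hc : HasCompactSupport ψ) :
    ∫ p, (dx φ p * dx ψ p + dz φ p * dz ψ p) = ∫ p, source η p * ψ p := by
  -- Lipschitz test functions are needed because `f` has a kink on the interface. The mollifications
  -- of `ψ` live in one ball, their gradients obey the bounds given by the Lipschitz constant, and
  -- functions and gradients converge almost everywhere; dominated convergence passes to the limit.
  obtain ⟨R, hR⟩ := exists_zero_of_hasCompactSupport hc
  obtain ⟨B, hB⟩ := hc.exists_bound_of_continuous hψ.continuous
  have hli := hψ.continuous.locallyIntegrable (μ := (volume : Measure (ℝ × ℝ)))
  set S : Set (ℝ × ℝ) := Metric.closedBall 0 (R + 2) with hS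
  have hSm : MeasurableSet S := measurableSet_closedBall
  have hSc : IsCompact S := isCompact_closedBall _ _
  have hout : ∀ p, p ∉ S → R + 2 ≤ ‖p‖ := fun p hp => by
    rw [hS, Metric.mem_closedBall, dist_zero_right] at hp; exact (not_le.1 hp).le
  have hder : ∀ e p : ℝ × ℝ, |fderiv ℝ ψ p e| ≤ C * ‖e‖ := fun e p =>
    ((fderiv ℝ ψ p).le_opNorm e).trans
      (mul_le_mul_of_nonneg_right (norm_fderiv_le_of_lipschitz ℝ hψ) (norm_nonneg _))
  have hdm : ∀ e : ℝ × ℝ, Measurable fun p => fderiv ℝ ψ p e := fun e =>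
    measurable_fderiv_apply_const ℝ ψ e
  have hdz : ∀ e p : ℝ × ℝ, R + 1 ≤ ‖p‖ → fderiv ℝ ψ p e = 0 := fun e p hp => by
    have : ψ =ᶠ[𝓝 p] fun _ => 0 := by
      have : {q : ℝ × ℝ | R < ‖q‖} ∈ 𝓝 p :=
        (isOpen_lt continuous_const continuous_norm).mem_nhds (by simp; linarith)
      filter_upwards [this] with q hq using hR q hq.le
    rw [this.fderiv_eq]; simp
  have hdz' : ∀ n (e p : ℝ × ℝ), p ∉ S → fderiv ℝ (mollify n ψ) p e = 0 := fun n e p hp => by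
    have : mollify n ψ =ᶠ[𝓝 p] fun _ => 0 := by
      filter_upwards [Metric.isClosed_closedBall.isOpen_compl.mem_nhds hp] with q hq
      exact mollify_eq_zero n hR (hout q hq)
    rw [this.fderiv_eq]; simp
  have hdli : ∀ e : ℝ × ℝ, LocallyIntegrable fun p => fderiv ℝ ψ p e := fun e => by
    have := (locallyIntegrable_const (μ := (volume : Measure (ℝ × ℝ))) ((C : ℝ) * ‖e‖))
    exact this.mono (hdm e).aestronglyMeasurable (Eventually.of_forall fun p =>
      (hder e p).trans (le_abs_self _))
  have hms : ∀ n, ContDiff ℝ ∞ (mollify n ψ) := fun n => contDiff_mollify n hli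
  have hweak : ∀ n, ∫ p, (dx φ p * dx (mollify n ψ) p + dz φ p * dz (mollify n ψ) p) =
      ∫ p, source η p * mollify n ψ p := fun n => by
    refine hφ.weak _ (hms n) ?_
    refine HasCompactSupport.of_support_subset_isCompact hSc fun p hp => ?_
    by_contra h
    exact hp (mollify_eq_zero n hR (hout p h))
  have cx := continuous_dx hφ.contDiff
  have cz := continuous_dz hφ.contDiff
  have bnd : ∀ n (e p : ℝ × ℝ), |fderiv ℝ (mollify n ψ) p e| ≤ S.indicator (fun _ => C * ‖e‖) p := by
    intro n e p
    by_cases hp : p ∈ S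
    · rw [indicator_of_mem hp, fderiv_mollify n hψ hB]
      exact abs_mollify_le n (hder e) p
    · rw [indicator_of_notMem hp, hdz' n e p hp, abs_zero]
  have lim : ∀ e : ℝ × ℝ, ∀ᵐ p, Tendsto (fun n => fderiv ℝ (mollify n ψ) p e) atTop
      (𝓝 (fderiv ℝ ψ p e)) := fun e => by
    filter_upwards [ae_tendsto_mollify (hdli e)] with p hp
    exact hp.congr fun n => (fderiv_mollify n hψ hB p e).symm
  have T1 : Tendsto (fun n => ∫ p, (dx φ p * dx (mollify n ψ) p + dz φ p * dz (mollify n ψ) p))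
      atTop (𝓝 (∫ p, (dx φ p * dx ψ p + dz φ p * dz ψ p))) := by
    apply tendsto_integral_of_dominated_convergence (S.indicator fun p =>
      |dx φ p| * (C * ‖((1, 0) : ℝ × ℝ)‖) + |dz φ p| * (C * ‖((0, 1) : ℝ × ℝ)‖))
    · intro n
      have m1 := continuous_dx ((hms n).of_le (by simp : (1 : ℕ∞ω) ≤ ∞))
      have m2 := continuous_dz ((hms n).of_le (by simp : (1 : ℕ∞ω) ≤ ∞))
      exact ((cx.mul m1).add (cz.mul m2)).aestronglyMeasurable
    · rw [integrable_indicator_iff hSm]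
      exact ContinuousOn.integrableOn_compact hSc (Continuous.continuousOn (by fun_prop))
    · refine fun n => Eventually.of_forall fun p => ?_
      have b1 := mul_le_mul_of_nonneg_left (bnd n (1, 0) p) (abs_nonneg (dx φ p))
      have b2 := mul_le_mul_of_nonneg_left (bnd n (0, 1) p) (abs_nonneg (dz φ p))
      rw [← abs_mul] at b1 b2
      refine (abs_add_le _ _).trans ((add_le_add b1 b2).trans (le_of_eq ?_))
      unfold indicator; split_ifs <;> simp
    · filter_upwards [lim (1, 0), lim (0, 1)] with p h1 h2
      exact (h1.const_mul _).add (h2.const_mul _)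
  have T2 : Tendsto (fun n => ∫ p, source η p * mollify n ψ p) atTop (𝓝 (∫ p, source η p * ψ p)) := by
    apply tendsto_integral_of_dominated_convergence (S.indicator fun _ => B)
    · exact fun n => (measurable_source hη).aestronglyMeasurable.mul
        (hms n).continuous.aestronglyMeasurable
    · rw [integrable_indicator_iff hSm]
      exact ContinuousOn.integrableOn_compact hSc (Continuous.continuousOn (by fun_prop))
    · refine fun n => Eventually.of_forall fun p => ?_
      rw [norm_mul]
      refine (mul_le_of_le_one_left (norm_nonneg _) (abs_source_le η p)).trans ?_
      by_cases hp : p ∈ S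
      · rw [indicator_of_mem hp]; exact abs_mollify_le n hB p
      · rw [indicator_of_notMem hp, mollify_eq_zero n hR (hout p hp), norm_zero]
    · filter_upwards [ae_tendsto_mollify hli] with p hp using hp.const_mul _
  exact tendsto_nhds_unique (T1.congr hweak) T2

end MullinsSekerka

end

noncomputable section

namespace MullinsSekerka

open MeasureTheory Filter Set
open scoped Topology ContDiff

/-! ### Approximation by compactly supported functions -/

lemma sq_sub_le {v v' : ℝ → ℝ} (hd : ∀ y, HasDerivAt v (v' y) y) (hc : Continuous v')
    (hL : MemLp v' 2) (x y : ℝ) : (v x - v y) ^ 2 ≤ |x - y| * ∫ s, v' s ^ 2 := by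
  wlog h : y ≤ x generalizing x y
  · rw [abs_sub_comm, ← neg_sq, neg_sub]; exact this y x (not_le.1 h).le
  have h1 := intervalIntegral.integral_eq_sub_of_hasDerivAt (a := y) (b := x)
    (fun s _ => hd s) (hc.intervalIntegrable _ _)
  rw [intervalIntegral.integral_of_le h] at h1
  have hone : MemLp (fun _ : ℝ => (1 : ℝ)) 2 (volume.restrict (Ioc y x)) := memLp_const 1
  have h2 := sq_integral_mul_le hone (hL.restrict (Ioc y x))
  simp only [one_mul, one_pow, integral_const, MeasurableSet.univ, measureReal_restrict_apply,
    univ_inter, smul_eq_mul, mul_one, Real.volume_real_Ioc_of_le h] at h2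
  rw [← h1, abs_of_nonneg (sub_nonneg.2 h)]
  refine h2.trans (mul_le_mul_of_nonneg_left ?_ (sub_nonneg.2 h))
  exact setIntegral_le_integral hL.integrable_sq (Eventually.of_forall fun _ => sq_nonneg _)

/-- Poincaré's inequality on a square. -/
lemma exists_integral_square_le {φ : ℝ × ℝ → ℝ} (hφ : ContDiff ℝ 1 φ) (hx : MemLp (dx φ) 2)
    (hz : MemLp (dz φ) 2) {R : ℝ} (hR : 0 < R) :
    ∃ c : ℝ, ∫ p in Icc (-(2 * R)) (2 * R) ×ˢ Icc (-(2 * R)) (2 * R), (φ p - c) ^ 2 ≤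
      32 * R ^ 2 * ∫ p, (dx φ p ^ 2 + dz φ p ^ 2) := by
  set I : Set ℝ := Icc (-(2 * R)) (2 * R) with hI
  have hvol : volume.real I = 4 * R := by
    rw [hI, Real.volume_real_Icc_of_le (by linarith)]; ring
  set A : ℝ := ∫ p, dz φ p ^ 2 with hA
  set m : ℝ → ℝ := fun z => ∫ x, dx φ (x, z) ^ 2 with hm
  have hzi : Integrable fun x => ∫ y, dz φ (x, y) ^ 2 := hz.integrable_sq.integral_prod_left
  have hmi : Integrable m := hx.integrable_sq.integral_prod_right
  have hne : volume.restrict I ≠ 0 := by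
    rw [Ne, Measure.restrict_eq_zero, hI, Real.volume_Icc]; simp; linarith
  have : IsFiniteMeasure (volume.restrict I) := ⟨by rw [hI]; simp⟩
  -- A vertical line `x'` is selected on which the integral of `(∂_z φ)²` does not exceed its
  -- average over `I`. Each point of the square is joined to `(x', 0)`, first horizontally and then
  -- along this line, and `c` is the value at `(x', 0)`.
  obtain ⟨x', hx'N, hx'⟩ := exists_notMem_null_le_average hne hzi.restrict (ae_iff.1
    ((ae_restrict_mem measurableSet_Icc).and (ae_restrict_of_ae (ae_memLp_slice_fst hz))))
  obtain ⟨hx'I, hsl⟩ : x' ∈ I ∧ MemLp (fun y => dz φ (x', y)) 2 := by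
    simpa only [mem_ofPred_eq, not_not] using hx'N
  have hAx : (∫ y, dz φ (x', y) ^ 2) * (4 * R) ≤ A := by
    rw [setAverage_eq, hvol, smul_eq_mul] at hx'
    have h1 : ∫ x in I, ∫ y, dz φ (x, y) ^ 2 ≤ A := by
      rw [hA, Measure.volume_eq_prod, integral_prod _ hz.integrable_sq]
      exact setIntegral_le_integral hzi
        (Eventually.of_forall fun x => integral_nonneg fun _ => sq_nonneg _)
    calc _ ≤ ((4 * R)⁻¹ * ∫ x in I, ∫ y, dz φ (x, y) ^ 2) * (4 * R) := by gcongr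
      _ = ∫ x in I, ∫ y, dz φ (x, y) ^ 2 := by field_simp
      _ ≤ A := h1
  set c := φ (x', 0) with hc
  refine ⟨c, ?_⟩
  have hdx : ∀ z x, HasDerivAt (fun x => φ (x, z)) (dx φ (x, z)) x := fun z x =>
    hasDerivAt_dx (q := (x, z)) (hφ.differentiable one_ne_zero _)
  have hdz : ∀ x z, HasDerivAt (fun z => φ (x, z)) (dz φ (x, z)) z := fun x z =>
    hasDerivAt_dz (q := (x, z)) (hφ.differentiable one_ne_zero _)
  have hle : ∀ᵐ p : ℝ × ℝ, p ∈ I ×ˢ I → (φ p - c) ^ 2 ≤ 8 * R * m p.2 + A := by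
    filter_upwards [ae_snd (ae_memLp_slice_snd hx)] with p hp hpI
    have h1 := sq_sub_le (hdx p.2) ((continuous_dx hφ).comp (by fun_prop)) hp p.1 x'
    have h2 := sq_sub_le (hdz x') ((continuous_dz hφ).comp (by fun_prop)) hsl p.2 0
    have b1 : |p.1 - x'| ≤ 4 * R := abs_le.2 ⟨by linarith [hpI.1.1, hx'I.2], by linarith [hpI.1.2, hx'I.1]⟩
    have b2 : |p.2 - 0| ≤ 2 * R := by rw [sub_zero]; exact abs_le.2 ⟨by linarith [hpI.2.1], hpI.2.2⟩
    have m0 : 0 ≤ m p.2 := integral_nonneg fun _ => sq_nonneg _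
    have m1 : 0 ≤ ∫ y, dz φ (x', y) ^ 2 := integral_nonneg fun _ => sq_nonneg _
    have h1' : (φ p - φ (x', p.2)) ^ 2 ≤ 4 * R * m p.2 := h1.trans (mul_le_mul_of_nonneg_right b1 m0)
    have h2' : (φ (x', p.2) - c) ^ 2 ≤ 2 * R * ∫ y, dz φ (x', y) ^ 2 :=
      h2.trans (mul_le_mul_of_nonneg_right b2 m1)
    nlinarith [sq_nonneg ((φ p - φ (x', p.2)) - (φ (x', p.2) - c))]
  have hQ : MeasurableSet (I ×ˢ I) := measurableSet_Icc.prod measurableSet_Icc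
  set ι : ℝ → ℝ := I.indicator fun _ => (1 : ℝ) with hι
  set γ : ℝ → ℝ := I.indicator fun z => 8 * R * m z + A with hγ
  have hιi : Integrable ι := (integrable_indicator_iff measurableSet_Icc).2 (by simp)
  have hAi : IntegrableOn (fun _ : ℝ => A) I := integrable_const A
  have hγi : Integrable γ := (integrable_indicator_iff measurableSet_Icc).2
    ((hmi.const_mul _).integrableOn.add hAi)
  have hpi : Integrable fun p : ℝ × ℝ => ι p.1 * γ p.2 := hιi.mul_prod hγi
  have hfi : IntegrableOn (fun p => (φ p - c) ^ 2) (I ×ˢ I) :=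
    ContinuousOn.integrableOn_compact (isCompact_Icc.prod isCompact_Icc)
      (Continuous.continuousOn (by have := hφ.continuous; fun_prop))
  rw [← integral_indicator hQ]
  have hD : ∫ p, (dx φ p ^ 2 + dz φ p ^ 2) = (∫ z, m z) + A := by
    rw [integral_add hx.integrable_sq hz.integrable_sq]
    congr 1
    exact integral_prod_symm _ hx.integrable_sq
  have h0 : ∫ p, (I ×ˢ I).indicator (fun p => (φ p - c) ^ 2) p ≤ ∫ p : ℝ × ℝ, ι p.1 * γ p.2 := by
    refine integral_mono_ae ((integrable_indicator_iff hQ).2 hfi) hpi ?_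
    filter_upwards [hle] with p hp
    by_cases hpI : p ∈ I ×ˢ I
    · rw [indicator_of_mem hpI, hι, hγ, indicator_of_mem hpI.1, indicator_of_mem hpI.2, one_mul]
      exact hp hpI
    · rw [indicator_of_notMem hpI]
      have : ι p.1 * γ p.2 = 0 := by
        by_cases h1 : p.1 ∈ I
        · have h2 : p.2 ∉ I := fun h2 => hpI ⟨h1, h2⟩
          rw [hγ, indicator_of_notMem h2, mul_zero]
        · rw [hι, indicator_of_notMem h1, zero_mul]
      exact this.ge
  refine h0.trans ?_
  have h1 : ∫ p : ℝ × ℝ, ι p.1 * γ p.2 = (∫ x, ι x) * ∫ z, γ z := integral_prod_mul ι γ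
  have h2 : ∫ x, ι x = 4 * R := by
    rw [hι, integral_indicator measurableSet_Icc, setIntegral_const, hvol, smul_eq_mul, mul_one]
  have h3 : ∫ z, γ z ≤ 8 * R * (∫ z, m z) + 4 * R * A := by
    rw [hγ, integral_indicator measurableSet_Icc, integral_add (hmi.const_mul _).integrableOn hAi,
      integral_const_mul, setIntegral_const, hvol, smul_eq_mul]
    have := setIntegral_le_integral (s := I) hmi
      (Eventually.of_forall fun z => integral_nonneg fun x => sq_nonneg (dx φ (x, z)))
    have := mul_le_mul_of_nonneg_left this (by positivity : 0 ≤ 8 * R)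
    linarith
  rw [h1, h2, hD]
  have hm0 : 0 ≤ ∫ z, m z := integral_nonneg fun z => integral_nonneg fun x => sq_nonneg _
  have hA0 : 0 ≤ A := integral_nonneg fun z => sq_nonneg _
  have := mul_le_mul_of_nonneg_left h3 (by positivity : 0 ≤ 4 * R)
  nlinarith [mul_nonneg (sq_nonneg R) hA0]

lemma IsCutoffError.integral_sq_mul_le {M : ℝ} {e : ℕ → ℝ × ℝ → ℝ} (he : IsCutoffError M e)
    {w : ℝ × ℝ → ℝ} (hw : Continuous w) (n : ℕ) (hec : Continuous (e n)) :
    MemLp (fun p => w p * e n p) 2 ∧ ∫ p, (w p * e n p) ^ 2 ≤ (M / (n + 1)) ^ 2 *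
      ∫ p in Icc (-(2 * ((n : ℝ) + 1))) (2 * ((n : ℝ) + 1)) ×ˢ
        Icc (-(2 * ((n : ℝ) + 1))) (2 * ((n : ℝ) + 1)), w p ^ 2 := by
  set Q : Set (ℝ × ℝ) := Icc (-(2 * ((n : ℝ) + 1))) (2 * ((n : ℝ) + 1)) ×ˢ
        Icc (-(2 * ((n : ℝ) + 1))) (2 * ((n : ℝ) + 1)) with hQ
  have hQc : IsCompact Q := isCompact_Icc.prod isCompact_Icc
  have hQm : MeasurableSet Q := measurableSet_Icc.prod measurableSet_Icc
  have hz : ∀ p, p ∉ Q → e n p = 0 := fun p hp => by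
    apply he.support
    by_contra! h
    exact hp ⟨abs_le.1 h.1.le, abs_le.1 h.2.le⟩
  have hc : HasCompactSupport fun p => w p * e n p := by
    refine HasCompactSupport.of_support_subset_isCompact hQc fun p hp => ?_
    by_contra h
    exact hp (by simp [hz p h])
  refine ⟨(hw.mul hec).memLp_of_hasCompactSupport hc, ?_⟩
  rw [← integral_const_mul, ← integral_indicator hQm]
  have hi : IntegrableOn (fun p => (M / ((n : ℝ) + 1)) ^ 2 * w p ^ 2) Q :=
    ContinuousOn.integrableOn_compact hQc (Continuous.continuousOn (by fun_prop))
  refine integral_mono_of_nonneg (Eventually.of_forall fun _ => sq_nonneg _)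
    ((integrable_indicator_iff hQm).2 hi) (Eventually.of_forall fun p => ?_)
  by_cases hp : p ∈ Q
  · simp only [indicator_of_mem hp]
    rw [mul_pow, mul_comm]
    exact mul_le_mul_of_nonneg_right (sq_le_sq.2 ((he.bound n p).trans (le_abs_self _))) (sq_nonneg _)
  · simp only [indicator_of_notMem hp, hz p hp]; simp

/-- Gradients of `C¹` functions with finite Dirichlet integral are weak limits of gradients of
compactly supported functions. -/
theorem exists_compact_approximation : ∃ C : ℝ, 0 ≤ C ∧ ∀ φ : ℝ × ℝ → ℝ, ContDiff ℝ 1 φ →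
    MemLp (dx φ) 2 → MemLp (dz φ) 2 → ∃ ψ : ℕ → ℝ × ℝ → ℝ, (∀ n, ContDiff ℝ 1 (ψ n)) ∧
      (∀ n, HasCompactSupport (ψ n)) ∧
      (∀ n, ∫ p, (dx (ψ n) p ^ 2 + dz (ψ n) p ^ 2) ≤ C * ∫ p, (dx φ p ^ 2 + dz φ p ^ 2)) ∧
      ∀ X Z : ℝ × ℝ → ℝ, MemLp X 2 → MemLp Z 2 →
        Tendsto (fun n => ∫ p, (X p * dx (ψ n) p + Z p * dz (ψ n) p)) atTop
          (𝓝 (∫ p, (X p * dx φ p + Z p * dz φ p))) := by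
  obtain ⟨M, hM0, ex, ez⟩ := exists_isCutoffError
  refine ⟨2 + 128 * M ^ 2, by positivity, fun φ hφ hx hz => ?_⟩
  have hR : ∀ n : ℕ, (0 : ℝ) < n + 1 := fun n => by positivity
  choose c hc using fun n : ℕ => exists_integral_square_le hφ hx hz (hR n)
  set D := ∫ p, (dx φ p ^ 2 + dz φ p ^ 2) with hD
  have hχ : ∀ n, ContDiff ℝ 1 (cutoff n) := fun n => (contDiff_cutoff n).of_le (by simp)
  have hw : ∀ n, ContDiff ℝ 1 fun p => φ p - c n := fun n => hφ.sub contDiff_const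
  have hdx : ∀ n p, dx (fun p => cutoff n p * (φ p - c n)) p =
      cutoff n p * dx φ p + (φ p - c n) * dx (cutoff n) p := fun n p => by
    rw [dx_mul ((hχ n).differentiable one_ne_zero p) ((hw n).differentiable one_ne_zero p)]
    simp only [dx, fderiv_sub_const]
  have hdz : ∀ n p, dz (fun p => cutoff n p * (φ p - c n)) p =
      cutoff n p * dz φ p + (φ p - c n) * dz (cutoff n) p := fun n p => by
    rw [dz_mul ((hχ n).differentiable one_ne_zero p) ((hw n).differentiable one_ne_zero p)]
    simp only [dz, fderiv_sub_const]
  -- The factor `R²` from Poincaré's inequality on a square of size `R = n + 1` cancels the `R⁻²` of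
  -- the squared gradient of the cutoff. The errors are therefore bounded in L², and they tend to
  -- zero weakly since they vanish eventually at each point.
  have scale : ∀ n : ℕ, (M / ((n : ℝ) + 1)) ^ 2 * (32 * ((n : ℝ) + 1) ^ 2 * D) = 32 * M ^ 2 * D :=
    fun n => by have := (hR n).ne'; field_simp
  have Ex : ∀ n, MemLp (fun p => (φ p - c n) * dx (cutoff n) p) 2 ∧
      ∫ p, ((φ p - c n) * dx (cutoff n) p) ^ 2 ≤ 32 * M ^ 2 * D := fun n => by
    obtain ⟨h1, h2⟩ := ex.integral_sq_mul_le (hw n).continuous n (continuous_dx (hχ n))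
    exact ⟨h1, h2.trans (scale n ▸ mul_le_mul_of_nonneg_left (hc n) (sq_nonneg _))⟩
  have Ez : ∀ n, MemLp (fun p => (φ p - c n) * dz (cutoff n) p) 2 ∧
      ∫ p, ((φ p - c n) * dz (cutoff n) p) ^ 2 ≤ 32 * M ^ 2 * D := fun n => by
    obtain ⟨h1, h2⟩ := ez.integral_sq_mul_le (hw n).continuous n (continuous_dz (hχ n))
    exact ⟨h1, h2.trans (scale n ▸ mul_le_mul_of_nonneg_left (hc n) (sq_nonneg _))⟩
  have hχL : ∀ n {v : ℝ × ℝ → ℝ}, MemLp v 2 → MemLp (fun p => cutoff n p * v p) 2 := fun n v hv =>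
    memLp_bounded_mul (A := 1) (hχ n).continuous.aestronglyMeasurable (fun p => by
      rw [abs_of_nonneg (cutoff_mem_Icc n p).1]; exact (cutoff_mem_Icc n p).2) hv
  refine ⟨fun n p => cutoff n p * (φ p - c n), fun n => (hχ n).mul (hw n), fun n =>
    (hasCompactSupport_cutoff n).mul_right, fun n => ?_, fun X Z hX hZ => ?_⟩
  · have hsq : ∀ a b s : ℝ, 0 ≤ a → a ≤ 1 → (a * b + s) ^ 2 ≤ 2 * b ^ 2 + 2 * s ^ 2 := by
      intro a b s h0 h1
      have : (a * b) ^ 2 ≤ b ^ 2 := by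
        rw [mul_pow]; exact mul_le_of_le_one_left (sq_nonneg _) (by nlinarith)
      nlinarith [sq_nonneg (a * b - s)]
    have i1 : Integrable fun p => dx φ p ^ 2 + dz φ p ^ 2 := hx.integrable_sq.add hz.integrable_sq
    have i2 : Integrable fun p => ((φ p - c n) * dx (cutoff n) p) ^ 2 +
      ((φ p - c n) * dz (cutoff n) p) ^ 2 := (Ex n).1.integrable_sq.add (Ez n).1.integrable_sq
    have h1 : ∫ p, (dx (fun p => cutoff n p * (φ p - c n)) p ^ 2 +
        dz (fun p => cutoff n p * (φ p - c n)) p ^ 2) ≤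
        ∫ p, (2 * (dx φ p ^ 2 + dz φ p ^ 2) + 2 * (((φ p - c n) * dx (cutoff n) p) ^ 2 +
          ((φ p - c n) * dz (cutoff n) p) ^ 2)) := by
      refine integral_mono_of_nonneg (Eventually.of_forall fun p => by positivity)
        ((i1.const_mul 2).add (i2.const_mul 2)) (Eventually.of_forall fun p => ?_)
      have hcut := cutoff_mem_Icc n p
      have a1 := hsq _ (dx φ p) ((φ p - c n) * dx (cutoff n) p) hcut.1 hcut.2
      have a2 := hsq _ (dz φ p) ((φ p - c n) * dz (cutoff n) p) hcut.1 hcut.2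
      simp only [hdx, hdz]
      linarith
    rw [integral_add (i1.const_mul 2) (i2.const_mul 2), integral_const_mul, integral_const_mul,
      integral_add (Ex n).1.integrable_sq (Ez n).1.integrable_sq] at h1
    linarith [(Ex n).2, (Ez n).2]
  · have iX : Integrable fun p => X p * dx φ p := integrable_mul_of_memLp hX hx
    have iZ : Integrable fun p => Z p * dz φ p := integrable_mul_of_memLp hZ hz
    have iXZ : Integrable fun p => X p * dx φ p + Z p * dz φ p := iX.add iZ
    have T1 := tendsto_integral_cutoff_mul iXZ
    have T2 := tendsto_integral_mul_of_eventually_zero hX (fun n => (Ex n).1) (fun n => (Ex n).2)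
      (Eventually.of_forall fun p => by
        filter_upwards [ex.eventually_zero p] with n hn; simp [hn])
    have T3 := tendsto_integral_mul_of_eventually_zero hZ (fun n => (Ez n).1) (fun n => (Ez n).2)
      (Eventually.of_forall fun p => by
        filter_upwards [ez.eventually_zero p] with n hn; simp [hn])
    have T := (T1.add T2).add T3
    rw [add_zero, add_zero] at T
    refine T.congr fun n => ?_
    have j0 : Integrable fun p => cutoff n p * (X p * dx φ p + Z p * dz φ p) := by
      refine ((integrable_mul_of_memLp hX (hχL n hx)).add
        (integrable_mul_of_memLp hZ (hχL n hz))).congr (Eventually.of_forall fun p => ?_)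
      simp only [Pi.add_apply]; ring
    have j1 := integrable_mul_of_memLp (Ex n).1 hX
    have j2 := integrable_mul_of_memLp (Ez n).1 hZ
    have j01 : Integrable fun p => cutoff n p * (X p * dx φ p + Z p * dz φ p) +
      (φ p - c n) * dx (cutoff n) p * X p := j0.add j1
    rw [← integral_add j0 j1, ← integral_add j01 j2]
    congr 1; ext p
    rw [hdx, hdz]; ring

end MullinsSekerka

end

noncomputable section

namespace MullinsSekerka

open MeasureTheory Filter Set
open scoped Topology ContDiff

/-! ### The source of the potential -/

/-- Between the axis and the graph the source is `-1` where `η > 0` and `+1` where `η < 0`; the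
oriented integral treats both signs at once. -/
lemma source_mul_eq (η : ℝ → ℝ) (v : ℝ × ℝ → ℝ) (x : ℝ) :
    ∫ z, source η (x, z) * v (x, z) = -∫ z in (0 : ℝ)..η x, v (x, z) := by
  rcases le_total 0 (η x) with h | h
  · rw [intervalIntegral.integral_of_le h, ← integral_indicator measurableSet_Ioc, ← integral_neg]
    congr 1; ext z
    simp only [source, upperPhase, indicator, mem_ofPred_eq, mem_Ioc, ← not_lt]
    by_cases h1 : η x < z <;> by_cases h2 : 0 < z <;> simp [h1, h2]
    linarith
  · rw [intervalIntegral.integral_of_ge h, neg_neg, ← integral_indicator measurableSet_Ioc]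
    congr 1; ext z
    simp only [source, upperPhase, indicator, mem_ofPred_eq, mem_Ioc, ← not_lt]
    by_cases h1 : η x < z <;> by_cases h2 : 0 < z <;> simp [h1, h2]
    linarith

lemma integral_source_mul {η : ℝ → ℝ} (hη : Measurable η) {v : ℝ × ℝ → ℝ} (hv : Continuous v)
    (hc : HasCompactSupport v) :
    ∫ p, source η p * v p = -∫ x, ∫ z in (0 : ℝ)..η x, v (x, z) := by
  have hi : Integrable fun p => source η p * v p :=
    (hv.integrable_of_hasCompactSupport hc).bdd_mul (c := 1)
      (measurable_source hη).aestronglyMeasurable (Eventually.of_forall fun p => abs_source_le η p)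
  rw [Measure.volume_eq_prod] at hi ⊢
  rw [integral_prod _ hi, ← integral_neg]
  congr 1; ext x
  exact source_mul_eq η v x

lemma IsPotential.weak_compact {η : ℝ → ℝ} {φ : ℝ × ℝ → ℝ} (hφ : IsPotential η φ)
    (hη : Measurable η) {ψ : ℝ × ℝ → ℝ} (hψ : ContDiff ℝ 1 ψ) (hc : HasCompactSupport ψ) :
    ∫ p, (dx φ p * dx ψ p + dz φ p * dz ψ p) = ∫ p, source η p * ψ p := by
  obtain ⟨C, hC⟩ := hψ.lipschitzWith_of_hasCompactSupport hc one_ne_zero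
  exact hφ.weak_lipschitz hη hC hc

lemma IsPotential.memLp_dx {η : ℝ → ℝ} {φ : ℝ × ℝ → ℝ} (hφ : IsPotential η φ) : MemLp (dx φ) 2 := by
  have hm := (continuous_dx hφ.contDiff).aestronglyMeasurable (μ := volume)
  refine memLp_two_of_sq hm (hφ.integrable.mono' (hm.pow 2) (Eventually.of_forall fun p => ?_))
  rw [Real.norm_of_nonneg (sq_nonneg _)]
  linarith [sq_nonneg (dz φ p)]

lemma IsPotential.memLp_dz {η : ℝ → ℝ} {φ : ℝ × ℝ → ℝ} (hφ : IsPotential η φ) : MemLp (dz φ) 2 := by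
  have hm := (continuous_dz hφ.contDiff).aestronglyMeasurable (μ := volume)
  refine memLp_two_of_sq hm (hφ.integrable.mono' (hm.pow 2) (Eventually.of_forall fun p => ?_))
  rw [Real.norm_of_nonneg (sq_nonneg _)]
  linarith [sq_nonneg (dx φ p)]

lemma dx_comp_shift {η : ℝ → ℝ} (hη : ContDiff ℝ ∞ η) {ψ : ℝ × ℝ → ℝ} {z : ℝ × ℝ}
    (hψ : DifferentiableAt ℝ ψ (shift η z)) : dx (fun z => ψ (shift η z)) z =
      dx ψ (shift η z) + deriv η z.1 * dz ψ (shift η z) := by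
  have cs : ContDiff ℝ 1 (shift η) := by
    have : ContDiff ℝ 1 η := hη.of_le (by simp)
    unfold shift; fun_prop
  have h1 := hasDerivAt_dx (hψ.comp z (cs.differentiable one_ne_zero z))
  have h2 : HasFDerivAt ψ (fderiv ℝ ψ (shift η z)) (shift η (z.1, z.2)) := hψ.hasFDerivAt
  have h3 : HasDerivAt (fun x => shift η (x, z.2)) (1, deriv η z.1) z.1 :=
    (hasDerivAt_id z.1).prodMk ((hasDerivAt_of_contDiff hη z.1).add_const z.2)
  refine (h1.unique (h2.comp_hasDerivAt z.1 h3)).trans ?_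
  have : ((1, deriv η z.1) : ℝ × ℝ) = (1, 0) + deriv η z.1 • (0, 1) := by simp
  rw [this, map_add, map_smul]; rfl

lemma dz_comp_shift {η : ℝ → ℝ} (hη : ContDiff ℝ ∞ η) {ψ : ℝ × ℝ → ℝ} {z : ℝ × ℝ}
    (hψ : DifferentiableAt ℝ ψ (shift η z)) : dz (fun z => ψ (shift η z)) z = dz ψ (shift η z) := by
  have cs : ContDiff ℝ 1 (shift η) := by
    have : ContDiff ℝ 1 η := hη.of_le (by simp)
    unfold shift; fun_prop
  have h1 := hasDerivAt_dz (hψ.comp z (cs.differentiable one_ne_zero z))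
  have h2 : HasFDerivAt ψ (fderiv ℝ ψ (shift η z)) (shift η (z.1, z.2)) := hψ.hasFDerivAt
  have h3 : HasDerivAt (fun y => shift η (z.1, y)) (0, 1) z.2 :=
    (hasDerivAt_const z.2 z.1).prodMk ((hasDerivAt_id z.2).const_add (η z.1))
  exact h1.unique (h2.comp_hasDerivAt z.2 h3)

/-! ### Motion of the source and the weak form in the original coordinates -/

section Motion

variable {J : Set ℝ} {h : ℝ → ℝ → ℝ} {f : ℝ → ℝ × ℝ → ℝ} {F : Bool → ℝ × (ℝ × ℝ) → ℝ}

/-- The change of the source is a measure on the interface. -/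
lemma hasDerivAt_integral_source (hh : RegularHeight J h) (hJ : IsOpen J) {t : ℝ} (ht : t ∈ J)
    {ψ : ℝ × ℝ → ℝ} (hψ : Continuous ψ) (hc : HasCompactSupport ψ) :
    HasDerivAt (fun s => ∫ p, source (h s) p * ψ p) (-∫ x, ψ (x, h t x) * heightRate h t x) t := by
  have hl := hh.smooth_lift
  obtain ⟨R, hR⟩ := exists_zero_of_hasCompactSupport hc
  obtain ⟨B, hB⟩ := hc.exists_bound_of_continuous hψ
  have hB0 : 0 ≤ B := (norm_nonneg _).trans (hB 0)
  obtain ⟨K, hK, hk⟩ := hh.dominated ht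
  obtain ⟨ε, hε, hball⟩ := Metric.eventually_nhds_iff_ball.1 (hk.and (hJ.mem_nhds ht))
  have ch : ∀ s ∈ J, Continuous (h s) := fun s hs => (contDiff_height hJ hl hs).continuous
  have hz : ∀ x z : ℝ, R ≤ |x| → ψ (x, z) = 0 := fun x z hx => hR _ (hx.trans (le_max_left |x| |z|))
  have cF : ∀ s ∈ J, Continuous fun x => ∫ z in (0 : ℝ)..h s x, ψ (x, z) := fun s hs =>
    intervalIntegral.continuous_parametric_intervalIntegral_of_continuous (f := fun x z => ψ (x, z))
      hψ (ch s hs)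
  -- By Fubini the source tested with `ψ` is minus the integral of `∫₀^h ψ dz`, and only the upper
  -- limit depends on time.
  have key := hasDerivAt_integral_of_dominated_loc_of_deriv_le (μ := volume) (x₀ := t)
    (F := fun s x => ∫ z in (0 : ℝ)..h s x, ψ (x, z)) (F' := fun s x => ψ (x, h s x) * heightRate h s x)
    (bound := fun x => (Icc (-R) R).indicator (fun _ => B) x * K x) (Metric.ball_mem_nhds t hε)
    ?_ ?_ ?_ ?_ ?_ ?_
  · refine key.2.neg.congr_of_eventuallyEq ?_
    filter_upwards [hJ.mem_nhds ht] with s hs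
    exact integral_source_mul (ch s hs).measurable hψ hc
  · filter_upwards [hJ.mem_nhds ht] with s hs using (cF s hs).aestronglyMeasurable
  · refine (cF t ht).integrable_of_hasCompactSupport
      (HasCompactSupport.of_support_subset_isCompact (isCompact_Icc (a := -R) (b := R)) fun x hx => ?_)
    by_contra hcon
    refine hx ?_
    have : R ≤ |x| := by
      by_contra! h2
      exact hcon (abs_le.1 h2.le)
    simp [hz x _ this]
  · exact ((hψ.comp (by have := ch t ht; fun_prop)).mul
      (contDiff_heightRate hJ hl ht).continuous).aestronglyMeasurable
  · refine Eventually.of_forall fun x s hs => ?_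
    have hb := ((hball s hs).1 x).2.2.2.1
    rw [norm_mul]
    by_cases hx : x ∈ Icc (-R) R
    · rw [indicator_of_mem hx]
      exact mul_le_mul (hB _) hb (norm_nonneg _) hB0
    · rw [indicator_of_notMem hx, zero_mul, hz x _ (by
        by_contra! h2
        exact hx (abs_le.1 h2.le))]
      simp
  · have : MemLp ((Icc (-R) R).indicator fun _ : ℝ => B) 2 :=
      memLp_indicator_const 2 measurableSet_Icc B (Or.inr (by simp))
    exact integrable_mul_of_memLp this hK
  · refine Eventually.of_forall fun x s hs => ?_
    have hsJ := (hball s hs).2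
    have cx : Continuous fun z => ψ (x, z) := hψ.comp (by fun_prop)
    have d1 := intervalIntegral.integral_hasDerivAt_right (cx.intervalIntegrable 0 (h s x))
      (cx.stronglyMeasurableAtFilter _ _) cx.continuousAt
    have d2 := hasDerivAt_height_time hJ hl hsJ x 0
    rw [← heightRate_eq hJ hl hsJ] at d2
    exact d1.comp s d2

lemma memLp_comp_shift {η : ℝ → ℝ} (hη : Continuous η) {v : ℝ × ℝ → ℝ} :
    MemLp (fun z => v (shift η z)) 2 ↔ MemLp v 2 := by
  have := (measurableEmbedding_shift hη).memLp_map_measure_iff (μ := volume) (g := v) (p := 2)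
  rw [(measurePreserving_shift hη).map_eq] at this
  exact this.symm

lemma IsExtension.memLp_grad (hS : IsSolution J h f) (hJ : IsOpen J) (hF : IsExtension J h f F) {t : ℝ}
    (ht : t ∈ J) : MemLp (dx (f t)) 2 ∧ MemLp (dz (f t)) 2 := by
  have hl := hS.regular_height.smooth_lift
  have S := hS.flatSolution hJ hF ht
  have ch := (contDiff_height hJ hl ht).continuous
  constructor
  · rw [← memLp_comp_shift ch]
    refine S.memLp_p.ae_eq ?_
    filter_upwards [ae_snd_ne 0] with z hz
    exact hF.flatP_eq hJ hl ht (sgn_decide_mul_pos hz)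
  · rw [← memLp_comp_shift ch]
    refine S.memLp_q.ae_eq ?_
    filter_upwards [ae_snd_ne 0] with z hz
    exact hF.flatQ_eq hJ hl ht (sgn_decide_mul_pos hz)

/-- The weak form of the Mullins-Sekerka problem. -/
lemma IsExtension.weak_form (hS : IsSolution J h f) (hJ : IsOpen J) (hF : IsExtension J h f F) {t : ℝ}
    (ht : t ∈ J) {ψ : ℝ × ℝ → ℝ} (hψ : ContDiff ℝ 1 ψ) (hc : HasCompactSupport ψ) :
    ∫ p, (dx (f t) p * dx ψ p + dz (f t) p * dz ψ p) = ∫ x, ψ (x, h t x) * heightRate h t x := by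
  have hl := hS.regular_height.smooth_lift
  have S := hS.flatSolution hJ hF ht
  have ch := contDiff_height hJ hl ht
  have cs : ContDiff ℝ 1 (shift (h t)) := by
    have : ContDiff ℝ 1 (h t) := ch.of_le (by simp)
    unfold shift; fun_prop
  have hΨ : ContDiff ℝ 1 fun z => ψ (shift (h t) z) := hψ.comp cs
  have hΨc : HasCompactSupport fun z => ψ (shift (h t) z) :=
    hc.comp_homeomorph (shiftHomeomorph ch.continuous)
  have ex := fun z => dx_comp_shift ch (hψ.differentiable one_ne_zero (shift (h t) z))
  have ez := fun z => dz_comp_shift ch (hψ.differentiable one_ne_zero (shift (h t) z))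
  have key := S.weak_form (Ψ := fun _ z => ψ (shift (h t) z)) (ψ₀ := fun x => ψ (x, h t x))
    (fun _ => hΨ) (fun i x => by simp [shift]) ?_ ?_ ?_
  · rw [← key, ← integral_comp_shift ch.continuous]
    apply integral_congr_ae
    filter_upwards [ae_snd_ne 0] with z hz
    have hs := sgn_decide_mul_pos hz
    have q1 := hF.flatP_eq hJ hl ht hs
    have q2 := hF.flatQ_eq hJ hl ht hs
    simp only [glue, ex, ez, q1, q2]
    ring
  · have e : (fun x => ψ (x, h t x)) = fun x => (fun z => ψ (shift (h t) z)) (x, 0) := by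
      ext x; simp [shift]
    rw [e]
    exact (hΨ.continuous.comp (by fun_prop : Continuous fun x : ℝ => (x, (0 : ℝ)))).memLp_of_hasCompactSupport
      (hasCompactSupport_slice_snd hΨc 0)
  · exact (continuous_dx hΨ).memLp_of_hasCompactSupport (hasCompactSupport_dx hΨc)
  · exact (continuous_dz hΨ).memLp_of_hasCompactSupport (hasCompactSupport_dz hΨc)

end Motion

/-! ### Strong convergence -/

/-- Pointwise convergence together with convergence of the norms. -/
lemma tendsto_integral_sq_sub {X : Type*} [MeasureSpace X] {a b : ℕ → X → ℝ} {a' b' : X → ℝ}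
    (ha : ∀ n, MemLp (a n) 2) (hb : ∀ n, MemLp (b n) 2) (ha' : MemLp a' 2) (hb' : MemLp b' 2)
    (la : ∀ᵐ x, Tendsto (fun n => a n x) atTop (𝓝 (a' x)))
    (lb : ∀ᵐ x, Tendsto (fun n => b n x) atTop (𝓝 (b' x)))
    (hl : Tendsto (fun n => ∫ x, (a n x ^ 2 + b n x ^ 2)) atTop (𝓝 (∫ x, (a' x ^ 2 + b' x ^ 2)))) :
    Tendsto (fun n => ∫ x, ((a n x - a' x) ^ 2 + (b n x - b' x) ^ 2)) atTop (𝓝 0) := by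
  set A : ℕ → ℝ := fun n => ∫ x, (a n x ^ 2 + b n x ^ 2) with hA
  set A' : ℝ := ∫ x, (a' x ^ 2 + b' x ^ 2) with hA'
  set B : ℕ → ℝ := fun n => ∫ x, ((a n x - a' x) ^ 2 + (b n x - b' x) ^ 2) with hB
  -- Fatou's lemma is applied to `G n`, which converges pointwise to `4 (a'² + b'²)`. By the
  -- parallelogram law its integral is `2 A n + 2 A' - B n`, and since `A n → A'` this forces `B n →
  -- 0`.
  set G : ℕ → X → ℝ := fun n x => (a n x + a' x) ^ 2 + (b n x + b' x) ^ 2 with hG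
  have hGi : ∀ n, Integrable (G n) := fun n =>
    ((ha n).add ha').integrable_sq.add ((hb n).add hb').integrable_sq
  have hG0 : ∀ n x, 0 ≤ G n x := fun n x => by simp only [hG]; positivity
  have i1 : ∀ n, Integrable fun x => a n x ^ 2 + b n x ^ 2 := fun n =>
    (ha n).integrable_sq.add (hb n).integrable_sq
  have i2 : Integrable fun x => a' x ^ 2 + b' x ^ 2 := ha'.integrable_sq.add hb'.integrable_sq
  have i3 : ∀ n, Integrable fun x => (a n x - a' x) ^ 2 + (b n x - b' x) ^ 2 := fun n =>
    ((ha n).sub ha').integrable_sq.add ((hb n).sub hb').integrable_sq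
  have hGint : ∀ n, ∫ x, G n x = 2 * A n + 2 * A' - B n := fun n => by
    have i12 : Integrable fun x => 2 * (a n x ^ 2 + b n x ^ 2) + 2 * (a' x ^ 2 + b' x ^ 2) :=
      ((i1 n).const_mul 2).add (i2.const_mul 2)
    rw [hA, hA', hB, ← integral_const_mul, ← integral_const_mul,
      ← integral_add ((i1 n).const_mul 2) (i2.const_mul 2), ← integral_sub i12 (i3 n)]
    congr 1; ext x; simp only [hG]; ring
  have fatou : ENNReal.ofReal (4 * A') ≤ liminf (fun n => ENNReal.ofReal (2 * A n + 2 * A' - B n)) atTop := by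
    have h1 := lintegral_liminf_le' (μ := volume) (u := atTop) (f := fun n x => ENNReal.ofReal (G n x))
      fun n => (hGi n).1.aemeasurable.ennreal_ofReal
    have h2 : ∫⁻ x, liminf (fun n => ENNReal.ofReal (G n x)) atTop = ENNReal.ofReal (4 * A') := by
      rw [hA', ← integral_const_mul, ofReal_integral_eq_lintegral_ofReal (i2.const_mul 4)
        (Eventually.of_forall fun x => by positivity)]
      apply lintegral_congr_ae
      filter_upwards [la, lb] with x h1 h2
      refine (Tendsto.liminf_eq ?_)
      refine (ENNReal.continuous_ofReal.tendsto _).comp ?_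
      have h3 := ((h1.add_const (a' x)).pow 2).add ((h2.add_const (b' x)).pow 2)
      convert h3 using 2
      ring
    rw [h2] at h1
    refine h1.trans (le_of_eq ?_)
    congr 1; ext n
    rw [← hGint, ofReal_integral_eq_lintegral_ofReal (hGi n) (Eventually.of_forall (hG0 n))]
  have hA'0 : 0 ≤ A' := integral_nonneg fun x => by positivity
  have hB0 : ∀ n, 0 ≤ B n := fun n => integral_nonneg fun x => by positivity
  rw [Metric.tendsto_atTop']
  intro ε hε
  have e1 : ∀ᶠ n in atTop, 4 * A' - ε / 2 < 2 * A n + 2 * A' - B n := by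
    rcases lt_or_ge (4 * A' - ε / 2) 0 with h0 | h0
    · refine Eventually.of_forall fun n => h0.trans_le ?_
      rw [← hGint]; exact integral_nonneg (hG0 n)
    · have hlt : ENNReal.ofReal (4 * A' - ε / 2) < ENNReal.ofReal (4 * A') :=
        (ENNReal.ofReal_lt_ofReal_iff_of_nonneg h0).2 (by linarith)
      filter_upwards [eventually_lt_of_lt_liminf (hlt.trans_le fatou)] with n hn
      exact (ENNReal.ofReal_lt_ofReal_iff_of_nonneg h0).1 hn
  have e2 : ∀ᶠ n in atTop, A n < A' + ε / 4 := hl.eventually (gt_mem_nhds (by linarith))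
  obtain ⟨N, hN⟩ := eventually_atTop.1 (e1.and e2)
  refine ⟨N, fun n hn => ?_⟩
  obtain ⟨h1, h2⟩ := hN n hn.le
  rw [Real.dist_eq, sub_zero, abs_of_nonneg (hB0 n)]
  linarith

/-- The Cauchy-Schwarz inequality for fields. -/
lemma abs_integral_add_le {X : Type*} [MeasureSpace X] {a b c d : X → ℝ} (ha : MemLp a 2)
    (hb : MemLp b 2) (hc : MemLp c 2) (hd : MemLp d 2) :
    |∫ x, (a x * c x + b x * d x)| ≤
      √(∫ x, (a x ^ 2 + b x ^ 2)) * √(∫ x, (c x ^ 2 + d x ^ 2)) := by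
  rw [integral_add (integrable_mul_of_memLp ha hc) (integrable_mul_of_memLp hb hd),
    integral_add ha.integrable_sq hb.integrable_sq, integral_add hc.integrable_sq hd.integrable_sq,
    ← l2norm_sq, ← l2norm_sq, ← l2norm_sq, ← l2norm_sq, ← Real.sqrt_mul (by positivity)]
  refine (abs_add_le _ _).trans ?_
  refine (add_le_add (abs_integral_mul_le ha hc) (abs_integral_mul_le hb hd)).trans ?_
  apply Real.le_sqrt_of_sq_le
  nlinarith [sq_nonneg (l2norm a * l2norm d - l2norm b * l2norm c)]

end MullinsSekerka

end

/-! ### Differentiability of the squared distance -/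

noncomputable section

namespace MullinsSekerka

open MeasureTheory Filter Set
open scoped Topology ContDiff

/-- `∫ ∇v · ∇w`. -/
def gradInner (v w : ℝ × ℝ → ℝ) : ℝ := ∫ p, (dx v p * dx w p + dz v p * dz w p)

lemma gradInner_self (v : ℝ × ℝ → ℝ) : gradInner v v = dirichlet v := by
  unfold gradInner dirichlet; congr 1; ext p; ring

lemma dirichlet_nonneg (v : ℝ × ℝ → ℝ) : 0 ≤ dirichlet v := integral_nonneg fun _ => by positivity

lemma abs_gradInner_le {v w : ℝ × ℝ → ℝ} (hv : MemLp (dx v) 2 ∧ MemLp (dz v) 2)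
    (hw : MemLp (dx w) 2 ∧ MemLp (dz w) 2) : |gradInner v w| ≤ √(dirichlet v) * √(dirichlet w) :=
  abs_integral_add_le hv.1 hv.2 hw.1 hw.2

section Motion

variable {J : Set ℝ} {h : ℝ → ℝ → ℝ} {f : ℝ → ℝ × ℝ → ℝ} {F : Bool → ℝ × (ℝ × ℝ) → ℝ}

/-- Continuity in time of `∇f` with respect to the `L²` norm. -/
lemma IsExtension.tendsto_grad (hS : IsSolution J h f) (hJ : IsOpen J) (hF : IsExtension J h f F)
    {t : ℝ} (ht : t ∈ J) :
    Tendsto (fun s => ∫ p, ((dx (f s) p - dx (f t) p) ^ 2 + (dz (f s) p - dz (f t) p) ^ 2))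
      (𝓝 t) (𝓝 0) := by
  classical
  have hl := hS.regular_height.smooth_lift
  have ch := (contDiff_height hJ hl ht).continuous
  apply tendsto_of_seq_tendsto
  intro u hu
  -- Times outside `J` are replaced by `t`, so that every term has the regularity of a solution;
  -- eventually this changes nothing.
  set v : ℕ → ℝ := fun n => if u n ∈ J then u n else t with hv
  have hvu : ∀ᶠ n in atTop, v n = u n := by
    filter_upwards [hu.eventually (hJ.mem_nhds ht)] with n hn using if_pos hn
  have hvJ : ∀ n, v n ∈ J := fun n => by
    simp only [hv]; split_ifs with h
    · exact h
    · exact ht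
  have hvt : Tendsto v atTop (𝓝 t) := hu.congr' (hvu.mono fun n hn => hn.symm)
  have hgrad := fun n => hF.memLp_grad hS hJ (hvJ n)
  have hgrad' := hF.memLp_grad hS hJ ht
  have hne : ∀ᵐ p : ℝ × ℝ, p.2 - h t p.1 ≠ 0 := by
    have h1 : ∀ᵐ z : ℝ × ℝ, (shift (h t) z).2 - h t (shift (h t) z).1 ≠ 0 := by
      filter_upwards [ae_snd_ne 0] with z hz
      simpa [shift] using hz
    have h2 := (measurePreserving_shift ch).map_eq
    rw [← h2]
    exact (measurableEmbedding_shift ch).ae_map_iff.2 h1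
  have hlim : ∀ e : ℝ × ℝ, ∀ᵐ p : ℝ × ℝ, Tendsto (fun n => fderiv ℝ (f (v n)) p e) atTop
      (𝓝 (fderiv ℝ (f t) p e)) := fun e => by
    filter_upwards [hne] with p hp
    set i := decide (0 < p.2 - h t p.1) with hi
    have hP : ((t, p) : ℝ × (ℝ × ℝ)) ∈ phase J h i := ⟨mem_slab ht p, sgn_decide_mul_pos hp⟩
    have hc : ContinuousAt (pd (F i) (0, e)) (t, p) :=
      (differentiableAt_slab hJ (contDiffOn_pd hJ (hF.smooth i) _) hP.1).continuousAt
    have hvp : Tendsto (fun n => ((v n, p) : ℝ × (ℝ × ℝ))) atTop (𝓝 (t, p)) :=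
      hvt.prodMk_nhds tendsto_const_nhds
    have h1 := hc.tendsto.comp hvp
    rw [← hF.fderiv_eq hJ hl hP e] at h1
    refine h1.congr' ?_
    filter_upwards [hvp.eventually ((isOpen_phase hJ hl i).mem_nhds hP)] with n hn
    exact (hF.fderiv_eq hJ hl hn e).symm
  -- Pointwise convergence holds off the graph at time `t`, and the norms converge because `D` is
  -- differentiable in time and hence continuous.
  have key := tendsto_integral_sq_sub (fun n => (hgrad n).1) (fun n => (hgrad n).2) hgrad'.1 hgrad'.2
    (hlim (1, 0)) (hlim (0, 1))
    ((hS.hasDerivAt_dirichlet hJ hF ht).continuousAt.tendsto.comp hvt)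
  refine key.congr' ?_
  filter_upwards [hvu] with n hn
  rw [hn]; rfl

/-- The source tested with `ψ` has derivative `-∫ ∇f(τ) · ∇ψ`, and `∇f(τ)` is close to `∇f(t)` in
L², so the mean value inequality applies. The error depends on `ψ` only through its Dirichlet
integral; this uniformity allows test functions that vary with `s`. -/
lemma IsExtension.source_increment (hS : IsSolution J h f) (hJ : IsOpen J) (hF : IsExtension J h f F)
    {t : ℝ} (ht : t ∈ J) {ε : ℝ} (hε : 0 < ε) : ∀ᶠ s in 𝓝 t, s ∈ J ∧
      ∀ ψ : ℝ × ℝ → ℝ, ContDiff ℝ 1 ψ → HasCompactSupport ψ →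
        |(∫ p, source (h s) p * ψ p) - (∫ p, source (h t) p * ψ p) + (s - t) * gradInner (f t) ψ| ≤
          ε * √(dirichlet ψ) * |s - t| := by
  have hlim := hF.tendsto_grad hS hJ ht
  have hev := (hlim.eventually (gt_mem_nhds (by positivity : 0 < ε ^ 2))).and (hJ.mem_nhds ht)
  obtain ⟨r, hr, hball⟩ := Metric.eventually_nhds_iff_ball.1 hev
  filter_upwards [Metric.ball_mem_nhds t hr] with s hs
  refine ⟨(hball s hs).2, fun ψ hψ hc => ?_⟩
  have hψx : MemLp (dx ψ) 2 := (continuous_dx hψ).memLp_of_hasCompactSupport (hasCompactSupport_dx hc)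
  have hψz : MemLp (dz ψ) 2 := (continuous_dz hψ).memLp_of_hasCompactSupport (hasCompactSupport_dz hc)
  have hd : ∀ τ ∈ Metric.ball t r, HasDerivAt
      (fun τ => (∫ p, source (h τ) p * ψ p) + τ * gradInner (f t) ψ)
      (-gradInner (f τ) ψ + gradInner (f t) ψ) τ := fun τ hτ => by
    have h1 := hasDerivAt_integral_source hS.regular_height hJ (hball τ hτ).2 hψ.continuous hc
    rw [← hF.weak_form hS hJ (hball τ hτ).2 hψ hc] at h1
    refine (h1.add ((hasDerivAt_id τ).mul_const (gradInner (f t) ψ))).congr_deriv ?_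
    rw [one_mul]; rfl
  have hb : ∀ τ ∈ Metric.ball t r, ‖-gradInner (f τ) ψ + gradInner (f t) ψ‖ ≤ ε * √(dirichlet ψ) := by
    intro τ hτ
    have g1 := hF.memLp_grad hS hJ (hball τ hτ).2
    have g2 := hF.memLp_grad hS hJ ht
    have e : gradInner (f τ) ψ - gradInner (f t) ψ = ∫ p, ((dx (f τ) p - dx (f t) p) * dx ψ p +
        (dz (f τ) p - dz (f t) p) * dz ψ p) := by
      have i1 : Integrable fun p => dx (f τ) p * dx ψ p + dz (f τ) p * dz ψ p :=
        (integrable_mul_of_memLp g1.1 hψx).add (integrable_mul_of_memLp g1.2 hψz)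
      have i2 : Integrable fun p => dx (f t) p * dx ψ p + dz (f t) p * dz ψ p :=
        (integrable_mul_of_memLp g2.1 hψx).add (integrable_mul_of_memLp g2.2 hψz)
      unfold gradInner
      rw [← integral_sub i1 i2]
      congr 1; ext p; ring
    rw [Real.norm_eq_abs, neg_add_eq_sub, abs_sub_comm, e]
    refine (abs_integral_add_le (g1.1.sub g2.1) (g1.2.sub g2.2) hψx hψz).trans ?_
    apply mul_le_mul_of_nonneg_right _ (Real.sqrt_nonneg _)
    rw [Real.sqrt_le_left hε.le]
    exact (hball τ hτ).1.le
  have := (convex_ball t r).norm_image_sub_le_of_norm_hasDerivWithin_le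
    (fun τ hτ => (hd τ hτ).hasDerivWithinAt) hb (Metric.mem_ball_self hr) hs
  simp only [Real.norm_eq_abs] at this
  refine le_trans (le_of_eq ?_) this
  congr 1; ring

/-- The squared distance is differentiable. -/
theorem IsExtension.hasDerivAt_potential (hS : IsSolution J h f) (hJ : IsOpen J)
    (hF : IsExtension J h f F) {φ : ℝ → ℝ × ℝ → ℝ} (hφ : ∀ s ∈ J, IsPotential (h s) (φ s)) {t : ℝ}
    (ht : t ∈ J) : HasDerivAt (fun s => dirichlet (φ s)) (-2 * gradInner (f t) (φ t)) t := by
  have hl := hS.regular_height.smooth_lift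
  obtain ⟨C, hC0, hC⟩ := exists_compact_approximation
  have hgf := hF.memLp_grad hS hJ ht
  have gφ : ∀ s ∈ J, MemLp (dx (φ s)) 2 ∧ MemLp (dz (φ s)) 2 := fun s hs =>
    ⟨(hφ s hs).memLp_dx, (hφ s hs).memLp_dz⟩
  -- The increment estimate passes to all `C¹` functions `w` of finite Dirichlet integral. The
  -- approximations converge only weakly, with energy at most `C` times that of `w`, whence the
  -- factor `√C`.
  have incr : ∀ ε > 0, ∀ᶠ s in 𝓝 t, s ∈ J ∧ ∀ w : ℝ × ℝ → ℝ, ContDiff ℝ 1 w → MemLp (dx w) 2 →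
      MemLp (dz w) 2 → |gradInner (φ s) w - gradInner (φ t) w + (s - t) * gradInner (f t) w| ≤
        ε * (√C * √(dirichlet w)) * |s - t| := by
    intro ε hε
    filter_upwards [hF.source_increment hS hJ ht hε] with s hs
    refine ⟨hs.1, fun w hw hwx hwz => ?_⟩
    obtain ⟨ψ, h1, h2, h3, h4⟩ := hC w hw hwx hwz
    have T := (((h4 _ _ (gφ s hs.1).1 (gφ s hs.1).2).sub (h4 _ _ (gφ t ht).1 (gφ t ht).2)).add
      ((h4 _ _ hgf.1 hgf.2).const_mul (s - t))).abs
    refine le_of_tendsto T (Eventually.of_forall fun n => ?_)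
    rw [(hφ s hs.1).weak_compact (contDiff_height hJ hl hs.1).continuous.measurable (h1 n) (h2 n),
      (hφ t ht).weak_compact (contDiff_height hJ hl ht).continuous.measurable (h1 n) (h2 n)]
    refine (hs.2 (ψ n) (h1 n) (h2 n)).trans ?_
    rw [← Real.sqrt_mul hC0]
    have : √(dirichlet (ψ n)) ≤ √(C * dirichlet w) := Real.sqrt_le_sqrt (h3 n)
    gcongr
  set A := gradInner (f t) (φ t) with hA
  set H := dirichlet (φ t) with hH
  set D := dirichlet (f t) with hD
  rw [hasDerivAt_iff_isLittleO, Asymptotics.isLittleO_iff]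
  intro c hc
  set ε : ℝ := min 1 (c / (4 * (√C * √H + 1))) with hεdef
  have hε : 0 < ε := by positivity
  have hε1 : ε ≤ 1 := min_le_left _ _
  have hε2 : 2 * (ε * (√C * √H)) ≤ c / 2 := by
    have h1 : ε ≤ c / (4 * (√C * √H + 1)) := min_le_right _ _
    rw [le_div_iff₀ (by positivity)] at h1
    nlinarith
  set L : ℝ := √D + √C with hL
  have hL0 : 0 ≤ L := by positivity
  have hnear : ∀ᶠ s in 𝓝 t, |s - t| * L ^ 2 ≤ c / 2 := by
    have : Tendsto (fun s => |s - t| * L ^ 2) (𝓝 t) (𝓝 (|t - t| * L ^ 2)) :=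
      (by fun_prop : Continuous fun s : ℝ => |s - t| * L ^ 2).tendsto t
    rw [sub_self, abs_zero, zero_mul] at this
    exact this.eventually (ge_mem_nhds (by positivity))
  filter_upwards [incr ε hε, hnear] with s hs hsn
  obtain ⟨hsJ, hs⟩ := hs
  have gt' := gφ t ht
  have gs := gφ s hsJ
  set w : ℝ × ℝ → ℝ := fun p => φ s p - φ t p with hw
  have wc : ContDiff ℝ 1 w := (hφ s hsJ).contDiff.sub (hφ t ht).contDiff
  have wx : dx w = fun p => dx (φ s) p - dx (φ t) p := by
    ext p
    simp only [dx, hw]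
    rw [fderiv_fun_sub ((hφ s hsJ).contDiff.differentiable one_ne_zero p)
      ((hφ t ht).contDiff.differentiable one_ne_zero p)]; rfl
  have wz : dz w = fun p => dz (φ s) p - dz (φ t) p := by
    ext p
    simp only [dz, hw]
    rw [fderiv_fun_sub ((hφ s hsJ).contDiff.differentiable one_ne_zero p)
      ((hφ t ht).contDiff.differentiable one_ne_zero p)]; rfl
  have gw : MemLp (dx w) 2 ∧ MemLp (dz w) 2 := by
    rw [wx, wz]; exact ⟨gs.1.sub gt'.1, gs.2.sub gt'.2⟩
  have int : ∀ {a b : ℝ × ℝ → ℝ}, MemLp (dx a) 2 ∧ MemLp (dz a) 2 → MemLp (dx b) 2 ∧ MemLp (dz b) 2 →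
      Integrable fun p => dx a p * dx b p + dz a p * dz b p := fun ha hb =>
    (integrable_mul_of_memLp ha.1 hb.1).add (integrable_mul_of_memLp ha.2 hb.2)
  have e1 : dirichlet w = gradInner (φ s) w - gradInner (φ t) w := by
    rw [← gradInner_self]
    unfold gradInner
    rw [← integral_sub (int gs gw) (int gt' gw)]
    congr 1; ext p; rw [wx, wz]; ring
  have e2 : gradInner (φ s) w - gradInner (φ t) w =
      dirichlet (φ s) - 2 * gradInner (φ s) (φ t) + H := by
    rw [hH, ← gradInner_self, ← gradInner_self, ← e1, ← gradInner_self]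
    unfold gradInner
    rw [← integral_const_mul, ← integral_sub (int gs gs) ((int gs gt').const_mul 2)]
    have i1 : Integrable fun p => (dx (φ s) p * dx (φ s) p + dz (φ s) p * dz (φ s) p) -
      2 * (dx (φ s) p * dx (φ t) p + dz (φ s) p * dz (φ t) p) := (int gs gs).sub ((int gs gt').const_mul 2)
    rw [← integral_add i1 (int gt' gt')]
    congr 1; ext p; rw [wx, wz]; ring
  have b1 := hs (φ t) (hφ t ht).contDiff gt'.1 gt'.2
  have b2 := hs w wc gw.1 gw.2
  rw [gradInner_self (φ t), ← hA, ← hH] at b1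
  have b3 := abs_gradInner_le hgf gw
  rw [← hD] at b3
  rw [← e1] at b2
  set W := √(dirichlet w) with hWdef
  have hW0 : 0 ≤ W := Real.sqrt_nonneg _
  have hWsq : W ^ 2 = dirichlet w := Real.sq_sqrt (dirichlet_nonneg w)
  rw [← hWsq] at b2
  have hst : 0 ≤ |s - t| := abs_nonneg _
  -- The increment estimate with `w = φ s - φ t` as test function. Cancelling one factor `W` gives
  -- `W = O(|s - t|)`.
  have b4 : W ^ 2 ≤ |s - t| * L * W := by
    have h1 : |(s - t) * gradInner (f t) w| ≤ |s - t| * (√D * W) := by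
      rw [abs_mul]; exact mul_le_mul_of_nonneg_left b3 hst
    have h2 : ε * (√C * W) * |s - t| ≤ 1 * (√C * W) * |s - t| := by gcongr
    have h3 := neg_abs_le ((s - t) * gradInner (f t) w)
    have h4 := le_abs_self (W ^ 2 + (s - t) * gradInner (f t) w)
    rw [hL]
    linarith
  have b5 : W ≤ |s - t| * L := by
    rcases hW0.eq_or_lt with h0 | h0
    · rw [← h0]; positivity
    · exact le_of_mul_le_mul_right (by rw [← sq]; exact b4) h0
  have b6 : W ^ 2 ≤ c / 2 * |s - t| := by
    calc W ^ 2 ≤ (|s - t| * L) ^ 2 := pow_le_pow_left₀ hW0 b5 2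
      _ = |s - t| * L ^ 2 * |s - t| := by ring
      _ ≤ _ := mul_le_mul_of_nonneg_right hsn hst
  have b7 : 2 * |gradInner (φ s) (φ t) - H + (s - t) * A| ≤ c / 2 * |s - t| := by
    calc _ ≤ 2 * (ε * (√C * √H) * |s - t|) := by linarith
      _ = 2 * (ε * (√C * √H)) * |s - t| := by ring
      _ ≤ _ := mul_le_mul_of_nonneg_right hε2 hst
  -- Expansion of the square about `φ t`: the linear part is governed by the increment estimate with
  -- test function `φ t`, and `W²` is of second order in `s - t`.
  have e3 : dirichlet (φ s) - H - (s - t) * (-2 * A) =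
      2 * (gradInner (φ s) (φ t) - H + (s - t) * A) + W ^ 2 := by
    rw [hWsq, e1, e2]; ring
  rw [Real.norm_eq_abs, Real.norm_eq_abs, smul_eq_mul, e3]
  refine (abs_add_le _ _).trans ?_
  rw [abs_mul, abs_two, abs_of_nonneg (sq_nonneg W)]
  linarith

end Motion

end MullinsSekerka

end

/-! ### Testing the equation of the potential with `f` -/

noncomputable section

namespace MullinsSekerka

open MeasureTheory Filter Set
open scoped Topology ContDiff

/-- Two functions with the same trace glue to a Lipschitz function. -/
lemma exists_lipschitzWith_glue {Ψ : Bool → ℝ × ℝ → ℝ} (hΨ : ∀ i, ContDiff ℝ 1 (Ψ i))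
    (hc : ∀ i, HasCompactSupport (Ψ i)) (htr : ∀ x, Ψ true (x, 0) = Ψ false (x, 0)) :
    ∃ C, LipschitzWith C (glue Ψ) := by
  obtain ⟨C1, h1⟩ := (hΨ true).lipschitzWith_of_hasCompactSupport (hc true) one_ne_zero
  obtain ⟨C2, h2⟩ := (hΨ false).lipschitzWith_of_hasCompactSupport (hc false) one_ne_zero
  -- Written with `max` and `min`, the glued function is a combination of Lipschitz maps, and no
  -- case distinction across the line is needed.
  have e : glue Ψ = fun z => Ψ true (z.1, max z.2 0) + Ψ false (z.1, min z.2 0) - Ψ true (z.1, 0) := by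
    ext z
    rcases le_or_gt z.2 0 with h | h
    · rw [glue_of_nonpos Ψ h, max_eq_right h, min_eq_left h]; ring
    · rw [glue_of_pos Ψ h, max_eq_left h.le, min_eq_right h.le, htr]; ring
  have f1 : LipschitzWith 1 (fun z : ℝ × ℝ => z.1) := LipschitzWith.prod_fst
  have f2 : LipschitzWith 1 (fun z : ℝ × ℝ => z.2) := LipschitzWith.prod_snd
  rw [e]
  exact ⟨_, ((h1.comp (f1.prodMk (f2.max_const 0))).add (h2.comp (f1.prodMk (f2.min_const 0)))).sub
    (h1.comp (f1.prodMk (LipschitzWith.const 0)))⟩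

lemma glue_eventuallyEq (Ψ : Bool → ℝ × ℝ → ℝ) {z : ℝ × ℝ} (hz : z.2 ≠ 0) :
    glue Ψ =ᶠ[𝓝 z] Ψ (decide (0 < z.2)) := by
  have hs := sgn_decide_mul_pos hz
  rcases lt_or_gt_of_ne hz with h | h
  · have : {w : ℝ × ℝ | w.2 < 0} ∈ 𝓝 z := (isOpen_lt continuous_snd continuous_const).mem_nhds h
    filter_upwards [this] with w hw
    rw [glue_of_nonpos Ψ (le_of_lt hw), decide_eq_false (not_lt.2 h.le)]
  · have : {w : ℝ × ℝ | 0 < w.2} ∈ 𝓝 z := (isOpen_lt continuous_const continuous_snd).mem_nhds h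
    filter_upwards [this] with w hw
    rw [glue_of_pos Ψ hw, decide_eq_true h]

/-- The inverse of `shift η`. -/
def unshift (η : ℝ → ℝ) (p : ℝ × ℝ) : ℝ × ℝ := (p.1, p.2 - η p.1)

lemma unshift_shift (η : ℝ → ℝ) (z : ℝ × ℝ) : unshift η (shift η z) = z := by simp [unshift, shift]

lemma contDiff_unshift {η : ℝ → ℝ} (hη : ContDiff ℝ ∞ η) : ContDiff ℝ ∞ (unshift η) := by
  unfold unshift; fun_prop

lemma source_shift_mul_eq (η : ℝ → ℝ) (v : ℝ × ℝ → ℝ) (x : ℝ) :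
    ∫ z in (0 : ℝ)..η x, v (unshift η (x, z)) = ∫ y in (-η x)..0, v (x, y) := by
  have := intervalIntegral.integral_comp_sub_right (fun y => v (x, y)) (η x) (a := 0) (b := η x)
  simp only [zero_sub, sub_self] at this
  exact this

/-- Testing the equation for `φ` with a function that is smooth up to the graph from each side. -/
lemma IsPotential.weak_glue {η : ℝ → ℝ} {φ : ℝ × ℝ → ℝ} (hφ : IsPotential η φ) (hη : ContDiff ℝ ∞ η)
    (hL : ∀ x, |deriv η x| ≤ 1) {Ψ : Bool → ℝ × ℝ → ℝ} (hΨ : ∀ i, ContDiff ℝ 1 (Ψ i))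
    (hc : ∀ i, HasCompactSupport (Ψ i)) (htr : ∀ x, Ψ true (x, 0) = Ψ false (x, 0)) :
    ∫ z, (dx φ (shift η z) * (glue (fun i => dx (Ψ i)) z - deriv η z.1 * glue (fun i => dz (Ψ i)) z) +
      dz φ (shift η z) * glue (fun i => dz (Ψ i)) z) = -∫ x, ∫ y in (-η x)..0, glue Ψ (x, y) := by
  obtain ⟨C, hC⟩ := exists_lipschitzWith_glue hΨ hc htr
  have hηL : LipschitzWith 1 η := lipschitzWith_of_nnnorm_deriv_le (hη.differentiable (by simp))
    fun x => by exact_mod_cast hL x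
  have f1 : LipschitzWith 1 (fun z : ℝ × ℝ => z.1) := LipschitzWith.prod_fst
  have f2 : LipschitzWith 1 (fun z : ℝ × ℝ => z.2) := LipschitzWith.prod_snd
  have hL1 := hC.comp (f1.prodMk (f2.sub (hηL.comp f1)))
  set ψ : ℝ × ℝ → ℝ := fun p => glue Ψ (unshift η p) with hψ
  have hψL : LipschitzWith _ ψ := hL1
  have hgc : HasCompactSupport (glue Ψ) := by
    refine HasCompactSupport.of_support_subset_isCompact ((hc true).isCompact.union (hc false).isCompact)
      fun z hz => ?_
    simp only [glue, Function.mem_support] at hz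
    rcases hb : decide (0 < z.2) with _ | _
    · rw [hb] at hz; exact Or.inr (subset_tsupport _ hz)
    · rw [hb] at hz; exact Or.inl (subset_tsupport _ hz)
  have hψc : HasCompactSupport ψ := hgc.comp_homeomorph (shiftHomeomorph hη.continuous).symm
  have key := hφ.weak_lipschitz hη.continuous.measurable hψL hψc
  rw [integral_source_mul hη.continuous.measurable hψL.continuous hψc,
    ← integral_comp_shift hη.continuous] at key
  simp only [hψ, source_shift_mul_eq] at key
  rw [← key]
  apply integral_congr_ae
  filter_upwards [ae_snd_ne 0] with z hz
  have hev := glue_eventuallyEq Ψ hz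
  set i := decide (0 < z.2) with hi
  have hsm : ContDiff ℝ 1 fun p => Ψ i (unshift η p) :=
    (hΨ i).comp ((contDiff_unshift hη).of_le (by simp))
  have hψev : ψ =ᶠ[𝓝 (shift η z)] fun p => Ψ i (unshift η p) := by
    have hcont : Tendsto (unshift η) (𝓝 (shift η z)) (𝓝 z) := by
      have := (contDiff_unshift hη).continuous.tendsto (shift η z)
      rwa [unshift_shift] at this
    exact hcont.eventually hev
  have hd : DifferentiableAt ℝ ψ (shift η z) :=
    (hsm.differentiable one_ne_zero _).congr_of_eventuallyEq hψev
  have hcomp : (fun w => ψ (shift η w)) = glue Ψ := by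
    ext w; simp only [hψ, unshift_shift]
  have q1 := dx_comp_shift hη hd
  have q2 := dz_comp_shift hη hd
  rw [hcomp] at q1 q2
  have r1 : dx (glue Ψ) z = dx (Ψ i) z := by unfold dx; rw [hev.fderiv_eq]
  have r2 : dz (glue Ψ) z = dz (Ψ i) z := by unfold dz; rw [hev.fderiv_eq]
  rw [r1] at q1
  rw [r2] at q2
  have g1 : glue (fun i => dx (Ψ i)) z = dx (Ψ i) z := rfl
  have g2 : glue (fun i => dz (Ψ i)) z = dz (Ψ i) z := rfl
  rw [g1, g2, q1, q2]
  change _ = dx φ (shift η z) * dx ψ (shift η z) + dz φ (shift η z) * dz ψ (shift η z)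
  ring

section Pairing

variable {η u : ℝ → ℝ} {g p q gt pt qt : Bool → ℝ × ℝ → ℝ}

lemma FlatSolution.memLp_height_pow (S : FlatSolution η u g p q gt pt qt) :
    MemLp (fun x => |η x| * √|η x|) 2 := by
  obtain ⟨A, -, hA⟩ := exists_abs_le S.smooth_η S.memLp_η S.memLp_η1
  have h1 : MemLp (fun x => √|η x| * |η x|) 2 := by
    refine memLp_bounded_mul (A := √A) (Real.continuous_sqrt.comp
      S.smooth_η.continuous.abs).aestronglyMeasurable (fun x => ?_) S.memLp_η.abs
    rw [abs_of_nonneg (Real.sqrt_nonneg _)]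
    exact Real.sqrt_le_sqrt (hA x)
  refine h1.congr_norm ?_ ?_
  · exact (S.smooth_η.continuous.abs.mul
      (Real.continuous_sqrt.comp S.smooth_η.continuous.abs)).aestronglyMeasurable
  · exact Eventually.of_forall fun x => by rw [mul_comm]

/-- The deviation from `c` is at most `√|r| b` on an interval of length `|r|`. In the application
`v` is `f` on the vertical segment from the axis to the graph and `c` is the curvature. -/
lemma abs_intervalIntegral_sub_le {v : ℝ → ℝ} (hv : ∀ a b : ℝ, IntervalIntegrable v volume a b)
    {c r b : ℝ} (hb : 0 ≤ b) (h : ∀ y, |v y - c| ≤ √|y| * b) :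
    |(∫ y in (-r)..0, v y) - r * c| ≤ |r| * √|r| * b := by
  have e : (∫ y in (-r)..0, v y) - r * c = ∫ y in (-r)..0, (v y - c) := by
    rw [intervalIntegral.integral_sub (hv _ _) intervalIntegrable_const]
    simp
  rw [e, ← Real.norm_eq_abs]
  refine (intervalIntegral.norm_integral_le_of_norm_le_const (C := √|r| * b) fun y hy => ?_).trans ?_
  · rw [Real.norm_eq_abs]
    refine (h y).trans (mul_le_mul_of_nonneg_right (Real.sqrt_le_sqrt ?_) hb)
    rcases le_total 0 r with h0 | h0
    · rw [uIoc_of_le (by linarith)] at hy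
      rw [abs_of_nonneg h0, abs_of_nonpos hy.2]; linarith [hy.1]
    · rw [uIoc_of_ge (by linarith)] at hy
      rw [abs_of_nonpos h0, abs_of_pos hy.1]; exact hy.2
  · rw [zero_sub, neg_neg]; apply le_of_eq; ring

/-- `∫ ∇f · ∇φ` in terms of the curvature, up to an error. -/
theorem FlatSolution.pairing (S : FlatSolution η u g p q gt pt qt) (hL : ∀ x, |deriv η x| ≤ 1)
    {φ : ℝ × ℝ → ℝ} (hφ : IsPotential η φ) :
    |(∫ z, (glue p z * dx φ (shift η z) + glue q z * dz φ (shift η z))) + ∫ x, η x * curvature η x| ≤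
      √(∫ x, |η x| ^ 3) * l2norm (glue q) := by
  obtain ⟨M, hM0, ex, ez⟩ := exists_isCutoffError
  have hg1 : ∀ i, ContDiff ℝ 1 (g i) := fun i => (S.smooth_g i).of_le (by simp)
  have Ly : MemLp (glue fun i => dz (g i)) 2 := S.memLp_dz_g
  obtain ⟨β, hβ0, hβ, hβn, hgrow⟩ := exists_growth_bound hg1 S.trace_g Ly
  have hq : (glue fun i => dz (g i)) = glue q := by ext z; simp only [glue, S.dz_g]
  rw [hq] at hβn
  have hgrow' : ∀ᵐ z : ℝ × ℝ, |glue g z| ≤ |curvature η z.1| + √|z.2| * β z.1 := by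
    filter_upwards [ae_fst hgrow] with z hz
    have h1 := hz z.2
    have h2 := abs_add_le (glue g z - curvature η z.1) (curvature η z.1)
    rw [sub_add_cancel] at h2
    have h3 : glue g (z.1, z.2) = glue g z := rfl
    rw [h3] at h1
    linarith
  have hgm : AEStronglyMeasurable (glue g) :=
    (measurable_glue fun i => (hg1 i).continuous.measurable).aestronglyMeasurable
  set k1 : ℝ × ℝ → ℝ := fun z => dx φ (shift η z) with hk1
  set k2 : ℝ × ℝ → ℝ := fun z => dz φ (shift η z) with hk2
  have hk1L : MemLp k1 2 := (memLp_comp_shift S.smooth_η.continuous).2 hφ.memLp_dx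
  have hk2L : MemLp k2 2 := (memLp_comp_shift S.smooth_η.continuous).2 hφ.memLp_dz
  have hk3L : MemLp (fun z => k2 z - deriv η z.1 * k1 z) 2 := hk2L.sub (S.memLp_slope_mul hk1L)
  have hc1 : ∀ n, ContDiff ℝ 1 (cutoff n) := fun n => (contDiff_cutoff n).of_le (by simp)
  have hmx : ∀ n, Measurable (dx (cutoff n)) := fun n => (continuous_dx (hc1 n)).measurable
  have hmz : ∀ n, Measurable (dz (cutoff n)) := fun n => (continuous_dz (hc1 n)).measurable
  have hmain : Integrable fun z => glue p z * k1 z + glue q z * k2 z :=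
    (integrable_mul_of_memLp S.memLp_p hk1L).add (integrable_mul_of_memLp S.memLp_q hk2L)
  have T1 := tendsto_integral_cutoff_mul hmain
  have hκ : MemLp (fun x => |curvature η x|) 2 := S.memLp_curvature.abs
  have T2 := tendsto_integral_cutoff_error ex hmx hgm hκ hβ hk1L hgrow'
  have T3 := tendsto_integral_cutoff_error ez hmz hgm hκ hβ hk3L hgrow'
  -- `I x` is the integral of `f` from the axis, which is `y = -η x` here, to the graph. It equals
  -- `η κ` up to `|η|^{3/2} β`, while the equation of the potential tested with `f` gives `-∫ I`.
  set I : ℝ → ℝ := fun x => ∫ y in (-η x)..0, glue g (x, y) with hI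
  have hgc : ∀ x, Continuous fun y => glue g (x, y) := fun x => by
    have e : (fun y => glue g (x, y)) = fun y => g true (x, max y 0) + g false (x, min y 0) -
        g true (x, 0) := by
      ext y
      rcases le_or_gt y 0 with h | h
      · rw [glue_of_nonpos g (q := (x, y)) h, max_eq_right h, min_eq_left h]; ring
      · rw [glue_of_pos g (q := (x, y)) h, max_eq_left h.le, min_eq_right h.le, S.trace_g, S.trace_g]
        ring
    rw [e]
    have := (S.smooth_g true).continuous
    have := (S.smooth_g false).continuous
    fun_prop
  have hIb : ∀ᵐ x, |I x - η x * curvature η x| ≤ |η x| * √|η x| * β x := by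
    filter_upwards [hgrow] with x hx
    exact abs_intervalIntegral_sub_le (fun a b => (hgc x).intervalIntegrable a b) (hβ0 x) hx
  have hcube := S.memLp_height_pow
  have hcubeβ : Integrable fun x => |η x| * √|η x| * β x := integrable_mul_of_memLp hcube hβ
  have hηκ : Integrable fun x => η x * curvature η x := integrable_mul_of_memLp S.memLp_η S.memLp_curvature
  set bnd : ℝ → ℝ := fun x => |η x| * (|curvature η x| + √|η x| * β x) with hbnd
  have hbi : Integrable bnd := by
    refine (hηκ.abs.add hcubeβ).congr (Eventually.of_forall fun x => ?_)
    simp only [hbnd, Pi.add_apply, abs_mul]; ring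
  have joint : Continuous (glue g) := by
    have e : glue g = fun z => g true (z.1, max z.2 0) + g false (z.1, min z.2 0) - g true (z.1, 0) := by
      ext z
      rcases le_or_gt z.2 0 with h | h
      · rw [glue_of_nonpos g h, max_eq_right h, min_eq_left h]; ring
      · rw [glue_of_pos g h, max_eq_left h.le, min_eq_right h.le, S.trace_g, S.trace_g]; ring
    rw [e]
    have := (S.smooth_g true).continuous
    have := (S.smooth_g false).continuous
    fun_prop
  have measI : ∀ {v : ℝ × ℝ → ℝ}, Continuous v → Continuous fun x => ∫ y in (-η x)..0, v (x, y) := by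
    intro v hv
    have h1 := (intervalIntegral.continuous_parametric_intervalIntegral_of_continuous (μ := volume)
      (f := fun x y => v (x, y)) (a₀ := 0) hv S.smooth_η.continuous.neg).neg
    refine h1.congr fun x => ?_
    exact (intervalIntegral.integral_symm _ _).symm
  have T4 : Tendsto (fun n => ∫ x, ∫ y in (-η x)..0, cutoff n (x, y) * glue g (x, y)) atTop
      (𝓝 (∫ x, I x)) := by
    apply tendsto_integral_of_dominated_convergence bnd
    · exact fun n => (measI ((hc1 n).continuous.mul joint)).aestronglyMeasurable
    · exact hbi
    · intro n
      filter_upwards [hgrow] with x hx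
      refine (intervalIntegral.norm_integral_le_of_norm_le_const
        (C := |curvature η x| + √|η x| * β x) fun y hy => ?_).trans ?_
      · rw [norm_mul, Real.norm_of_nonneg (cutoff_mem_Icc n _).1]
        refine (mul_le_of_le_one_left (norm_nonneg _) (cutoff_mem_Icc n _).2).trans ?_
        have hy' : |y| ≤ |η x| := by
          rcases le_total 0 (η x) with h0 | h0
          · rw [uIoc_of_le (by linarith)] at hy
            rw [abs_of_nonneg h0, abs_of_nonpos hy.2]; linarith [hy.1]
          · rw [uIoc_of_ge (by linarith)] at hy
            rw [abs_of_nonpos h0, abs_of_pos hy.1]; exact hy.2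
        have h2 := abs_add_le (glue g (x, y) - curvature η x) (curvature η x)
        rw [sub_add_cancel] at h2
        have h3 := mul_le_mul_of_nonneg_right (Real.sqrt_le_sqrt hy') (hβ0 x)
        rw [Real.norm_eq_abs]
        linarith [hx y]
      · rw [zero_sub, neg_neg]; apply le_of_eq; simp only [hbnd]; ring
    · refine Eventually.of_forall fun x => ?_
      apply tendsto_const_nhds.congr'
      obtain ⟨N, hN⟩ := exists_nat_ge (max |x| |η x|)
      filter_upwards [eventually_ge_atTop N] with n hn
      have hn' : (N : ℝ) ≤ n := by exact_mod_cast hn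
      have hn0 : (0 : ℝ) < n + 1 := by positivity
      apply intervalIntegral.integral_congr
      intro y hy
      have hy' : |y| ≤ |η x| := by
        rcases le_total 0 (η x) with h0 | h0
        · rw [uIcc_of_le (by linarith)] at hy
          rw [abs_of_nonneg h0, abs_of_nonpos hy.2]; linarith [hy.1]
        · rw [uIcc_of_ge (by linarith)] at hy
          rw [abs_of_nonpos h0, abs_of_nonneg hy.1]; exact hy.2
      have hs : ∀ r : ℝ, |r| ≤ max |x| |η x| → lineBump (r / ((n : ℝ) + 1)) = 1 := fun r hr =>
        lineBump_eq_one (by rw [abs_div, abs_of_pos hn0, div_le_one hn0]; linarith)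
      have : cutoff n (x, y) = 1 := by
        simp [cutoff, hs x (le_max_left _ _), hs y (hy'.trans (le_max_right _ _))]
      simp [this]
  -- The equation of the potential is tested with the truncation `χ_n f`. The terms with derivatives
  -- of the cutoff `χ_n` vanish in the limit for the same reason as in `green`.
  have hid : ∀ n, ((∫ z, cutoff n z * (glue p z * k1 z + glue q z * k2 z)) +
      (∫ z, glue g z * dx (cutoff n) z * k1 z)) +
      (∫ z, glue g z * dz (cutoff n) z * (k2 z - deriv η z.1 * k1 z)) =
      -∫ x, ∫ y in (-η x)..0, cutoff n (x, y) * glue g (x, y) := by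
    intro n
    have hw := hφ.weak_glue S.smooth_η hL (Ψ := fun i z => cutoff n z * g i z)
      (fun i => (hc1 n).mul (hg1 i)) (fun i => (hasCompactSupport_cutoff n).mul_right)
      (fun x => by rw [S.trace_g, S.trace_g])
    have e : ∀ x y, glue (fun i z => cutoff n z * g i z) (x, y) = cutoff n (x, y) * glue g (x, y) :=
      fun x y => rfl
    simp only [e] at hw
    rw [← hw]
    have hsupp : ∀ {e : ℝ × ℝ → ℝ}, Continuous e → HasCompactSupport e →
        MemLp (fun z => glue g z * e z) 2 := fun he hec =>
      (joint.mul he).memLp_of_hasCompactSupport hec.mul_left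
    have i1 : Integrable fun z => cutoff n z * (glue p z * k1 z + glue q z * k2 z) := by
      refine hmain.abs.mono' ((hc1 n).continuous.aestronglyMeasurable.mul hmain.1)
        (Eventually.of_forall fun z => ?_)
      rw [norm_mul, Real.norm_eq_abs, Real.norm_eq_abs, abs_of_nonneg (cutoff_mem_Icc n z).1]
      exact mul_le_of_le_one_left (abs_nonneg _) (cutoff_mem_Icc n z).2
    have i2 := integrable_mul_of_memLp (hsupp (continuous_dx (hc1 n))
      (hasCompactSupport_dx (hasCompactSupport_cutoff n))) hk1L
    have i3 := integrable_mul_of_memLp (hsupp (continuous_dz (hc1 n))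
      (hasCompactSupport_dz (hasCompactSupport_cutoff n))) hk3L
    have i12 : Integrable fun z => cutoff n z * (glue p z * k1 z + glue q z * k2 z) +
      glue g z * dx (cutoff n) z * k1 z := i1.add i2
    rw [← integral_add i1 i2, ← integral_add i12 i3]
    congr 1; ext z
    simp only [glue]
    generalize decide (0 < z.2) = i
    rw [dx_mul ((hc1 n).differentiable one_ne_zero z) ((hg1 i).differentiable one_ne_zero z),
      dz_mul ((hc1 n).differentiable one_ne_zero z) ((hg1 i).differentiable one_ne_zero z),
      S.dx_g, S.dz_g]
    simp only [hk1, hk2]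
    ring
  have T5 := (T1.add T2).add T3
  rw [add_zero, add_zero] at T5
  have hlim := tendsto_nhds_unique (T5.congr hid) T4.neg
  have hIi : Integrable I := by
    refine hbi.mono' (measI joint).aestronglyMeasurable ?_
    filter_upwards [hIb] with x hx
    have h2 := abs_add_le (I x - η x * curvature η x) (η x * curvature η x)
    rw [sub_add_cancel, abs_mul] at h2
    rw [Real.norm_eq_abs]; simp only [hbnd]; linarith
  rw [hlim, neg_add_eq_sub, ← integral_sub hηκ hIi]
  have hcn : √(∫ x, |η x| ^ 3) = l2norm fun x => |η x| * √|η x| := by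
    unfold l2norm
    congr 2; ext x
    rw [mul_pow, Real.sq_sqrt (abs_nonneg _)]; ring
  rw [hcn, ← hβn]
  have h1 : |∫ x, (η x * curvature η x - I x)| ≤ ∫ x, |η x| * √|η x| * β x := by
    rw [← Real.norm_eq_abs]
    refine norm_integral_le_of_norm_le hcubeβ ?_
    filter_upwards [hIb] with x hx
    rwa [Real.norm_eq_abs, abs_sub_comm]
  exact h1.trans ((le_abs_self _).trans (abs_integral_mul_le hcube hβ))

end Pairing

end MullinsSekerka

end

noncomputable section

namespace MullinsSekerka

open MeasureTheory Filter Set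
open scoped Topology ContDiff

/-! ### The height in terms of the squared distance -/

lemma integral_sq_comp_div_le {w : ℝ → ℝ} {B l : ℝ} (hw : ∀ x, |w x| ≤ B) (h0 : ∀ x, 2 ≤ |x| → w x = 0)
    (hl : 0 < l) : ∫ z, w (z / l) ^ 2 ≤ 4 * l * B ^ 2 := by
  have h1 : ∫ z, w (z / l) ^ 2 ≤ ∫ z, (Icc (-(2 * l)) (2 * l)).indicator (fun _ => B ^ 2) z := by
    refine integral_mono_of_nonneg (Eventually.of_forall fun _ => sq_nonneg _)
      ((integrable_indicator_iff measurableSet_Icc).2 (by simp)) (Eventually.of_forall fun z => ?_)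
    by_cases hz : z ∈ Icc (-(2 * l)) (2 * l)
    · simp only [indicator_of_mem hz]
      exact sq_le_sq.2 ((hw _).trans (le_abs_self _))
    · simp only [indicator_of_notMem hz]
      rw [h0, zero_pow two_ne_zero]
      rw [abs_div, abs_of_pos hl, le_div_iff₀ hl]
      by_contra! h2
      exact hz (abs_le.1 h2.le)
  rw [integral_indicator measurableSet_Icc, setIntegral_const,
    Real.volume_real_Icc_of_le (by linarith), smul_eq_mul] at h1
  linarith

/-- The test function is `v(x)` times a bump in `z/l`. It equals `v` on the strip `|z| ≤ l`, which
contains the graph, so the source pairs with it to `-∫ v η` exactly. The two terms on the right come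
from its horizontal and vertical derivatives. -/
lemma IsPotential.sq_integral_le_of_compact {B : ℝ} (hB : ∀ x, |deriv lineBump x| ≤ B) {η : ℝ → ℝ}
    {φ : ℝ × ℝ → ℝ} (hφ : IsPotential η φ) (hη : Continuous η) {l : ℝ} (hl : 0 < l)
    (hηl : ∀ x, |η x| ≤ l) {v : ℝ → ℝ} (hv : ContDiff ℝ ∞ v) (hc : HasCompactSupport v) :
    (∫ x, v x * η x) ^ 2 ≤ dirichlet φ *
      (4 * l * (∫ x, deriv v x ^ 2) + 4 * B ^ 2 / l * ∫ x, v x ^ 2) := by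
  have hb : ContDiff ℝ ∞ lineBump := lineBump.contDiff
  set ψ : ℝ × ℝ → ℝ := fun p => v p.1 * lineBump (p.2 / l) with hψ
  have s1 : ContDiff ℝ ∞ fun p : ℝ × ℝ => v p.1 := hv.comp contDiff_fst
  have s2 : ContDiff ℝ ∞ fun p : ℝ × ℝ => lineBump (p.2 / l) :=
    hb.comp (contDiff_snd.div_const l)
  have hψs : ContDiff ℝ ∞ ψ := s1.mul s2
  have hz : ∀ x : ℝ, 2 * l ≤ |x| → 2 ≤ |x / l| := fun x hx => by
    rwa [abs_div, abs_of_pos hl, le_div_iff₀ hl]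
  have hψc : HasCompactSupport ψ := by
    refine HasCompactSupport.of_support_subset_isCompact
      (hc.isCompact.prod (isCompact_Icc (a := -(2 * l)) (b := 2 * l))) fun p hp => ⟨?_, ?_⟩
    · refine subset_tsupport _ fun h => hp ?_
      simp [hψ, h]
    · by_contra hcon
      refine hp ?_
      simp only [hψ]
      rw [lineBump_eq_zero (hz p.2 ?_), mul_zero]
      by_contra! h2
      exact hcon (abs_le.1 h2.le)
  have ex : dx ψ = fun p => deriv v p.1 * lineBump (p.2 / l) := by
    ext p
    have h1 := hasDerivAt_dx (hψs.differentiable (by simp) p)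
    exact h1.unique ((hasDerivAt_of_contDiff hv p.1).mul_const (lineBump (p.2 / l)))
  have ez : dz ψ = fun p => v p.1 * (deriv lineBump (p.2 / l) / l) := by
    ext p
    have h1 := hasDerivAt_dz (hψs.differentiable (by simp) p)
    have h2 := (hasDerivAt_of_contDiff hb (p.2 / l)).comp p.2 ((hasDerivAt_id p.2).div_const l)
    refine h1.unique ((h2.const_mul (v p.1)).congr_deriv ?_)
    ring
  have hψ1 : ContDiff ℝ 1 ψ := hψs.of_le (by simp)
  have mx : MemLp (dx ψ) 2 := (continuous_dx hψ1).memLp_of_hasCompactSupport (hasCompactSupport_dx hψc)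
  have mz : MemLp (dz ψ) 2 := (continuous_dz hψ1).memLp_of_hasCompactSupport (hasCompactSupport_dz hψc)
  have key := hφ.weak_compact hη.measurable hψ1 hψc
  rw [integral_source_mul hη.measurable hψ1.continuous hψc] at key
  have e1 : ∀ x, ∫ z in (0 : ℝ)..η x, ψ (x, z) = v x * η x := fun x => by
    have : ∫ z in (0 : ℝ)..η x, ψ (x, z) = ∫ _z in (0 : ℝ)..η x, v x := by
      apply intervalIntegral.integral_congr
      intro z hzm
      have hz' : |z| ≤ l := by
        have h1 := hηl x
        rw [abs_le] at h1 ⊢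
        rcases le_total 0 (η x) with h0 | h0
        · rw [uIcc_of_le h0] at hzm; constructor <;> linarith [hzm.1, hzm.2]
        · rw [uIcc_of_ge h0] at hzm; constructor <;> linarith [hzm.1, hzm.2]
      have : lineBump (z / l) = 1 := lineBump_eq_one (by rwa [abs_div, abs_of_pos hl, div_le_one hl])
      simp [hψ, this]
    rw [this, intervalIntegral.integral_const, sub_zero, smul_eq_mul, mul_comm]
  simp only [e1] at key
  have h1 : |∫ p, (dx φ p * dx ψ p + dz φ p * dz ψ p)| ≤ √(dirichlet φ) * √(dirichlet ψ) :=
    abs_gradInner_le ⟨hφ.memLp_dx, hφ.memLp_dz⟩ ⟨mx, mz⟩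
  rw [key, abs_neg] at h1
  have h2 : (∫ x, v x * η x) ^ 2 ≤ dirichlet φ * dirichlet ψ := by
    rw [← sq_abs, ← Real.sq_sqrt (dirichlet_nonneg φ), ← Real.sq_sqrt (dirichlet_nonneg ψ), ← mul_pow]
    exact pow_le_pow_left₀ (abs_nonneg _) h1 2
  refine h2.trans (mul_le_mul_of_nonneg_left ?_ (dirichlet_nonneg φ))
  unfold dirichlet
  rw [integral_add mx.integrable_sq mz.integrable_sq]
  have p1 : ∫ p, dx ψ p ^ 2 = (∫ x, deriv v x ^ 2) * ∫ z, lineBump (z / l) ^ 2 := by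
    rw [← integral_prod_mul, ex]
    simp only [mul_pow]; rfl
  have p2 : ∫ p, dz ψ p ^ 2 = (∫ x, v x ^ 2) * ∫ z, (deriv lineBump (z / l) / l) ^ 2 := by
    rw [← integral_prod_mul, ez]
    simp only [mul_pow]; rfl
  have q1 : ∫ z, lineBump (z / l) ^ 2 ≤ 4 * l * 1 ^ 2 := integral_sq_comp_div_le (fun x => by
    rw [abs_of_nonneg lineBump.nonneg]; exact lineBump.le_one) (fun x hx => lineBump_eq_zero hx) hl
  have q2 : ∫ z, (deriv lineBump (z / l) / l) ^ 2 ≤ 4 * l * (B / l) ^ 2 :=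
    integral_sq_comp_div_le (w := fun x => deriv lineBump x / l) (fun x => by
      rw [abs_div, abs_of_pos hl]; gcongr; exact hB x)
      (fun x hx => by rw [deriv_lineBump_eq_zero hx, zero_div]) hl
  rw [p1, p2]
  have n1 : 0 ≤ ∫ x, deriv v x ^ 2 := integral_nonneg fun _ => sq_nonneg _
  have n2 : 0 ≤ ∫ x, v x ^ 2 := integral_nonneg fun _ => sq_nonneg _
  have r1 := mul_le_mul_of_nonneg_left q1 n1
  have r2 := mul_le_mul_of_nonneg_left q2 n2
  have e3 : 4 * l * (B / l) ^ 2 = 4 * B ^ 2 / l := by field_simp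
  rw [e3] at r2
  linarith

/-- This is the choice `v = η`, reached through cutoffs in `x`. Balancing the two terms in `l`
interpolates `∫ η²` between the squared distance and `∫ η'²`, as long as the strip contains the
graph. -/
lemma exists_height_bound : ∃ c : ℝ, 1 ≤ c ∧ ∀ (η : ℝ → ℝ) (φ : ℝ × ℝ → ℝ), IsPotential η φ →
    ContDiff ℝ ∞ η → MemLp η 2 → MemLp (deriv η) 2 → ∀ l > 0, (∀ x, |η x| ≤ l) →
    (∫ x, η x ^ 2) ^ 2 ≤ c * dirichlet φ * (l * (∫ x, deriv η x ^ 2) + (∫ x, η x ^ 2) / l) := by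
  obtain ⟨B, hB0, hB⟩ := exists_deriv_lineBump_bound
  refine ⟨8 + 4 * B ^ 2, by nlinarith [sq_nonneg B], fun η φ hφ hη h0 h1 l hl hηl => ?_⟩
  have hb : ContDiff ℝ ∞ lineBump := lineBump.contDiff
  set M := ∫ x, η x ^ 2 with hM
  set A := ∫ x, deriv η x ^ 2 with hA
  have hM0 : 0 ≤ M := integral_nonneg fun _ => sq_nonneg _
  have hA0 : 0 ≤ A := integral_nonneg fun _ => sq_nonneg _
  have hH := dirichlet_nonneg φ
  set χ : ℕ → ℝ → ℝ := fun n x => lineBump (x / (n + 1)) with hχ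
  have hn : ∀ n : ℕ, (0 : ℝ) < n + 1 := fun n => by positivity
  have χs : ∀ n, ContDiff ℝ ∞ (χ n) := fun n => hb.comp (contDiff_id.div_const _)
  have χb : ∀ n x, |χ n x| ≤ 1 := fun n x => by
    rw [abs_of_nonneg lineBump.nonneg]; exact lineBump.le_one
  have χd : ∀ n x, deriv (χ n) x = deriv lineBump (x / (n + 1)) / (n + 1) := fun n x => by
    have h2 := (hasDerivAt_of_contDiff hb (x / ((n : ℝ) + 1))).comp x
      ((hasDerivAt_id x).div_const ((n : ℝ) + 1))
    rw [mul_one_div] at h2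
    exact h2.deriv
  set v : ℕ → ℝ → ℝ := fun n x => χ n x * η x with hv
  have vs : ∀ n, ContDiff ℝ ∞ (v n) := fun n => (χs n).mul hη
  have vc : ∀ n, HasCompactSupport (v n) := fun n => by
    refine HasCompactSupport.of_support_subset_isCompact
      (isCompact_Icc (a := -(2 * ((n : ℝ) + 1))) (b := 2 * ((n : ℝ) + 1))) fun x hx => ?_
    by_contra hcon
    refine hx ?_
    have : lineBump (x / ((n : ℝ) + 1)) = 0 := lineBump_eq_zero (by
      rw [abs_div, abs_of_pos (hn n), le_div_iff₀ (hn n)]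
      by_contra! h2
      exact hcon (abs_le.1 h2.le))
    simp [hv, hχ, this]
  have vd : ∀ n x, deriv (v n) x = deriv (χ n) x * η x + χ n x * deriv η x := fun n x =>
    ((hasDerivAt_of_contDiff (χs n) x).mul (hasDerivAt_of_contDiff hη x)).deriv
  have b1 : ∀ n, ∫ x, v n x ^ 2 ≤ M := fun n =>
    integral_mono_of_nonneg (Eventually.of_forall fun _ => sq_nonneg _) h0.integrable_sq
      (Eventually.of_forall fun x => by
        simp only [hv, mul_pow]
        exact mul_le_of_le_one_left (sq_nonneg _) (by rw [← sq_abs]; exact pow_le_one₀ (abs_nonneg _) (χb n x)))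
  have b2 : ∀ n : ℕ, ∫ x, deriv (v n) x ^ 2 ≤ 2 * A + 2 * (B / (n + 1)) ^ 2 * M := fun n => by
    rw [hA, hM, ← integral_const_mul, ← integral_const_mul,
      ← integral_add (h1.integrable_sq.const_mul 2) (h0.integrable_sq.const_mul _)]
    refine integral_mono_of_nonneg (Eventually.of_forall fun _ => sq_nonneg _)
      ((h1.integrable_sq.const_mul 2).add (h0.integrable_sq.const_mul _)) (Eventually.of_forall fun x => ?_)
    have c1 : (χ n x * deriv η x) ^ 2 ≤ deriv η x ^ 2 := by
      rw [mul_pow]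
      exact mul_le_of_le_one_left (sq_nonneg _) (by rw [← sq_abs]; exact pow_le_one₀ (abs_nonneg _) (χb n x))
    have c2 : (deriv (χ n) x * η x) ^ 2 ≤ (B / (n + 1)) ^ 2 * η x ^ 2 := by
      rw [mul_pow]
      refine mul_le_mul_of_nonneg_right (sq_le_sq.2 ?_) (sq_nonneg _)
      rw [χd, abs_div, abs_of_pos (hn n), abs_of_nonneg (by positivity : 0 ≤ B / ((n : ℝ) + 1))]
      gcongr; exact hB _
    simp only [vd]
    nlinarith [sq_nonneg (deriv (χ n) x * η x - χ n x * deriv η x)]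
  have lim1 : Tendsto (fun n => ∫ x, v n x * η x) atTop (𝓝 M) := by
    apply tendsto_integral_of_dominated_convergence fun x => η x ^ 2
    · exact fun n => ((vs n).continuous.mul hη.continuous).aestronglyMeasurable
    · exact h0.integrable_sq
    · refine fun n => Eventually.of_forall fun x => ?_
      simp only [hv]
      rw [mul_assoc, ← sq, norm_mul, Real.norm_of_nonneg (sq_nonneg _)]
      exact mul_le_of_le_one_left (sq_nonneg _) (χb n x)
    · refine Eventually.of_forall fun x => ?_
      apply tendsto_const_nhds.congr'
      obtain ⟨N, hN⟩ := exists_nat_ge |x|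
      filter_upwards [eventually_ge_atTop N] with n hn'
      have : (N : ℝ) ≤ n := by exact_mod_cast hn'
      have : χ n x = 1 := lineBump_eq_one (by
        rw [abs_div, abs_of_pos (hn n), div_le_one (hn n)]; linarith)
      simp only [hv, this]; ring
  have lim2 : Tendsto (fun n : ℕ => dirichlet φ * (4 * l * (2 * A + 2 * (B / (n + 1)) ^ 2 * M) +
      4 * B ^ 2 / l * M)) atTop (𝓝 (dirichlet φ * (4 * l * (2 * A + 2 * 0 ^ 2 * M) + 4 * B ^ 2 / l * M))) := by
    have : Tendsto (fun n : ℕ => B / ((n : ℝ) + 1)) atTop (𝓝 0) := by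
      have := (tendsto_const_div_atTop_nhds_zero_nat B).comp (tendsto_add_atTop_nat 1)
      refine this.congr fun n => ?_
      simp
    exact ((((((this.pow 2).const_mul 2).mul_const M).const_add (2 * A)).const_mul (4 * l)).add_const
      _).const_mul _
  have hle := le_of_tendsto_of_tendsto' (lim1.pow 2) lim2 fun n => by
    refine (hφ.sq_integral_le_of_compact hB hη.continuous hl hηl (vs n) (vc n)).trans ?_
    gcongr
    · exact b2 n
    · exact b1 n
  refine hle.trans ?_
  have e1 : dirichlet φ * (4 * l * (2 * A + 2 * 0 ^ 2 * M) + 4 * B ^ 2 / l * M) =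
      dirichlet φ * (8 * (l * A) + 4 * B ^ 2 * (M / l)) := by ring
  rw [e1, mul_comm (8 + 4 * B ^ 2), mul_assoc (dirichlet φ)]
  apply mul_le_mul_of_nonneg_left _ hH
  have : 0 ≤ l * A := by positivity
  have : 0 ≤ M / l := by positivity
  nlinarith [sq_nonneg B, mul_nonneg (sq_nonneg B) (by positivity : 0 ≤ l * A)]

/-- The elementary inequalities behind the bound for the squared distance. -/
lemma pow_le_of_interpolation {c M A E D H Q : ℝ} (hc : 1 ≤ c) (hM : 0 ≤ M) (hA : 0 < A) (hE : 0 ≤ E)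
    (hD : 0 ≤ D) (hH : 0 ≤ H) (hQ : 0 ≤ Q) (hED : E ^ 2 * D ≤ 1) (hAE : A ≤ 3 * E) (hEA : E ≤ A)
    (hAM : A ^ 6 ≤ 98304 * M ^ 3 * D ^ 2 * E)
    (htest : ∀ l > 0, 4 * M * A ≤ l ^ 4 → M ^ 2 ≤ c * H * (l * A + M / l))
    (hQM : Q ^ 4 ≤ 4 * M ^ 5 * A) (hpair : A ≤ 2 * (√(D * H) + √(Q * D))) :
    (2 * √(Q * D)) ^ 12 ≤ (2 ^ 12 * (8 * 10 ^ 5 * c ^ 5) * 9 * (9 * 16 ^ 6 * (8 * 10 ^ 5 * c ^ 5))) *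
      (H ^ 6 * E ^ 2 * D ^ 7) := by
  have hE0 : 0 < E := by linarith
  have hM0 : 0 < M := by
    rcases hM.eq_or_lt with h | h
    · exfalso; rw [← h] at hAM
      have : 0 < A ^ 6 := by positivity
      simp at hAM; linarith
    · exact h
  -- Here the condition on `E² D` enters: it reduces `A⁶ ≲ M³ D² E` to `E⁹ ≲ M³`. This will make a
  -- strip of height comparable to `√(M/A)` contain the graph, whose height is at most `(4 M
  -- A)^{1/4}`.
  have hA3 : A ^ 3 ≤ 1300 * M := by
    have h1 : E ^ 9 ≤ (47 * M) ^ 3 := by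
      have h2 : E ^ 5 * E ≤ (98304 * M ^ 3 * D ^ 2) * E := by
        calc E ^ 5 * E = E ^ 6 := by ring
          _ ≤ A ^ 6 := pow_le_pow_left₀ hE hEA 6
          _ ≤ _ := hAM
      have h3 := le_of_mul_le_mul_right h2 hE0
      calc E ^ 9 = E ^ 5 * E ^ 4 := by ring
        _ ≤ (98304 * M ^ 3 * D ^ 2) * E ^ 4 := mul_le_mul_of_nonneg_right h3 (by positivity)
        _ = 98304 * M ^ 3 * (E ^ 2 * D) ^ 2 := by ring
        _ ≤ 98304 * M ^ 3 * 1 ^ 2 := by gcongr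
        _ ≤ (47 * M) ^ 3 := by rw [mul_pow]; nlinarith [pow_pos hM0 3]
    have h2 : E ^ 3 ≤ 47 * M := by
      refine le_of_pow_le_pow_left₀ three_ne_zero (by positivity) ?_
      calc (E ^ 3) ^ 3 = E ^ 9 := by ring
        _ ≤ _ := h1
    have h3 : A ^ 3 ≤ (3 * E) ^ 3 := pow_le_pow_left₀ hA.le hAE 3
    nlinarith
  have hM3 : M ^ 3 ≤ 100 * c ^ 2 * H ^ 2 * A := by
    set r := √(M * A) with hr
    have hr0 : 0 < r := Real.sqrt_pos.2 (by positivity)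
    have hr2 : r ^ 2 = M * A := Real.sq_sqrt (by positivity)
    -- `r / A = √(M/A)` balances the two terms. The factor 9 gives `l⁴ = 6561 M²/A²`, which exceeds
    -- `4 M A` because `A³ ≤ 1300 M`.
    have h1 := htest (9 * (r / A)) (by positivity) (by
      have e : (9 * (r / A)) ^ 4 = 6561 * M ^ 2 / A ^ 2 := by
        rw [mul_pow, div_pow, show r ^ 4 = (r ^ 2) ^ 2 by ring, hr2]; field_simp; norm_num
      rw [e, le_div_iff₀ (by positivity)]
      nlinarith [mul_le_mul_of_nonneg_left hA3 hM])
    have e1 : 9 * (r / A) * A + M / (9 * (r / A)) = (9 + 1 / 9) * r := by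
      field_simp
      rw [hr2]; ring
    rw [e1] at h1
    have h2 : M ^ 2 ≤ 10 * c * H * r := by
      have : 0 ≤ c * H * r := by positivity
      nlinarith
    have h3 : (M ^ 2) ^ 2 ≤ (10 * c * H * r) ^ 2 := pow_le_pow_left₀ (by positivity) h2 2
    rw [mul_pow, hr2] at h3
    refine le_of_mul_le_mul_right ?_ hM0
    calc M ^ 3 * M = (M ^ 2) ^ 2 := by ring
      _ ≤ _ := h3
      _ = _ := by ring
  set K : ℝ := 8 * 10 ^ 5 * c ^ 5 with hK
  have hc0 : 0 < c := by linarith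
  have hK0 : 1 ≤ K := by
    have : 1 ≤ c ^ 5 := one_le_pow₀ hc
    rw [hK]; linarith
  have hQ6 : Q ^ 6 ≤ K * H ^ 5 * A ^ 4 := by
    refine le_of_pow_le_pow_left₀ two_ne_zero (by positivity) ?_
    calc (Q ^ 6) ^ 2 = (Q ^ 4) ^ 3 := by ring
      _ ≤ (4 * M ^ 5 * A) ^ 3 := pow_le_pow_left₀ (by positivity) hQM 3
      _ = 64 * (M ^ 3) ^ 5 * A ^ 3 := by ring
      _ ≤ 64 * (100 * c ^ 2 * H ^ 2 * A) ^ 5 * A ^ 3 := by gcongr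
      _ = (K * H ^ 5 * A ^ 4) ^ 2 := by rw [hK]; ring
  have hA2D : A ^ 2 * D ≤ 9 := by
    calc A ^ 2 * D ≤ (3 * E) ^ 2 * D := by gcongr
      _ = 9 * (E ^ 2 * D) := by ring
      _ ≤ 9 := by linarith
  -- If `√(D H)` dominates in the hypothesis on `A`, the claim is immediate. Otherwise `A¹² ≲ D⁶ Q⁶
  -- ≲ (D H)⁵ A² (A² D)`, and `A² D ≤ 9` allows `A²` to be cancelled.
  have hA2 : A ^ 2 ≤ 9 * 16 ^ 6 * K * (D * H) := by
    have hDH : 0 ≤ D * H := by positivity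
    have hQD : 0 ≤ Q * D := by positivity
    rcases le_total (Q * D) (D * H) with hle | hle
    · have h1 : √(Q * D) ≤ √(D * H) := Real.sqrt_le_sqrt hle
      have h2 : A ≤ 4 * √(D * H) := by linarith
      have h3 := pow_le_pow_left₀ hA.le h2 2
      rw [mul_pow, Real.sq_sqrt hDH] at h3
      nlinarith
    · have h1 : √(D * H) ≤ √(Q * D) := Real.sqrt_le_sqrt hle
      have h2 : A ≤ 4 * √(Q * D) := by linarith
      have h3 := pow_le_pow_left₀ hA.le h2 2
      rw [mul_pow, Real.sq_sqrt hQD] at h3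
      have h4 : A ^ 10 * A ^ 2 ≤ (9 * 16 ^ 6 * K * (D * H) ^ 5) * A ^ 2 := by
        calc A ^ 10 * A ^ 2 = (A ^ 2) ^ 6 := by ring
          _ ≤ (4 ^ 2 * (Q * D)) ^ 6 := pow_le_pow_left₀ (by positivity) h3 6
          _ = 16 ^ 6 * D ^ 6 * Q ^ 6 := by ring
          _ ≤ 16 ^ 6 * D ^ 6 * (K * H ^ 5 * A ^ 4) := by gcongr
          _ = 16 ^ 6 * K * (D * H) ^ 5 * A ^ 2 * (A ^ 2 * D) := by ring
          _ ≤ 16 ^ 6 * K * (D * H) ^ 5 * A ^ 2 * 9 := by gcongr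
          _ = _ := by ring
      have h5 := le_of_mul_le_mul_right h4 (by positivity)
      refine le_of_pow_le_pow_left₀ (n := 5) (by norm_num) (by positivity) ?_
      have hbig : 1 ≤ 9 * 16 ^ 6 * K := by linarith
      calc (A ^ 2) ^ 5 = A ^ 10 := by ring
        _ ≤ 9 * 16 ^ 6 * K * (D * H) ^ 5 := h5
        _ ≤ (9 * 16 ^ 6 * K) ^ 5 * (D * H) ^ 5 := by
          gcongr
          exact le_self_pow₀ hbig (by norm_num)
        _ = _ := by ring
  -- The bound for `Q⁶` contains `A⁴`: one factor `A²` is traded for `E²` and the other for `D H`,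
  -- which produces the exponents 6, 2 and 7.
  calc (2 * √(Q * D)) ^ 12 = 2 ^ 12 * (√(Q * D) ^ 2) ^ 6 := by ring
    _ = 2 ^ 12 * D ^ 6 * Q ^ 6 := by rw [Real.sq_sqrt (by positivity)]; ring
    _ ≤ 2 ^ 12 * D ^ 6 * (K * H ^ 5 * A ^ 4) := by gcongr
    _ = 2 ^ 12 * K * D ^ 6 * H ^ 5 * A ^ 2 * A ^ 2 := by ring
    _ ≤ 2 ^ 12 * K * D ^ 6 * H ^ 5 * (3 * E) ^ 2 * (9 * 16 ^ 6 * K * (D * H)) := by gcongr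
    _ = _ := by ring

/-- The rate of change of the squared distance. -/
theorem exists_potential_bound : ∃ C : ℝ, 0 < C ∧
    ∀ (η u : ℝ → ℝ) (g p q gt pt qt : Bool → ℝ × ℝ → ℝ), FlatSolution η u g p q gt pt qt →
      (∀ x, |deriv η x| ≤ 1) → energy η ^ 2 * (∫ z, (glue p z ^ 2 + glue q z ^ 2)) ≤ 1 →
      ∀ φ : ℝ × ℝ → ℝ, IsPotential η φ →
        -2 * (∫ z, (glue p z * dx φ (shift η z) + glue q z * dz φ (shift η z))) ≤
          C * (dirichlet φ ^ (1 / 2 : ℝ) * energy η ^ (1 / 6 : ℝ) *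
            (∫ z, (glue p z ^ 2 + glue q z ^ 2)) ^ (7 / 12 : ℝ)) := by
  obtain ⟨c, hc, hbound⟩ := exists_height_bound
  set C₀ : ℝ := 2 ^ 12 * (8 * 10 ^ 5 * c ^ 5) * 9 * (9 * 16 ^ 6 * (8 * 10 ^ 5 * c ^ 5)) with hC₀
  have hC₀1 : 1 ≤ C₀ := by
    have : 1 ≤ c ^ 5 := one_le_pow₀ hc
    rw [hC₀]; nlinarith
  refine ⟨C₀, by linarith, fun η u g p q gt pt qt S hL hED φ hφ => ?_⟩
  set D := ∫ z, (glue p z ^ 2 + glue q z ^ 2) with hD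
  set E := energy η with hE
  set H := dirichlet φ with hH
  set P := ∫ z, (glue p z * dx φ (shift η z) + glue q z * dz φ (shift η z)) with hP
  set Q := ∫ x, |η x| ^ 3 with hQ
  set M := ∫ x, η x ^ 2 with hM
  set A := ∫ x, deriv η x ^ 2 with hA
  have hD0 : 0 ≤ D := integral_nonneg fun _ => by positivity
  have hE0 : 0 ≤ E := energy_nonneg η
  have hH0 : 0 ≤ H := dirichlet_nonneg φ
  have hQ0 : 0 ≤ Q := integral_nonneg fun _ => by positivity
  have hM0 : 0 ≤ M := integral_nonneg fun _ => by positivity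
  have hA0 : 0 ≤ A := integral_nonneg fun _ => by positivity
  have hrhs : 0 ≤ C₀ * (H ^ (1 / 2 : ℝ) * E ^ (1 / 6 : ℝ) * D ^ (7 / 12 : ℝ)) := by positivity
  have hpair := S.pairing hL hφ
  have hqD : l2norm (glue q) ≤ √D := by
    refine Real.sqrt_le_sqrt (integral_mono S.memLp_q.integrable_sq S.integrable_sq_add_sq fun z => ?_)
    simp only; linarith [sq_nonneg (glue p z)]
  have hpair' : |P + ∫ x, η x * curvature η x| ≤ √(Q * D) := by
    rw [Real.sqrt_mul hQ0]
    exact hpair.trans (mul_le_mul_of_nonneg_left hqD (Real.sqrt_nonneg _))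
  have hslope := integral_slope_mul S.smooth_η S.memLp_η1 S.memLp_η2 S.smooth_η S.memLp_η S.memLp_η1
  have hslopeL : MemLp (slope η) 2 := MemLp.of_abs_le S.memLp_η1
    (contDiff_slope S.smooth_η).continuous.aestronglyMeasurable (Eventually.of_forall (abs_slope_le η))
  have hAs : A ≤ 2 * ∫ x, slope η x * deriv η x := by
    rw [hA, ← integral_const_mul]
    refine integral_mono S.memLp_η1.integrable_sq
      ((integrable_mul_of_memLp hslopeL S.memLp_η1).const_mul 2) fun x => ?_
    have h1 := lineElement_pos η x
    have h2 := (lineElement_le_two hL x).2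
    have e : 2 * (slope η x * deriv η x) = 2 * deriv η x ^ 2 / lineElement η x := by
      unfold slope; ring
    simp only [e]
    rw [le_div_iff₀ h1]
    nlinarith [sq_nonneg (deriv η x)]
  have hκ : ∫ x, η x * curvature η x = -∫ x, slope η x * deriv η x := by
    rw [hslope, neg_neg]; congr 1; ext x; ring
  have hPH : |P| ≤ √(D * H) := by
    have h1 := abs_integral_add_le S.memLp_p S.memLp_q
      ((memLp_comp_shift S.smooth_η.continuous).2 hφ.memLp_dx)
      ((memLp_comp_shift S.smooth_η.continuous).2 hφ.memLp_dz)
    have e : ∫ z, (dx φ (shift η z) ^ 2 + dz φ (shift η z) ^ 2) = H :=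
      integral_comp_shift S.smooth_η.continuous fun p => dx φ p ^ 2 + dz φ p ^ 2
    rw [e] at h1
    rwa [Real.sqrt_mul hD0]
  -- `∫ η κ = -∫ sin θ · η'` is nonpositive and is dropped here. The same term is kept in `hApair`,
  -- where it bounds `A`.
  have hbase : -2 * P ≤ 2 * √(Q * D) := by
    have h1 := neg_abs_le (P + ∫ x, η x * curvature η x)
    rw [hκ] at h1 hpair'
    linarith
  have hApair : A ≤ 2 * (√(D * H) + √(Q * D)) := by
    have h1 := neg_abs_le (P + ∫ x, η x * curvature η x)
    have h2 := le_abs_self P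
    rw [hκ] at h1 hpair'
    linarith
  have hsup : ∀ x, η x ^ 4 ≤ 4 * M * A := fun x => by
    have h1 := sq_le_l2norm_mul (hasDerivAt_of_contDiff S.smooth_η) S.memLp_η S.memLp_η1 x
    have h2 := pow_le_pow_left₀ (sq_nonneg _) h1 2
    have e1 : l2norm η ^ 2 = M := l2norm_sq η
    have e2 : l2norm (deriv η) ^ 2 = A := l2norm_sq _
    calc η x ^ 4 = (η x ^ 2) ^ 2 := by ring
      _ ≤ _ := h2
      _ = 4 * l2norm η ^ 2 * l2norm (deriv η) ^ 2 := by ring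
      _ = _ := by rw [e1, e2]
  have hQsup : ∀ s, 0 ≤ s → 4 * M * A ≤ s ^ 4 → Q ≤ s * M := fun s hs hle => by
    rw [hQ, hM, ← integral_const_mul]
    refine integral_mono_of_nonneg (Eventually.of_forall fun _ => by positivity)
      (S.memLp_η.integrable_sq.const_mul s) (Eventually.of_forall fun x => ?_)
    have h1 : |η x| ≤ s := by
      refine le_of_pow_le_pow_left₀ (n := 4) (by norm_num) hs ?_
      calc |η x| ^ 4 = η x ^ 4 := by rw [← abs_pow, abs_of_nonneg (by positivity)]
        _ ≤ _ := (hsup x).trans hle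
    calc |η x| ^ 3 = |η x| * η x ^ 2 := by rw [pow_succ', sq_abs]
      _ ≤ _ := mul_le_mul_of_nonneg_right h1 (sq_nonneg _)
  refine hbase.trans ?_
  -- If `A = 0`, the height bound makes the cubic integral vanish; otherwise division by `A` is
  -- allowed.
  rcases hA0.eq_or_lt with h0 | hA1
  · have hQz : Q = 0 := by
      have := hQsup 0 le_rfl (by rw [← h0]; simp)
      linarith
    rw [hQz]; simpa using hrhs
  obtain ⟨hAE, hEA⟩ := energy_bounds S.smooth_η S.memLp_η1 hL
  -- `∫ η'² = -∫ η'' η` and Cauchy-Schwarz, combined with the bound for `∫ η''²` by dissipation and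
  -- energy.
  have hAM : A ^ 6 ≤ 98304 * M ^ 3 * D ^ 2 * E := by
    have h1 := S.integral_curv_sq_pow_le hL
    have h2 : ∫ x, deriv η x * deriv η x = -∫ x, deriv (deriv η) x * η x :=
      integral_mul_deriv_eq_deriv_mul_of_integrable
        (fun x _ => hasDerivAt_of_contDiff (contDiff_deriv S.smooth_η) x)
        (fun x _ => hasDerivAt_of_contDiff S.smooth_η x) (integrable_mul_of_memLp S.memLp_η1 S.memLp_η1)
        (integrable_mul_of_memLp S.memLp_η2 S.memLp_η) (integrable_mul_of_memLp S.memLp_η1 S.memLp_η)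
    have h3 : A ^ 2 ≤ (∫ x, deriv (deriv η) x ^ 2) * M := by
      have e : A = -∫ x, deriv (deriv η) x * η x := by
        rw [← h2, hA]; congr 1; ext x; ring
      rw [e, neg_sq]
      exact sq_integral_mul_le S.memLp_η2 S.memLp_η
    have h4 : 0 ≤ ∫ x, deriv (deriv η) x ^ 2 := integral_nonneg fun _ => by positivity
    calc A ^ 6 = (A ^ 2) ^ 3 := by ring
      _ ≤ ((∫ x, deriv (deriv η) x ^ 2) * M) ^ 3 := pow_le_pow_left₀ (by positivity) h3 3
      _ = (∫ x, deriv (deriv η) x ^ 2) ^ 3 * M ^ 3 := by ring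
      _ ≤ (98304 * D ^ 2 * E) * M ^ 3 := by gcongr
      _ = _ := by ring
  have htest : ∀ l > 0, 4 * M * A ≤ l ^ 4 → M ^ 2 ≤ c * H * (l * A + M / l) := fun l hl hle =>
    hbound η φ hφ S.smooth_η S.memLp_η S.memLp_η1 l hl fun x => by
      refine le_of_pow_le_pow_left₀ (n := 4) (by norm_num) hl.le ?_
      calc |η x| ^ 4 = η x ^ 4 := by rw [← abs_pow, abs_of_nonneg (by positivity)]
        _ ≤ _ := (hsup x).trans hle
  have hQM : Q ^ 4 ≤ 4 * M ^ 5 * A := by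
    set s := √(√(4 * M * A)) with hs
    have hs4 : s ^ 4 = 4 * M * A := by
      calc s ^ 4 = (s ^ 2) ^ 2 := by ring
        _ = _ := by rw [hs, Real.sq_sqrt (Real.sqrt_nonneg _), Real.sq_sqrt (by positivity)]
    have h1 := hQsup s (Real.sqrt_nonneg _) hs4.ge
    calc Q ^ 4 ≤ (s * M) ^ 4 := pow_le_pow_left₀ hQ0 h1 4
      _ = s ^ 4 * M ^ 4 := by ring
      _ = _ := by rw [hs4]; ring
  have hfin := pow_le_of_interpolation hc hM0 hA1 hE0 hD0 hH0 hQ0 hED hAE hEA hAM htest hQM hApair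
  rw [← hC₀] at hfin
  -- Twelve is the common denominator of the exponents 1/2, 1/6 and 7/12; `C₀ ≥ 1` permits `C₀` in
  -- place of its twelfth root.
  refine le_of_pow_le_pow_left₀ (n := 12) (by norm_num) hrhs (hfin.trans ?_)
  have pw : ∀ {x r : ℝ} (m : ℕ), 0 ≤ x → r * 12 = m → (x ^ r) ^ 12 = x ^ m := fun {x r} m hx hr => by
    rw [← Real.rpow_natCast, ← Real.rpow_mul hx]
    push_cast
    rw [hr, Real.rpow_natCast]
  clear_value C₀
  rw [mul_pow C₀, mul_pow, mul_pow, pw 6 hH0 (by norm_num), pw 2 hE0 (by norm_num), pw 7 hD0 (by norm_num)]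
  exact mul_le_mul_of_nonneg_right (le_self_pow₀ hC₀1 (by norm_num)) (by positivity)

end MullinsSekerka

end

theorem lemma4p1 :
    ∃ δ : ℝ, 0 < δ ∧ ∃ C : ℝ, 0 < C ∧
      ∀ (J : Set ℝ) (h : ℝ → ℝ → ℝ) (f : ℝ → ℝ × ℝ → ℝ), IsOpen J →
        MullinsSekerka.IsSolution J h f →
        ∀ t ∈ J, (∀ x : ℝ, |deriv (h t) x| ≤ 1) →
          MullinsSekerka.energy (h t) ^ 2 * MullinsSekerka.dirichlet (f t) ≤ δ →
          -- `dE/dt = -D`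
          HasDerivAt (fun s => MullinsSekerka.energy (h s)) (-MullinsSekerka.dirichlet (f t)) t ∧
          -- `dD/dt + ∫_Γ V_s² ds ≲ D^{5/2} + E D³`
          (DifferentiableAt ℝ (fun s => MullinsSekerka.dirichlet (f s)) t ∧
            MeasureTheory.Integrable (fun x =>
              (MullinsSekerka.arcDeriv (h t) (MullinsSekerka.normalVelocity h t) x) ^ 2 *
                MullinsSekerka.lineElement (h t) x) ∧
            deriv (fun s => MullinsSekerka.dirichlet (f s)) t +
                ∫ x : ℝ, (MullinsSekerka.arcDeriv (h t) (MullinsSekerka.normalVelocity h t) x) ^ 2 *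
                  MullinsSekerka.lineElement (h t) x ≤
              C * (MullinsSekerka.dirichlet (f t) ^ (5 / 2 : ℝ) +
                MullinsSekerka.energy (h t) * MullinsSekerka.dirichlet (f t) ^ 3)) ∧
          -- `dH/dt ≲ H^{1/2} E^{1/6} D^{7/12}`, where `H` is the Dirichlet integral of `φ`
          (∀ φ : ℝ → ℝ × ℝ → ℝ, (∀ s ∈ J, MullinsSekerka.IsPotential (h s) (φ s)) →
            DifferentiableAt ℝ (fun s => MullinsSekerka.dirichlet (φ s)) t ∧
            deriv (fun s => MullinsSekerka.dirichlet (φ s)) t ≤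
              C * (MullinsSekerka.dirichlet (φ t) ^ (1 / 2 : ℝ) *
                MullinsSekerka.energy (h t) ^ (1 / 6 : ℝ) *
                MullinsSekerka.dirichlet (f t) ^ (7 / 12 : ℝ))) := by
  obtain ⟨C₁, hC₁, hdiss⟩ := MullinsSekerka.exists_dissipation_bound
  obtain ⟨C₂, hC₂, hpot⟩ := MullinsSekerka.exists_potential_bound
  -- Any fixed bound on `E² D` would serve, as it only affects constants in the interpolation; the
  -- value one is convenient.
  refine ⟨1, one_pos, max C₁ C₂, lt_max_of_lt_left hC₁, fun J h f hJ hS t ht hL hED => ?_⟩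
  obtain ⟨F, hF⟩ := hS.regular_field.exists_isExtension
  have hl := hS.regular_height.smooth_lift
  have S := hS.flatSolution hJ hF ht
  have hD := hF.dirichlet_eq hJ hl ht
  have hE0 := MullinsSekerka.energy_nonneg (h t)
  have hD0 := MullinsSekerka.dirichlet_nonneg (f t)
  have hdd := hS.hasDerivAt_dirichlet hJ hF ht
  obtain ⟨hint, hineq⟩ := hdiss _ _ _ _ _ _ _ _ S hL
  refine ⟨hS.hasDerivAt_energy hJ ht, ⟨hdd.differentiableAt, hint, ?_⟩, fun φ hφ => ?_⟩
  · rw [hdd.deriv]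
    refine hineq.trans ?_
    rw [← hD]
    exact mul_le_mul_of_nonneg_right (le_max_left _ _) (by positivity)
  · have hd := hF.hasDerivAt_potential hS hJ hφ ht
    refine ⟨hd.differentiableAt, ?_⟩
    rw [hd.deriv]
    have hH0 := MullinsSekerka.dirichlet_nonneg (φ t)
    have hp := hpot _ _ _ _ _ _ _ _ S hL (by rw [← hD]; exact hED) (φ t) (hφ t ht)
    rw [← hD] at hp
    refine le_trans (le_of_eq ?_) (hp.trans
      (mul_le_mul_of_nonneg_right (le_max_right _ _) (by positivity)))
    congr 1
    unfold MullinsSekerka.gradInner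
    rw [← MullinsSekerka.integral_comp_shift (MullinsSekerka.contDiff_height hJ hl ht).continuous]
    apply MeasureTheory.integral_congr_ae
    filter_upwards [MullinsSekerka.ae_snd_ne 0] with z hz
    have hs := MullinsSekerka.sgn_decide_mul_pos hz
    simp only [MullinsSekerka.glue, hF.flatP_eq hJ hl ht hs, hF.flatQ_eq hJ hl ht hs]
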